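/- **Setting.** Let $h\circ \boldsymbol l:\mathbb R^2\to\mathbb R$ be the steady-state cost (plant equilibrium map $\boldsymbol l:\mathbb R^2\to\mathbb R^2$ followed by the cost $h:\mathbb R^2\to\mathbb R$). Assume that $h\circ\boldsymbol l$ is smooth at a point $\boldsymbol r^*\in\mathbb R^2$ and has a local minimum there with $\nabla(h\circ\boldsymbol l)(\boldsymbol r^*)=0$ and $\nabla^2(h\circ\boldsymbol l)(\boldsymbol r^*)$ positive definite. Put $v(\boldsymbol\rho)=(h\circ\boldsymbol l)(\boldsymbol r^*+\boldsymbol\rho)-(h\circ\boldsymbol l)(\boldsymbol r^*)$. Let $\epsilon>0$ and, for $i\in\{v,\beta\}$, let $k_i',\omega_i',\omega_{li}',\omega_{hi}',\gamma_i'>0$ be constants with $\omega_v'\neq\omega_\beta'$, such that $\sin(\omega_v'\tau)$ and $\sin(\omega_\beta'\tau)$ have a least common period $\Pi>0$. For $\boldsymbol a=(a_v,a_\beta)$ and $\delta>0$ let $\bar{\boldsymbol p}(\tau)=(a_v\sin\omega_v'\tau,\ a_\beta\sin\omega_\beta'\tau)$ and consider the reduced system for $(\tilde{\boldsymbol r},\boldsymbol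 q,\tilde{\boldsymbol\eta},\boldsymbol m)\in\mathbb R^8$ on the set $\{m_v+\epsilon>0,\ m_\beta+\epsilon>0\}$, where for $i\in\{v,\beta\}$ $$\frac{d\tilde r_i}{d\tau}=-\delta\frac{k_i'q_i}{\sqrt{m_i+\epsilon}},\qquad \frac{dq_i}{d\tau}=\delta\,\omega_{li}'\big[(v(\tilde{\boldsymbol r}+\bar{\boldsymbol p}(\tau))-\tilde\eta_i)\sin(\omega_i'\tau)-q_i\big],$$ $$\frac{d\tilde\eta_i}{d\tau}=\delta\,\omega_{hi}'\big[v(\tilde{\boldsymbol r}+\bar{\boldsymbol p}(\tau))-\tilde\eta_i\big],\qquad \frac{dm_i}{d\tau}=\delta\,\gamma_i'(q_i^2-m_i).$$ **Proposition 1.** For every $\kappa>0$ there are $\bar a,\bar\delta,\rho,C>0$ such that for all amplitudes $\boldsymbol a$ with $0<\|\boldsymbol a\|<\bar a$ and $a_v,a_\beta\ge\kappa\|\boldsymbol a\|$, and for all $0<\delta<\bar\delta$, the reduced system has exactly one $\Pi$-periodic solution $(\tilde{\boldsymbol r}^\Pi,\boldsymbol q^\Pi,\tilde{\boldsymbol\eta}^\Pi,\boldsymbol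 m^\Pi)$ that stays in the ball of radius $\rho$ about the origin. This solution is (locally) exponentially stable, and for all $\tau$ and both $i\in\{v,\beta\}$ $$|\tilde r_i^\Pi(\tau)|\le C(\delta+\|\boldsymbol a\|^2),\quad |\tilde\eta_i^\Pi(\tau)|\le C(\delta+\|\boldsymbol a\|^2),\quad |q_i^\Pi(\tau)|\le C\delta,\quad |m_i^\Pi(\tau)|\le C\delta .$$ -/

import Mathlib

open scoped ContDiff

noncomputable section

namespace ExtremumSeeking

/-- The plane with its Euclidean norm. Coordinate `0` is the speed channel `v`,
coordinate `1` is the sideslip channel `β`. -/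
abbrev Plane : Type := EuclideanSpace ℝ (Fin 2)

/-- State `(r̃, q, η̃, m)` of the controller in error coordinates; each block holds the two
channels, so this is `ℝ⁸`. -/
abbrev State : Type := Plane × Plane × Plane × Plane

/-- The (rescaled) controller constants: all are positive, and the two perturbation frequencies
are distinct. -/
structure Params where
  /-- integrator gains `k'` -/
  gain : Fin 2 → ℝ
  /-- perturbation frequencies `ω'` -/
  freq : Fin 2 → ℝ
  /-- low-pass cutoff frequencies `ω'_l` -/
  lowPass : Fin 2 → ℝ
  /-- high-pass cutoff frequencies `ω'_h` -/
  highPass : Fin 2 → ℝ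
  /-- cutoff frequencies `γ'` of the second-moment filters -/
  moment : Fin 2 → ℝ
  /-- the regularization constant `ε` of the step size adapters -/
  eps : ℝ
  gain_pos : ∀ i, 0 < gain i
  freq_pos : ∀ i, 0 < freq i
  lowPass_pos : ∀ i, 0 < lowPass i
  highPass_pos : ∀ i, 0 < highPass i
  moment_pos : ∀ i, 0 < moment i
  eps_pos : 0 < eps
  freq_ne : freq 0 ≠ freq 1

/-- `T` is the least common period of `sin (ω'_v τ)` and `sin (ω'_β τ)`. -/
def Params.IsLeastCommonPeriod (P : Params) (T : ℝ) : Prop :=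
  IsLeast {S : ℝ | 0 < S ∧ ∀ i, Function.Periodic (fun τ : ℝ => Real.sin (P.freq i * τ)) S} T

/-- The sinusoidal perturbation `p̄(τ) = (a_v sin (ω'_v τ), a_β sin (ω'_β τ))`. -/
def Params.perturbation (P : Params) (a : Plane) (τ : ℝ) : Plane :=
  WithLp.toLp 2 fun i => a i * Real.sin (P.freq i * τ)

/-- `J` has a local minimum at `rstar` with vanishing gradient and positive definite Hessian. -/
structure HasNondegenerateLocalMin (J : Plane → ℝ) (rstar : Plane) : Prop where
  isLocalMin : IsLocalMin J rstar
  gradient_eq_zero : gradient J rstar = 0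
  hessian_pos : ∀ u : Plane, u ≠ 0 → 0 < fderiv ℝ (fderiv ℝ J) rstar u u

/-- The set of states where the step size adapters are defined. -/
def Params.domain (P : Params) : Set State :=
  {z | ∀ i, 0 < z.2.2.2 i + P.eps}

/-- The shifted steady-state cost `v(ρ) = (h ∘ l)(r* + ρ) - (h ∘ l)(r*)`. -/
def shiftedCost (h : Plane → ℝ) (l : Plane → Plane) (rstar ρ : Plane) : ℝ :=
  (h ∘ l) (rstar + ρ) - (h ∘ l) rstar

/-- Right-hand side of the reduced system: the controller dynamics in the time scale `τ`, with the
plant frozen at its equilibrium `x = l (r* + r̃ + p̄(τ))`. -/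
def Params.reducedField (P : Params) (h : Plane → ℝ) (l : Plane → Plane) (rstar a : Plane)
    (δ τ : ℝ) : State → State := fun (r, q, η, m) =>
  δ •
    (WithLp.toLp 2 fun i => -(P.gain i * q i) / √(m i + P.eps),
     WithLp.toLp 2 fun i =>
       P.lowPass i * (shiftedCost h l rstar (r + P.perturbation a τ) - η i)
           * Real.sin (P.freq i * τ)
         - P.lowPass i * q i,
     WithLp.toLp 2 fun i =>
       -(P.highPass i * η i) + P.highPass i * shiftedCost h l rstar (r + P.perturbation a τ),
     WithLp.toLp 2 fun i => P.moment i * (-(m i) + q i ^ 2))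

/-- `z` solves `dz/dτ = F τ z` on `I` and stays in the domain `D` there. -/
def IsSolutionOn (F : ℝ → State → State) (D : Set State) (I : Set ℝ) (z : ℝ → State) : Prop :=
  ∀ τ ∈ I, z τ ∈ D ∧ HasDerivWithinAt z (F τ (z τ)) I τ

/-- The solution `zbar` of `dz/dτ = F τ z` is (locally, uniformly in the initial time)
exponentially stable: from every initial state close to it a solution exists for all later times,
and every such solution converges to `zbar` exponentially. -/
def IsExponentiallyStable (F : ℝ → State → State) (D : Set State) (zbar : ℝ → State) : Prop :=
  ∃ c > 0, ∃ K > 0, ∃ lam > 0, ∀ (τ₀ : ℝ) (z₀ : State), ‖z₀ - zbar τ₀‖ < c →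
    (∃ z, IsSolutionOn F D (Set.Ici τ₀) z ∧ z τ₀ = z₀) ∧
    ∀ z, IsSolutionOn F D (Set.Ici τ₀) z → z τ₀ = z₀ →
      ∀ τ ≥ τ₀, ‖z τ - zbar τ‖ ≤ K * Real.exp (-lam * (τ - τ₀)) * ‖z₀ - zbar τ₀‖

/-- `z` is a `T`-periodic solution of `dz/dτ = F τ z` in `D`, defined for all times. -/
def IsPeriodicSolution (F : ℝ → State → State) (D : Set State) (T : ℝ) (z : ℝ → State) : Prop :=
  IsSolutionOn F D Set.univ z ∧ Function.Periodic z T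

end ExtremumSeeking

end

/-! ### Reduction to a globally defined cost with uniform bounds. -/

noncomputable section
namespace ExtremumSeeking

/-! Only the germ of the cost at the minimum matters. A cutoff replaces it by a compactly supported
C³ function `v` (`RegularCost`, `exists_regularCost`), and a small ball together with small
amplitudes keeps all relevant states where the two agree.

The core is averaging, done by explicit changes of variable with all constants uniform in `a` and
`δ`. Write p for the perturbation and expand v(r+p) = v(r) + H(r,p) + H(p,p)/2 + higher order. The
map `shift` subtracts from η the current level v(r) plus the mean of H(p,p)/2, and from q and η the
periodic response to its oscillating part. The map `fast` then removes the forcing sin(ω_i τ)·H(r,p)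
and sin(ω_i τ)·ζ_i of q. Since sin(ω_i τ)·sin(ω_j τ) has mean 1/2 for i = j and 0 otherwise, what
survives demodulation is (a_i/2)·H(r,e_i). Finally `slow` takes out the quasi-steady influence of
the gradient estimate x on r. The result is a gradient-like descent y_i' = δ(-(k_i
a_i/(2√ε))·H(r,e_i) + small), with decay rate of order δ‖a‖, coupled to filters x, ζ, m that decay
at a rate of order δ.

The remainders are small against these two unequal rates (`exists_remainder_bound`): in the slow
equation their Lipschitz constant in r is (ρ+δ)‖a‖ rather than ‖a‖, and at the shifted origin they
are O(‖a‖³ + δ‖a‖²). Hence √H(y,y) + ϑ√(‖x‖²+‖ζ‖²+‖m‖²), smoothed at its zeros, decays at a rate of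
order δ‖a‖: up to the residual along one solution, and without residual along a difference of two
(`exists_lyap_decay`, `exists_lyap_estimates`). The first gives forward invariant sublevel sets of
size ‖a‖² + δ‖a‖, the second exponential contraction (`exists_contracts_and_trapping`). An iterate
of the period map is then a contraction of such a set, which produces the periodic solution and its
stability (`IsTrapping.exists_stable_periodic`).

Uniqueness is claimed in a ball whose radius does not depend on `a`, while contraction is known only
where the shifted q is O(‖a‖). The gap is closed by looking at extrema of periodic solutions: any
such solution in the ball has q = O(‖a‖) (`exists_estimate_le_of_periodic`), so two of them contract
towards each other and coincide (`Contracts.eq_of_periodic`). The sharper O(δ) bounds for q and m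
also use periodicity: q_i vanishes where r_i is maximal, and q moves at speed O(δ)
(`exists_filters_le_of_periodic`). -/

/-- A globally defined cost `v` with minimum value `0` at the origin, derivative `Dv`, Hessian `H` at
the origin, and uniform bounds by `K` on everything that enters the averaging estimates. -/
structure RegularCost (v : Plane → ℝ) (Dv : Plane → Plane →L[ℝ] ℝ)
    (H : Plane →L[ℝ] Plane →L[ℝ] ℝ) (K : ℝ) : Prop where
  one_le : 1 ≤ K
  hasFDerivAt : ∀ r, HasFDerivAt v (Dv r) r
  v_zero : v 0 = 0
  Dv_zero : Dv 0 = 0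
  abs_le : ∀ r, |v r| ≤ K
  Dv_le : ∀ r, ‖Dv r‖ ≤ K
  Dv_lip : ∀ r s, ‖Dv r - Dv s‖ ≤ K * ‖r - s‖
  Dv_taylor : ∀ r p, ‖Dv (r + p) - Dv r - H p‖ ≤ K * ((‖r‖ + ‖p‖) * ‖p‖)
  v_taylor : ∀ p, |v p - 1 / 2 * H p p| ≤ K * ‖p‖ ^ 3
  H_le : ‖H‖ ≤ K
  H_symm : ∀ x y, H x y = H y x
  H_pos : ∀ x, K⁻¹ * ‖x‖ ^ 2 ≤ H x x

/-- The form attains a positive minimum on the compact unit sphere, and both sides are homogeneous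
of degree two. -/
theorem exists_pos_mul_sq_le {E : Type*} [NormedAddCommGroup E] [NormedSpace ℝ E]
    [FiniteDimensional ℝ E] (H : E →L[ℝ] E →L[ℝ] ℝ) (hH : ∀ u, u ≠ 0 → 0 < H u u) :
    ∃ c > 0, ∀ x, c * ‖x‖ ^ 2 ≤ H x x := by
  rcases subsingleton_or_nontrivial E with hE | hE
  · exact ⟨1, one_pos, fun x => by simp [Subsingleton.elim x 0]⟩
  have : ProperSpace E := FiniteDimensional.proper ℝ E
  have hne : (Metric.sphere (0 : E) 1).Nonempty := NormedSpace.sphere_nonempty.2 zero_le_one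
  obtain ⟨x₀, hx₀, hmin⟩ := (isCompact_sphere (0 : E) 1).exists_isMinOn hne
    (f := fun x => H x x) (by fun_prop)
  have hx₀' : x₀ ≠ 0 := by
    rintro rfl
    simp at hx₀
  refine ⟨H x₀ x₀, hH _ hx₀', fun x => ?_⟩
  by_cases hx : x = 0
  · simp [hx]
  have hn : 0 < ‖x‖ := norm_pos_iff.2 hx
  have := hmin (show ‖x‖⁻¹ • x ∈ Metric.sphere (0 : E) 1 by
    simp [norm_smul, hn.ne'])
  simp only [Set.mem_ofPred_eq, map_smul, smul_apply, smul_eq_mul] at this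
  calc H x₀ x₀ * ‖x‖ ^ 2 ≤ ‖x‖⁻¹ * (‖x‖⁻¹ * H x x) * ‖x‖ ^ 2 := by gcongr
    _ = H x x := by field_simp

/-- Multiply by a bump supported well inside the ball on which `f` is smooth: outside that ball the
product vanishes locally, so the lack of smoothness of `f` there is harmless. -/
theorem exists_contDiff_hasCompactSupport_eq {E : Type*} [NormedAddCommGroup E]
    [InnerProductSpace ℝ E] [FiniteDimensional ℝ E] {f : E → ℝ} {n : ℕ}
    (hf : ContDiffAt ℝ n f 0) :
    ∃ v : E → ℝ, ContDiff ℝ n v ∧ HasCompactSupport v ∧ ∃ R > 0, ∀ x, ‖x‖ < R → v x = f x := by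
  obtain ⟨R, hR, hball⟩ := Metric.eventually_nhds_iff.1 (hf.eventually (by simp))
  let χ : ContDiffBump (0 : E) := ⟨R / 4, R / 2, by positivity, by linarith⟩
  refine ⟨fun x => χ x * f x, ?_, ?_, R / 4, by positivity, fun x hx => ?_⟩
  · rw [contDiff_iff_contDiffAt]
    intro x
    by_cases hx : dist x 0 < R
    · exact χ.contDiffAt.mul (hball hx)
    · have hx' : x ∉ tsupport χ := by
        rw [χ.tsupport_eq, Metric.mem_closedBall]
        simp only [χ]
        linarith
      have : (fun x => χ x * f x) =ᶠ[nhds x] fun _ => 0 := by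
        filter_upwards [notMem_tsupport_iff_eventuallyEq.1 hx'] with y hy
        simp [hy]
      exact contDiffAt_const.congr_of_eventuallyEq this
  · exact χ.hasCompactSupport.mul_right
  · have : χ x = 1 := χ.one_of_mem_closedBall (by simpa [χ] using hx.le)
    simp [this]

theorem exists_norm_le_and_lipschitz_of_hasCompactSupport {E F : Type*} [NormedAddCommGroup E]
    [NormedSpace ℝ E] [NormedAddCommGroup F] [NormedSpace ℝ F] {f : E → F}
    (hf : HasCompactSupport f) (h : ContDiff ℝ 1 f) :
    ∃ C, (∀ x, ‖f x‖ ≤ C) ∧ ∀ x y, ‖f x - f y‖ ≤ C * ‖x - y‖ := by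
  obtain ⟨C, hC⟩ := hf.exists_bound_of_continuous h.continuous
  obtain ⟨D, hD⟩ := h.lipschitzWith_of_hasCompactSupport hf one_ne_zero
  refine ⟨max C D, fun x => (hC x).trans (le_max_left _ _), fun x y => ?_⟩
  refine (hD.norm_sub_le x y).trans ?_
  gcongr
  exact le_max_right _ _

theorem exists_norm_fderiv_le_and_lipschitz {E F : Type*} [NormedAddCommGroup E] [NormedSpace ℝ E]
    [NormedAddCommGroup F] [NormedSpace ℝ F] {f : E → F} (hf : HasCompactSupport f)
    (h : ContDiff ℝ 2 f) :
    ∃ C, (∀ x, ‖fderiv ℝ f x‖ ≤ C) ∧ ∀ x y, ‖fderiv ℝ f x - fderiv ℝ f y‖ ≤ C * ‖x - y‖ :=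
  exists_norm_le_and_lipschitz_of_hasCompactSupport (hf.fderiv ℝ) (h.fderiv_right (by norm_num))

/-- Three derivatives are needed to make the Hessian Lipschitz, on which both Taylor estimates of
`RegularCost` rest. -/
theorem exists_bound_of_contDiff_three {E : Type*} [NormedAddCommGroup E] [NormedSpace ℝ E]
    {v : E → ℝ} (hv : ContDiff ℝ 3 v) (hvs : HasCompactSupport v) :
    ∃ C, (∀ x, |v x| ≤ C) ∧ (∀ x, ‖fderiv ℝ v x‖ ≤ C) ∧
      (∀ x y, ‖fderiv ℝ v x - fderiv ℝ v y‖ ≤ C * ‖x - y‖) ∧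
      (∀ x, ‖fderiv ℝ (fderiv ℝ v) x‖ ≤ C) ∧
      ∀ x y, ‖fderiv ℝ (fderiv ℝ v) x - fderiv ℝ (fderiv ℝ v) y‖ ≤ C * ‖x - y‖ := by
  have hv1 : ContDiff ℝ 2 (fderiv ℝ v) := hv.fderiv_right (by norm_num)
  have hs1 : HasCompactSupport (fderiv ℝ v) := hvs.fderiv ℝ
  obtain ⟨C0, hC0, -⟩ := exists_norm_le_and_lipschitz_of_hasCompactSupport hvs
    (hv.of_le (by norm_num))
  obtain ⟨C1, hC1, hL1⟩ := exists_norm_fderiv_le_and_lipschitz hvs (hv.of_le (by norm_num))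
  obtain ⟨C2, hC2, hL2⟩ := exists_norm_fderiv_le_and_lipschitz hs1 hv1
  have h0 : C0 ≤ max C0 (max C1 C2) := le_max_left _ _
  have h1 : C1 ≤ max C0 (max C1 C2) := (le_max_left _ _).trans (le_max_right _ _)
  have h2 : C2 ≤ max C0 (max C1 C2) := (le_max_right _ _).trans (le_max_right _ _)
  exact ⟨max C0 (max C1 C2), fun x => (hC0 x).trans h0, fun x => (hC1 x).trans h1,
    fun x y => (hL1 x y).trans (mul_le_mul_of_nonneg_right h1 (norm_nonneg _)),
    fun x => (hC2 x).trans h2,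
    fun x y => (hL2 x y).trans (mul_le_mul_of_nonneg_right h2 (norm_nonneg _))⟩

section Taylor

variable {E : Type*} [NormedAddCommGroup E] [NormedSpace ℝ E]

/-- Mean value inequality for `f` minus the linear map `f' 0` on the ball of radius ‖r‖ + ‖p‖, which
contains both endpoints. Used with `f` the gradient, it expands around `r` while keeping the Hessian
frozen at the origin. -/
theorem norm_sub_sub_le_of_fderiv_lipschitz {F : Type*} [NormedAddCommGroup F] [NormedSpace ℝ F]
    {f : E → F} {f' : E → E →L[ℝ] F} {K : ℝ} (hK : 0 ≤ K) (hf : ∀ x, HasFDerivAt f (f' x) x)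
    (hL : ∀ x, ‖f' x - f' 0‖ ≤ K * ‖x‖) (r p : E) :
    ‖f (r + p) - f r - f' 0 p‖ ≤ K * ((‖r‖ + ‖p‖) * ‖p‖) := by
  have hb : ∀ x ∈ Metric.closedBall (0 : E) (‖r‖ + ‖p‖), ‖f' x - f' 0‖ ≤ K * (‖r‖ + ‖p‖) := by
    intro x hx
    have hx' : ‖x‖ ≤ ‖r‖ + ‖p‖ := by simpa using hx
    exact (hL x).trans (by gcongr)
  have := (convex_closedBall (0 : E) (‖r‖ + ‖p‖)).norm_image_sub_le_of_norm_hasFDerivWithin_le'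
    (fun x _ => (hf x).hasFDerivWithinAt) hb (x := r) (y := r + p)
    (by simp) (by simpa using norm_add_le r p)
  simp only [add_sub_cancel_left] at this
  linarith

/-- The function v(x) - H(x,x)/2 vanishes at 0 and has derivative Dv(x) - H(x) of quadratic size, so
the mean value inequality on the ball of radius ‖p‖ yields the cubic bound. -/
theorem abs_sub_quadratic_le {v : E → ℝ} {Dv : E → E →L[ℝ] ℝ} {H : E →L[ℝ] E →L[ℝ] ℝ} {K : ℝ}
    (hK : 0 ≤ K) (hv : ∀ x, HasFDerivAt v (Dv x) x) (hv0 : v 0 = 0)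
    (hsymm : ∀ x y, H x y = H y x) (hD : ∀ x, ‖Dv x - H x‖ ≤ K * ‖x‖ ^ 2) (p : E) :
    |v p - 1 / 2 * H p p| ≤ K * ‖p‖ ^ 3 := by
  have hder : ∀ x, HasFDerivAt (fun x => v x - 1 / 2 * H x x) (Dv x - H x) x := by
    intro x
    have h1 : HasFDerivAt (fun x => H x x) ((2 : ℝ) • H x) x := by
      refine ((H.hasFDerivAt (x := x)).clm_apply (hasFDerivAt_id x)).congr_fderiv ?_
      ext y
      simp [hsymm y x, two_mul]
    refine ((hv x).sub (h1.const_mul (1 / 2))).congr_fderiv ?_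
    ext y
    simp
  have hb : ∀ x ∈ Metric.closedBall (0 : E) ‖p‖, ‖Dv x - H x‖ ≤ K * ‖p‖ ^ 2 := by
    intro x hx
    have hx' : ‖x‖ ≤ ‖p‖ := by simpa using hx
    exact (hD x).trans (by gcongr)
  have := (convex_closedBall (0 : E) ‖p‖).norm_image_sub_le_of_norm_hasFDerivWithin_le
    (fun x _ => (hder x).hasFDerivWithinAt) hb (x := 0) (y := p) (by simp) (by simp)
  simp only [hv0, map_zero, sub_zero, mul_zero, Real.norm_eq_abs] at this
  exact this.trans (le_of_eq (by ring))

end Taylor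

theorem regularCost_of_contDiff {v : Plane → ℝ} (hv : ContDiff ℝ 3 v) (hvs : HasCompactSupport v)
    (hv0 : v 0 = 0) (hDv0 : fderiv ℝ v 0 = 0)
    (hpos : ∀ u : Plane, u ≠ 0 → 0 < fderiv ℝ (fderiv ℝ v) 0 u u) :
    ∃ K, RegularCost v (fderiv ℝ v) (fderiv ℝ (fderiv ℝ v) 0) K := by
  have hv1 : ContDiff ℝ 2 (fderiv ℝ v) := hv.fderiv_right (by norm_num)
  have hd : ∀ x, HasFDerivAt v (fderiv ℝ v x) x := fun x =>
    (hv.differentiable (by norm_num) x).hasFDerivAt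
  have hdd : ∀ x, HasFDerivAt (fderiv ℝ v) (fderiv ℝ (fderiv ℝ v) x) x := fun x =>
    (hv1.differentiable (by norm_num) x).hasFDerivAt
  have hsymm : ∀ x y, fderiv ℝ (fderiv ℝ v) 0 x y = fderiv ℝ (fderiv ℝ v) 0 y x := by
    have : IsSymmSndFDerivAt ℝ v 0 := hv.contDiffAt.isSymmSndFDerivAt (by simp; norm_cast)
    exact fun x y => this x y
  obtain ⟨C, hC0, hC1, hL1, hC2, hL2⟩ := exists_bound_of_contDiff_three hv hvs
  obtain ⟨c, hc, hpos'⟩ := exists_pos_mul_sq_le (fderiv ℝ (fderiv ℝ v) 0) hpos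
  obtain ⟨K, hK1, hKC, hKc⟩ : ∃ K, 1 ≤ K ∧ C ≤ K ∧ c⁻¹ ≤ K :=
    ⟨max 1 (max C c⁻¹), le_max_left _ _, (le_max_left _ _).trans (le_max_right _ _),
      (le_max_right _ _).trans (le_max_right _ _)⟩
  have htaylor := norm_sub_sub_le_of_fderiv_lipschitz (K := K) (by linarith) hdd (fun x => by
    have := hL2 x 0
    rw [sub_zero] at this
    exact this.trans (by gcongr))
  refine ⟨K, hK1, hd, hv0, hDv0, fun x => (hC0 x).trans hKC, fun x => (hC1 x).trans hKC,
    fun x y => (hL1 x y).trans (by gcongr), htaylor, ?_, (hC2 0).trans hKC, hsymm, ?_⟩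
  · refine abs_sub_quadratic_le (by linarith) hd hv0 hsymm fun x => ?_
    have := htaylor 0 x
    rw [zero_add, hDv0, sub_zero, norm_zero, zero_add, ← sq] at this
    exact this
  · intro x
    refine le_trans ?_ (hpos' x)
    gcongr
    exact inv_le_of_inv_le₀ hc hKc

theorem exists_regularCost {J : Plane → ℝ} {rstar : Plane} (hs : ContDiffAt ℝ ∞ J rstar)
    (hmin : HasNondegenerateLocalMin J rstar) :
    ∃ v Dv H K, RegularCost v Dv H K ∧
      ∃ R > 0, ∀ x, ‖x‖ < R → v x = J (rstar + x) - J rstar := by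
  have hf : ContDiffAt ℝ (3 : ℕ) (fun x => J (rstar + x) - J rstar) 0 := by
    refine ContDiffAt.sub ?_ contDiffAt_const
    have h1 : ContDiffAt ℝ (3 : ℕ) J (rstar + 0) := by
      rw [add_zero]
      exact hs.of_le (WithTop.coe_le_coe.2 le_top)
    exact h1.comp (0 : Plane) (contDiffAt_const.add contDiffAt_id)
  obtain ⟨v, hv, hvs, R, hR, hvf⟩ := exists_contDiff_hasCompactSupport_eq hf
  have hev : v =ᶠ[nhds 0] fun x => J (rstar + x) - J rstar :=
    Metric.eventually_nhds_iff.2 ⟨R, hR, fun x hx => hvf x (by simpa using hx)⟩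
  have hfd : fderiv ℝ v =ᶠ[nhds 0] fun x => fderiv ℝ J (rstar + x) := by
    refine hev.fderiv.trans (Filter.Eventually.of_forall fun x => ?_)
    simp only [fderiv_sub_const]
    exact fderiv_comp_add_left rstar
  have hDv0 : fderiv ℝ v 0 = 0 := by
    rw [hfd.eq_of_nhds, add_zero]
    have := hmin.gradient_eq_zero
    rw [gradient] at this
    simpa using this
  have hH : fderiv ℝ (fderiv ℝ v) 0 = fderiv ℝ (fderiv ℝ J) rstar := by
    rw [hfd.fderiv_eq, fderiv_comp_add_left rstar, add_zero]
  have hv0 : v 0 = 0 := by rw [hvf 0 (by simpa using hR)]; simp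
  obtain ⟨K, hK⟩ := regularCost_of_contDiff hv hvs hv0 hDv0 (by rw [hH]; exact hmin.hessian_pos)
  exact ⟨v, _, _, K, hK, R, hR, hvf⟩

end ExtremumSeeking
end

/-! ### Global solutions, uniqueness and comparison for ordinary differential equations. -/

noncomputable section
namespace ExtremumSeeking
open Set

/-- A bounded, globally Lipschitz, time-dependent vector field has a global solution. -/
theorem exists_solution_of_bounded_lipschitz {E : Type*} [NormedAddCommGroup E] [NormedSpace ℝ E]
    [CompleteSpace E] {F : ℝ → E → E} {K M : NNReal} (hlip : ∀ t, LipschitzWith K (F t))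
    (hcont : ∀ x, Continuous fun t => F t x) (hbdd : ∀ t x, ‖F t x‖ ≤ M) (t₀ : ℝ) (x₀ : E) :
    ∃ z : ℝ → E, z t₀ = x₀ ∧ ∀ t, HasDerivAt z (F t (z t)) t := by
  have hloc : ∀ n : ℕ, ∃ z : ℝ → E, z t₀ = x₀ ∧
      ∀ t ∈ Ioo (t₀ - (n + 1)) (t₀ + (n + 1)), HasDerivAt z (F t (z t)) t := by
    intro n
    have hmem : t₀ ∈ Icc (t₀ - (n + 1)) (t₀ + (n + 1)) := by
      constructor <;> linarith [n.cast_nonneg (α := ℝ)]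
    -- A field bounded by `M` cannot leave the ball of radius M(n+1) during time n+1, so
    -- Picard-Lindelöf applies on the whole interval.
    have hPL : IsPicardLindelof F (⟨t₀, hmem⟩ : Icc (t₀ - (n + 1)) (t₀ + (n + 1 : ℝ))) x₀
        (M * (n + 1)) 0 M K :=
      { lipschitzOnWith := fun t _ => (hlip t).lipschitzOnWith
        continuousOn := fun x _ => (hcont x).continuousOn
        norm_le := fun t _ x _ => hbdd t x
        mul_max_le := by simp }
    obtain ⟨z, hz0, hz⟩ := hPL.exists_eq_forall_mem_Icc_hasDerivWithinAt₀
    exact ⟨z, hz0, fun t ht => (hz t (Ioo_subset_Icc_self ht)).hasDerivAt (Icc_mem_nhds ht.1 ht.2)⟩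
  choose z hz0 hz using hloc
  have hagree : ∀ m n : ℕ, m ≤ n → EqOn (z m) (z n) (Ioo (t₀ - (m + 1)) (t₀ + (m + 1))) := by
    intro m n hmn
    have hmn' : (m : ℝ) ≤ n := by exact_mod_cast hmn
    have hm0 := m.cast_nonneg (α := ℝ)
    refine ODE_solution_unique_of_mem_Ioo (v := F) (s := fun _ => univ) (K := K) (t₀ := t₀)
      (fun t _ => (hlip t).lipschitzOnWith) ⟨by linarith, by linarith⟩
      (fun t ht => ⟨hz m t ht, mem_univ _⟩) (fun t ht => ⟨hz n t ?_, mem_univ _⟩)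
      ((hz0 m).trans (hz0 n).symm)
    exact ⟨by linarith [ht.1], by linarith [ht.2]⟩
  have hagree' : ∀ (m n : ℕ) (t : ℝ), |t - t₀| < m + 1 → |t - t₀| < n + 1 → z m t = z n t := by
    intro m n t hm hn
    rw [abs_lt] at hm hn
    rcases le_total m n with h | h
    · exact hagree m n h ⟨by linarith, by linarith⟩
    · exact (hagree n m h ⟨by linarith, by linarith⟩).symm
  -- The index varies with `t`, but solution `n` lives on an interval of half-length n + 1; near a
  -- given time all chosen solutions therefore agree with a single one.
  refine ⟨fun t => z ⌈|t - t₀|⌉₊ t, ?_, fun t => ?_⟩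
  · exact hz0 _
  · set n := ⌈|t - t₀|⌉₊ with hn
    have hlt : |t - t₀| < n + 1 := (Nat.le_ceil _).trans_lt (lt_add_one _)
    have hev : (fun s => z ⌈|s - t₀|⌉₊ s) =ᶠ[nhds t] z n := by
      have : ∀ᶠ s in nhds t, |s - t₀| < n + 1 :=
        (continuous_abs.comp (continuous_id.sub continuous_const)).continuousAt.eventually_lt
          continuousAt_const hlt
      filter_upwards [this] with s hs
      exact hagree' _ _ s ((Nat.le_ceil _).trans_lt (lt_add_one _)) hs
    refine HasDerivAt.congr_of_eventuallyEq (hz n t ?_) hev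
    rw [abs_lt] at hlt
    exact ⟨by linarith, by linarith⟩

/-- Two solutions with the same initial value agree to the right, if one of them keeps a fixed
distance from the places where the vector field is not Lipschitz. -/
theorem eqOn_Ici_of_lipschitz_near {E : Type*} [NormedAddCommGroup E] [NormedSpace ℝ E]
    {F : ℝ → E → E} {K d t₀ : ℝ} {z w : ℝ → E} (hd : 0 < d)
    (hz : ∀ t ∈ Ici t₀, HasDerivWithinAt z (F t (z t)) (Ici t₀) t)
    (hw : ∀ t ∈ Ici t₀, HasDerivWithinAt w (F t (w t)) (Ici t₀) t)
    (hF : ∀ t ∈ Ici t₀, ∀ x, ‖x - w t‖ ≤ d → ‖F t x - F t (w t)‖ ≤ K * ‖x - w t‖)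
    (h0 : z t₀ = w t₀) : EqOn z w (Ici t₀) := by
  intro t₁ ht₁
  have hK0 : K ≤ |K| + 1 := by linarith [le_abs_self K]
  have hcont : ∀ t ∈ Ici t₀, ContinuousWithinAt (fun t => z t - w t) (Ici t₀) t := fun t ht =>
    ((hz t ht).sub (hw t ht)).continuousWithinAt
  set L := |K| + 1 with hL
  have hL0 : 0 < L := by positivity
  -- Barrier argument: as long as the barrier is at most `d`, a first contact would occur inside the
  -- tube where the Lipschitz estimate holds, and L > K makes the barrier grow strictly faster.
  -- Letting ν tend to 0 then gives equality.
  have key : ∀ ν > 0, ν * Real.exp (L * (t₁ - t₀)) ≤ d →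
      ‖z t₁ - w t₁‖ ≤ ν * Real.exp (L * (t₁ - t₀)) := by
    intro ν hν hνd
    refine image_norm_le_of_norm_deriv_right_lt_deriv_boundary (f := fun t => z t - w t)
      (f' := fun t => F t (z t) - F t (w t)) (a := t₀) (b := t₁)
      (B := fun t => ν * Real.exp (L * (t - t₀)))
      (B' := fun t => ν * (Real.exp (L * (t - t₀)) * L)) (fun t ht => ?_) (fun t ht => ?_) ?_
      (fun t => ?_) (fun t ht heq => ?_) (right_mem_Icc.2 ht₁)
    · exact (hcont t ht.1).mono (Icc_subset_Ici_self)
    · exact ((hz t ht.1).sub (hw t ht.1)).mono (Ici_subset_Ici.2 ht.1)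
    · simp [h0, hν.le]
    · have h1 : HasDerivAt (fun t => L * (t - t₀)) L t := by
        simpa using ((hasDerivAt_id t).sub_const t₀).const_mul L
      exact h1.exp.const_mul ν
    · have hle : ν * Real.exp (L * (t - t₀)) ≤ d := by
        refine le_trans ?_ hνd
        gcongr
        exact ht.2.le
      refine (hF t ht.1 (z t) (heq.le.trans hle)).trans_lt ?_
      have hpos : 0 < ν * Real.exp (L * (t - t₀)) := by positivity
      rw [heq]
      have : K < L := by linarith [le_abs_self K]
      nlinarith
  have hzero : ‖z t₁ - w t₁‖ ≤ 0 := by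
    refine le_of_forall_pos_le_add fun e he => ?_
    rw [zero_add]
    set X := Real.exp (L * (t₁ - t₀)) with hX
    have hXpos : 0 < X := Real.exp_pos _
    have hmin : 0 < min d e := lt_min hd he
    have h1 : min d e / X * X = min d e := by field_simp
    have := key (min d e / X) (by positivity) (by rw [h1]; exact min_le_left _ _)
    rw [h1] at this
    exact this.trans (min_le_right _ _)
  exact sub_eq_zero.1 (norm_le_zero_iff.1 hzero)

/-- Linear differential inequality with a constant inhomogeneity. -/
theorem le_of_right_deriv_le_neg_mul_add {f f' : ℝ → ℝ} {a b lam c : ℝ}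
    (hab : a ≤ b) (hf : ContinuousOn f (Icc a b))
    (hf' : ∀ x ∈ Ico a b, HasDerivWithinAt f (f' x) (Ici x) x)
    (bound : ∀ x ∈ Ico a b, f' x ≤ -lam * f x + lam * c) :
    f b ≤ Real.exp (-lam * (b - a)) * (f a - c) + c := by
  have hE : ∀ x, HasDerivAt (fun x => Real.exp (lam * (x - a))) (Real.exp (lam * (x - a)) * lam) x := by
    intro x
    have h1 : HasDerivAt (fun t => lam * (t - a)) lam x := by
      simpa using ((hasDerivAt_id x).sub_const a).const_mul lam
    exact h1.exp
  -- With the integrating factor, exp(lam (x - a))·(f x - c) has nonpositive right derivative.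
  have := image_le_of_deriv_right_le_deriv_boundary
    (f := fun x => Real.exp (lam * (x - a)) * (f x - c))
    (f' := fun x => Real.exp (lam * (x - a)) * lam * (f x - c) + Real.exp (lam * (x - a)) * f' x)
    (a := a) (b := b) (B := fun _ => f a - c) (B' := fun _ => 0)
    (ContinuousOn.mul (fun x _ => (hE x).continuousAt.continuousWithinAt)
      (hf.sub continuousOn_const))
    (fun x hx => ((hE x).hasDerivWithinAt).mul ((hf' x hx).sub_const c))
    (by simp) continuousOn_const (fun x _ => hasDerivWithinAt_const _ _ _)
    (fun x hx => by
      have h1 := bound x hx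
      have h2 := Real.exp_pos (lam * (x - a))
      nlinarith) (right_mem_Icc.2 hab)
  have h3 : Real.exp (-lam * (b - a)) * Real.exp (lam * (b - a)) = 1 := by
    rw [← Real.exp_add]; simp
  have h4 := Real.exp_pos (-lam * (b - a))
  have h5 := mul_le_mul_of_nonneg_left this h4.le
  rw [← mul_assoc, h3, one_mul] at h5
  linarith

end ExtremumSeeking
end

noncomputable section
namespace ExtremumSeeking
open Set Real

/-! ### Antiderivatives of the oscillating terms -/

/-- The cosine is the sine advanced by a quarter of its own period. -/
theorem periodic_cos_of_periodic_sin {w T : ℝ} (hw : 0 < w)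
    (h : Function.Periodic (fun τ : ℝ => sin (w * τ)) T) :
    Function.Periodic (fun τ : ℝ => cos (w * τ)) T := by
  intro τ
  have := h (τ + π / 2 / w)
  simp only at this
  rw [show w * (τ + π / 2 / w + T) = w * (τ + T) + π / 2 by field_simp; ring,
    show w * (τ + π / 2 / w) = w * τ + π / 2 by field_simp, sin_add_pi_div_two,
    sin_add_pi_div_two] at this
  exact this

theorem intervalIntegral_eq_zero_of_odd_periodic {f : ℝ → ℝ} {T : ℝ}
    (hper : Function.Periodic f T) (hodd : ∀ t, f (-t) = -f t) : ∫ t in (0 : ℝ)..T, f t = 0 := by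
  have h1 : ∫ t in (0 : ℝ)..T, f t = ∫ t in (-T / 2)..(T / 2), f t := by
    have := hper.intervalIntegral_add_eq 0 (-T / 2)
    rw [zero_add, show -T / 2 + T = T / 2 by ring] at this
    exact this
  have h2 : ∫ t in (-T / 2)..(T / 2), f t = -∫ t in (-T / 2)..(T / 2), f t := by
    have := intervalIntegral.integral_comp_neg (f := f) (a := -T / 2) (b := T / 2)
    rw [show -(-T / 2) = T / 2 by ring, show -(T / 2) = -T / 2 by ring] at this
    simp only [hodd, intervalIntegral.integral_neg] at this
    exact this.symm
  rw [h1]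
  linarith

/-- Zero mean makes the primitive periodic, so a bound on one period bounds it for all times. -/
theorem abs_integral_le_of_periodic {f : ℝ → ℝ} {T M : ℝ} (hT : 0 < T) (hf : Continuous f)
    (hper : Function.Periodic f T) (hzero : ∫ t in (0 : ℝ)..T, f t = 0) (hM : ∀ t, |f t| ≤ M) :
    Function.Periodic (fun τ => ∫ t in (0 : ℝ)..τ, f t) T ∧
      ∀ τ, |∫ t in (0 : ℝ)..τ, f t| ≤ M * T := by
  have hp : Function.Periodic (fun τ => ∫ t in (0 : ℝ)..τ, f t) T := by
    intro τ
    simp only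
    rw [← intervalIntegral.integral_add_adjacent_intervals (hf.intervalIntegrable 0 τ)
      (hf.intervalIntegrable τ (τ + T)), hper.intervalIntegral_add_eq τ 0, zero_add, hzero, add_zero]
  refine ⟨hp, fun τ => ?_⟩
  obtain ⟨t, ht, hτ⟩ := hp.exists_mem_Ico₀ hT τ
  rw [hτ]
  have h1 := intervalIntegral.norm_integral_le_of_norm_le_const (a := 0) (b := t) (f := f) (C := M)
    (fun x _ => hM x)
  rw [sub_zero, abs_of_nonneg ht.1] at h1
  have hM0 : 0 ≤ M := (abs_nonneg _).trans (hM 0)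
  exact h1.trans (by gcongr; exact ht.2.le)

/-- The unit vector of channel `i`. -/
abbrev unitVec (i : Fin 2) : Plane := EuclideanSpace.single i 1

theorem norm_unitVec (i : Fin 2) : ‖unitVec i‖ = 1 := by simp [unitVec]

namespace Params

variable (P : Params)

/-- A bounded antiderivative of `sin (ω_i τ) sin (ω_j τ)` minus its mean. -/
def sinSin (i j : Fin 2) (τ : ℝ) : ℝ :=
  if i = j then -(sin (P.freq i * τ) * cos (P.freq i * τ)) / (2 * P.freq i)
  else (P.freq j * (sin (P.freq i * τ) * cos (P.freq j * τ))
    - P.freq i * (cos (P.freq i * τ) * sin (P.freq j * τ))) / (P.freq i ^ 2 - P.freq j ^ 2)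

theorem hasDerivAt_sin_freq (i : Fin 2) (τ : ℝ) :
    HasDerivAt (fun τ => sin (P.freq i * τ)) (cos (P.freq i * τ) * P.freq i) τ := by
  have h1 : HasDerivAt (fun t => P.freq i * t) (P.freq i) τ := by
    simpa using (hasDerivAt_id τ).const_mul (P.freq i)
  exact h1.sin

theorem hasDerivAt_cos_freq (i : Fin 2) (τ : ℝ) :
    HasDerivAt (fun τ => cos (P.freq i * τ)) (-sin (P.freq i * τ) * P.freq i) τ := by
  have h1 : HasDerivAt (fun t => P.freq i * t) (P.freq i) τ := by
    simpa using (hasDerivAt_id τ).const_mul (P.freq i)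
  exact h1.cos

theorem freq_sq_sub_ne {i j : Fin 2} (hij : i ≠ j) : P.freq i ^ 2 - P.freq j ^ 2 ≠ 0 := by
  have hne : P.freq i ≠ P.freq j := by
    have := P.freq_ne
    fin_cases i <;> fin_cases j <;> simp_all [eq_comm]
  have h1 := P.freq_pos i
  have h2 := P.freq_pos j
  rw [sq_sub_sq]
  exact mul_ne_zero (by positivity) (sub_ne_zero.2 hne)

theorem hasDerivAt_sinSin (i j : Fin 2) (τ : ℝ) :
    HasDerivAt (P.sinSin i j)
      (sin (P.freq i * τ) * sin (P.freq j * τ) - if i = j then 1 / 2 else 0) τ := by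
  have hs := P.hasDerivAt_sin_freq
  have hc := P.hasDerivAt_cos_freq
  unfold sinSin
  by_cases hij : i = j
  · subst hij
    simp only [if_true]
    refine ((((hs i τ).mul (hc i τ)).neg).div_const (2 * P.freq i)).congr_deriv ?_
    have := (P.freq_pos i).ne'
    have h1 := sin_sq_add_cos_sq (P.freq i * τ)
    field_simp
    nlinarith
  · simp only [if_neg hij]
    refine (((((hs i τ).mul (hc j τ)).const_mul (P.freq j)).sub
      (((hc i τ).mul (hs j τ)).const_mul (P.freq i))).div_const
      (P.freq i ^ 2 - P.freq j ^ 2)).congr_deriv ?_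
    have := P.freq_sq_sub_ne hij
    field_simp
    ring

theorem exists_abs_sinSin_le : ∃ C, ∀ i j τ, |P.sinSin i j τ| ≤ C := by
  have h : ∀ i j, ∃ C, ∀ τ, |P.sinSin i j τ| ≤ C := by
    intro i j
    unfold sinSin
    have hb : ∀ x y : ℝ, |x| ≤ 1 → |y| ≤ 1 → |x * y| ≤ 1 := fun x y hx hy => by
      rw [abs_mul]; exact mul_le_one₀ hx (abs_nonneg _) hy
    split_ifs
    · refine ⟨1 / |2 * P.freq i|, fun τ => ?_⟩
      rw [abs_div, abs_neg]
      gcongr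
      exact hb _ _ (abs_sin_le_one _) (abs_cos_le_one _)
    · refine ⟨(|P.freq j| * 1 + |P.freq i| * 1) / |P.freq i ^ 2 - P.freq j ^ 2|, fun τ => ?_⟩
      rw [abs_div]
      gcongr
      refine (abs_sub _ _).trans ?_
      rw [abs_mul (P.freq j), abs_mul (P.freq i)]
      gcongr
      · exact hb _ _ (abs_sin_le_one _) (abs_cos_le_one _)
      · exact hb _ _ (abs_cos_le_one _) (abs_sin_le_one _)
  choose C hC using h
  refine ⟨∑ i, ∑ j, |C i j|, fun i j τ => (hC i j τ).trans ((le_abs_self _).trans ?_)⟩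
  have h1 : |C i j| ≤ ∑ j, |C i j| :=
    Finset.single_le_sum (f := fun j => |C i j|) (fun _ _ => abs_nonneg _) (Finset.mem_univ j)
  exact h1.trans (Finset.single_le_sum (f := fun i => ∑ j, |C i j|)
    (fun _ _ => Finset.sum_nonneg fun _ _ => abs_nonneg _) (Finset.mem_univ i))

variable {P} {T : ℝ}

theorem periodic_sinSin (h : ∀ i, Function.Periodic (fun τ : ℝ => sin (P.freq i * τ)) T)
    (i j : Fin 2) : Function.Periodic (P.sinSin i j) T := by
  intro τ
  have hs : ∀ i, sin (P.freq i * (τ + T)) = sin (P.freq i * τ) := fun i => h i τ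
  have hc : ∀ i, cos (P.freq i * (τ + T)) = cos (P.freq i * τ) := fun i =>
    periodic_cos_of_periodic_sin (P.freq_pos i) (h i) τ
  simp only [sinSin, hs, hc]

variable (P) (H : Plane →L[ℝ] Plane →L[ℝ] ℝ) (a : Plane)

theorem perturbation_eq_sum (τ : ℝ) :
    P.perturbation a τ = ∑ j, (a j * sin (P.freq j * τ)) • unitVec j := by
  ext i
  fin_cases i <;> simp [perturbation, Fin.sum_univ_two]

theorem apply_perturbation (r : Plane) (τ : ℝ) :
    H r (P.perturbation a τ) = ∑ j, a j * sin (P.freq j * τ) * H r (unitVec j) := by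
  rw [perturbation_eq_sum]
  simp [Fin.sum_univ_two]

theorem abs_coord_le (x : Plane) (i : Fin 2) : |x i| ≤ ‖x‖ := PiLp.norm_apply_le x i

theorem norm_perturbation_le (τ : ℝ) : ‖P.perturbation a τ‖ ≤ ‖a‖ := by
  rw [EuclideanSpace.norm_eq, EuclideanSpace.norm_eq]
  apply Real.sqrt_le_sqrt
  refine Finset.sum_le_sum fun i _ => ?_
  simp only [perturbation, norm_mul, Real.norm_eq_abs]
  gcongr
  exact mul_le_of_le_one_right (abs_nonneg _) (abs_sin_le_one _)

theorem continuous_perturbation : Continuous (P.perturbation a) := by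
  have : P.perturbation a = fun τ => ∑ j, (a j * sin (P.freq j * τ)) • unitVec j :=
    funext (P.perturbation_eq_sum a)
  rw [this]
  fun_prop

/-- The time average of `H p p / 2` for the perturbation signal `p`. -/
def meanQuad : ℝ := ∑ j, 1 / 4 * (a j ^ 2 * H (unitVec j) (unitVec j))

/-- A bounded antiderivative of `H p p / 2 - meanQuad`. -/
def intQuad (τ : ℝ) : ℝ :=
  ∑ j, ∑ k, 1 / 2 * (a j * a k * H (unitVec j) (unitVec k)) * P.sinSin j k τ

/-- The Hessian paired with a bounded antiderivative of the oscillating part of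
`sin (ω_i τ) p(τ)`. -/
def intLin (i : Fin 2) (τ : ℝ) (r : Plane) : ℝ := ∑ j, a j * P.sinSin i j τ * H r (unitVec j)

/-- The mean-zero integrand of `intCubic`. -/
def cubicRate (i : Fin 2) (τ : ℝ) : ℝ :=
  sin (P.freq i * τ) * (1 / 2 * H (P.perturbation a τ) (P.perturbation a τ) - meanQuad H a)

/-- A bounded antiderivative of `sin (ω_i τ) (H p p / 2 - meanQuad)`. -/
def intCubic (i : Fin 2) (τ : ℝ) : ℝ := ∫ t in (0 : ℝ)..τ, P.cubicRate H a i t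

theorem hasDerivAt_intQuad (τ : ℝ) :
    HasDerivAt (P.intQuad H a)
      (1 / 2 * H (P.perturbation a τ) (P.perturbation a τ) - meanQuad H a) τ := by
  have h := P.hasDerivAt_sinSin
  unfold intQuad
  simp only [Fin.sum_univ_two]
  refine ((((h 0 0 τ).const_mul _).add ((h 0 1 τ).const_mul _)).add
    (((h 1 0 τ).const_mul _).add ((h 1 1 τ).const_mul _))).congr_deriv ?_
  rw [P.apply_perturbation, P.perturbation_eq_sum]
  simp [Fin.sum_univ_two, meanQuad]
  ring

theorem continuous_cubicRate (i : Fin 2) : Continuous (P.cubicRate H a i) := by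
  unfold cubicRate
  have := P.continuous_perturbation a
  fun_prop

theorem hasDerivAt_intCubic (i : Fin 2) (τ : ℝ) :
    HasDerivAt (P.intCubic H a i) (P.cubicRate H a i τ) τ :=
  intervalIntegral.integral_hasDerivAt_right ((P.continuous_cubicRate H a i).intervalIntegrable _ _)
    ((P.continuous_cubicRate H a i).stronglyMeasurableAtFilter _ _)
    (P.continuous_cubicRate H a i).continuousAt

theorem abs_meanQuad_le : |meanQuad H a| ≤ ‖H‖ * ‖a‖ ^ 2 := by
  have h : ∀ j, |1 / 4 * (a j ^ 2 * H (unitVec j) (unitVec j))| ≤ 1 / 4 * (‖a‖ ^ 2 * ‖H‖) := by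
    intro j
    rw [abs_mul, abs_mul, abs_pow, abs_of_pos (by norm_num : (0 : ℝ) < 1 / 4)]
    have h1 := H.le_opNorm₂ (unitVec j) (unitVec j)
    simp only [norm_unitVec, mul_one, Real.norm_eq_abs] at h1
    have h2 := abs_coord_le a j
    gcongr
  unfold meanQuad
  rw [Fin.sum_univ_two]
  refine (abs_add_le _ _).trans ?_
  have := h 0; have := h 1
  have : 0 ≤ ‖H‖ * ‖a‖ ^ 2 := by positivity
  linarith

theorem abs_cubicRate_le (i : Fin 2) (τ : ℝ) : |P.cubicRate H a i τ| ≤ 2 * ‖H‖ * ‖a‖ ^ 2 := by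
  unfold cubicRate
  rw [abs_mul]
  have h1 := H.le_opNorm₂ (P.perturbation a τ) (P.perturbation a τ)
  rw [Real.norm_eq_abs] at h1
  have h2 := P.norm_perturbation_le a τ
  have h3 : |H (P.perturbation a τ) (P.perturbation a τ)| ≤ ‖H‖ * ‖a‖ * ‖a‖ := h1.trans (by gcongr)
  have h4 := abs_meanQuad_le H a
  have h5 := abs_sin_le_one (P.freq i * τ)
  have h6 : |1 / 2 * H (P.perturbation a τ) (P.perturbation a τ) - meanQuad H a|
      ≤ 1 * (2 * ‖H‖ * ‖a‖ ^ 2) := by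
    refine (abs_sub _ _).trans ?_
    rw [abs_mul, abs_of_pos (by norm_num : (0 : ℝ) < 1 / 2)]
    have : 0 ≤ ‖H‖ * ‖a‖ ^ 2 := by positivity
    nlinarith
  calc _ ≤ 1 * (1 * (2 * ‖H‖ * ‖a‖ ^ 2)) := by gcongr
    _ = _ := by ring

theorem exists_abs_intQuad_le : ∃ C, ∀ (H : Plane →L[ℝ] Plane →L[ℝ] ℝ) (a : Plane) (τ : ℝ),
    |P.intQuad H a τ| ≤ C * ‖H‖ * ‖a‖ ^ 2 := by
  obtain ⟨C, hC⟩ := P.exists_abs_sinSin_le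
  refine ⟨2 * C, fun H a τ => ?_⟩
  have h : ∀ j k, |1 / 2 * (a j * a k * H (unitVec j) (unitVec k)) * P.sinSin j k τ|
      ≤ 1 / 2 * (‖a‖ * ‖a‖ * ‖H‖) * C := by
    intro j k
    rw [abs_mul, abs_mul, abs_mul, abs_mul, abs_of_pos (by norm_num : (0 : ℝ) < 1 / 2)]
    have h1 := H.le_opNorm₂ (unitVec j) (unitVec k)
    simp only [norm_unitVec, mul_one, Real.norm_eq_abs] at h1
    have h2 := abs_coord_le a j
    have h3 := abs_coord_le a k
    gcongr
    exact hC j k τ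
  unfold intQuad
  simp only [Fin.sum_univ_two]
  refine (abs_add_le _ _).trans ((add_le_add (abs_add_le _ _) (abs_add_le _ _)).trans ?_)
  have := h 0 0; have := h 0 1; have := h 1 0; have := h 1 1
  nlinarith

theorem exists_abs_intLin_le : ∃ C, ∀ (H : Plane →L[ℝ] Plane →L[ℝ] ℝ) (a : Plane) (i τ) (r : Plane),
    |P.intLin H a i τ r| ≤ C * ‖H‖ * ‖a‖ * ‖r‖ := by
  obtain ⟨C, hC⟩ := P.exists_abs_sinSin_le
  refine ⟨2 * C, fun H a i τ r => ?_⟩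
  have h : ∀ j, |a j * P.sinSin i j τ * H r (unitVec j)| ≤ ‖a‖ * C * (‖H‖ * ‖r‖) := by
    intro j
    rw [abs_mul, abs_mul]
    have h1 := H.le_opNorm₂ r (unitVec j)
    simp only [norm_unitVec, mul_one, Real.norm_eq_abs] at h1
    have h2 := abs_coord_le a j
    have h0 : 0 ≤ C := (abs_nonneg _).trans (hC i j τ)
    gcongr
    exact hC i j τ
  unfold intLin
  simp only [Fin.sum_univ_two]
  refine (abs_add_le _ _).trans ?_
  have := h 0; have := h 1
  linarith

variable {P} in
theorem periodic_perturbation (h : ∀ i, Function.Periodic (fun τ : ℝ => sin (P.freq i * τ)) T) :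
    Function.Periodic (P.perturbation a) T := by
  intro τ
  have hs : ∀ i, sin (P.freq i * (τ + T)) = sin (P.freq i * τ) := fun i => h i τ
  simp only [perturbation, hs]

-- The perturbation is odd in time, so H(p,p) minus its mean is even and its product with a sine is
-- odd. The mean therefore vanishes for every ratio of the frequencies; no resonance between three
-- of the factors has to be excluded.
variable {P} in
theorem periodic_intCubic_and_bound (hT : 0 < T)
    (h : ∀ i, Function.Periodic (fun τ : ℝ => sin (P.freq i * τ)) T) (i : Fin 2) :
    Function.Periodic (P.intCubic H a i) T ∧
      ∀ τ, |P.intCubic H a i τ| ≤ 2 * ‖H‖ * ‖a‖ ^ 2 * T := by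
  have hp : Function.Periodic (P.cubicRate H a i) T := by
    intro τ
    have hs : ∀ i, sin (P.freq i * (τ + T)) = sin (P.freq i * τ) := fun i => h i τ
    simp only [cubicRate, periodic_perturbation a h τ, hs]
  refine abs_integral_le_of_periodic hT (P.continuous_cubicRate H a i) hp
    (intervalIntegral_eq_zero_of_odd_periodic hp fun t => ?_) (P.abs_cubicRate_le H a i)
  have hneg : P.perturbation a (-t) = -P.perturbation a t := by
    ext i
    simp [perturbation]
  simp [cubicRate, hneg]

variable {P} in
theorem periodic_intQuad (h : ∀ i, Function.Periodic (fun τ : ℝ => sin (P.freq i * τ)) T) :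
    Function.Periodic (P.intQuad H a) T := by
  intro τ
  have hs : ∀ i j, P.sinSin i j (τ + T) = P.sinSin i j τ := fun i j => periodic_sinSin h i j τ
  simp only [intQuad, hs]

end Params
end ExtremumSeeking
end

/-! ### Averaging coordinates and the equations of motion in them. -/

noncomputable section
namespace ExtremumSeeking
open Set Real

theorem hasDerivWithinAt_plane {f : ℝ → Plane} {f' : Plane} {s : Set ℝ} {τ : ℝ} :
    HasDerivWithinAt f f' s τ ↔ ∀ i, HasDerivWithinAt (fun t => f t i) (f' i) s τ := by
  simp only [hasDerivWithinAt_iff_hasFDerivWithinAt]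
  rw [hasFDerivWithinAt_euclidean]
  refine forall_congr' fun i => ?_
  have : ContinuousLinearMap.toSpanSingleton ℝ (f' i) =
      (EuclideanSpace.proj i).comp (ContinuousLinearMap.toSpanSingleton ℝ f') := by
    ext; simp
  rw [this]

namespace Params

variable (P : Params) (v : Plane → ℝ) (Dv : Plane → Plane →L[ℝ] ℝ)
  (H : Plane →L[ℝ] Plane →L[ℝ] ℝ) (a : Plane) (δ τ : ℝ)

/-- The reduced field for a general cost function `v`. -/
def costField (z : State) : State :=
  δ •
    (WithLp.toLp 2 fun i => -(P.gain i * z.2.1 i) / √(z.2.2.2 i + P.eps),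
     WithLp.toLp 2 fun i =>
       P.lowPass i * (v (z.1 + P.perturbation a τ) - z.2.2.1 i) * sin (P.freq i * τ)
         - P.lowPass i * z.2.1 i,
     WithLp.toLp 2 fun i =>
       -(P.highPass i * z.2.2.1 i) + P.highPass i * v (z.1 + P.perturbation a τ),
     WithLp.toLp 2 fun i => P.moment i * (-(z.2.2.2 i) + z.2.1 i ^ 2))

/-- Shifted coordinates `(r, q̂, ζ, m)`: the known periodic response and the cost at the current
reference are subtracted from `q` and `η`. -/
def shift (z : State) : State :=
  (z.1,
   WithLp.toLp 2 fun i => z.2.1 i - δ * P.lowPass i * P.intCubic H a i τ,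
   WithLp.toLp 2 fun i => z.2.2.1 i - v z.1 - meanQuad H a - δ * P.highPass i * P.intQuad H a τ,
   z.2.2.2)

/-- The averaged gradient estimate, a near-identity linear change of `q̂`. -/
def fast (u : State) : Plane :=
  WithLp.toLp 2 fun i => u.2.1 i
    - δ * P.lowPass i * (P.intLin H a i τ u.1 + cos (P.freq i * τ) / P.freq i * u.2.2.1 i)

/-- Quasi-steady sensitivity of `r` to the averaged gradient estimate. -/
def slope (i : Fin 2) : ℝ := P.gain i / (P.lowPass i * √P.eps)

/-- The slow variable of the averaged system. -/
def slow (u : State) : Plane :=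
  WithLp.toLp 2 fun i => u.1 i - P.slope i * P.fast H a δ τ u i

/-- The gradient estimate `q` in shifted coordinates. -/
def estimate (i : Fin 2) (u : State) : ℝ := u.2.1 i + δ * P.lowPass i * P.intCubic H a i τ

/-- The rate of `r` in shifted coordinates. -/
def rate (u : State) : Plane :=
  WithLp.toLp 2 fun i => -(P.gain i * P.estimate H a δ τ i u) / √(u.2.2.2 i + P.eps)

/-- Variation of the cost under the perturbation, without its leading quadratic part. -/
def costDiff (r : Plane) : ℝ :=
  v (r + P.perturbation a τ) - v r - 1 / 2 * H (P.perturbation a τ) (P.perturbation a τ)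

/-- Remainder in the `ζ` equation. -/
def remEta (i : Fin 2) (u : State) : ℝ :=
  P.highPass i * P.costDiff v H a τ u.1 - δ * P.highPass i ^ 2 * P.intQuad H a τ
    - Dv u.1 (P.rate H a δ τ u)

/-- Remainder in the equation of the averaged gradient estimate. -/
def remFast (i : Fin 2) (u : State) : ℝ :=
  P.lowPass i * sin (P.freq i * τ) *
      (P.costDiff v H a τ u.1 - H u.1 (P.perturbation a τ) - δ * P.highPass i * P.intQuad H a τ)
    - δ * P.lowPass i ^ 2 * (P.intLin H a i τ u.1 + P.intCubic H a i τ
        + cos (P.freq i * τ) / P.freq i * u.2.2.1 i)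
    - δ * P.lowPass i * (P.intLin H a i τ (P.rate H a δ τ u)
        + cos (P.freq i * τ) / P.freq i
          * (-P.highPass i * u.2.2.1 i + P.remEta v Dv H a δ τ i u))

/-- Remainder in the `m` equation. -/
def remMoment (i : Fin 2) (u : State) : ℝ := P.moment i * P.estimate H a δ τ i u ^ 2

/-- Remainder in the equation of the slow variable. -/
def remSlow (i : Fin 2) (u : State) : ℝ :=
  -(P.gain i / √P.eps * (δ * P.lowPass i * (P.intLin H a i τ u.1 + P.intCubic H a i τ
        + cos (P.freq i * τ) / P.freq i * u.2.2.1 i)))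
    + P.gain i * P.estimate H a δ τ i u * (1 / √P.eps - 1 / √(u.2.2.2 i + P.eps))
    - P.slope i * P.remFast v Dv H a δ τ i u

variable {P v Dv H a δ τ}

/-- Here the averaged gradient appears: the mean 1/2 carried by the diagonal case of `sinSin`
contributes (a_i/2)·H(r,e_i), while the off-diagonal case has mean zero. -/
theorem hasDerivWithinAt_intLin {r : ℝ → Plane} {r' : Plane} {s : Set ℝ}
    (hr : HasDerivWithinAt r r' s τ) (i : Fin 2) :
    HasDerivWithinAt (fun t => P.intLin H a i t (r t))
      (sin (P.freq i * τ) * H (r τ) (P.perturbation a τ) - a i / 2 * H (r τ) (unitVec i)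
        + P.intLin H a i τ r') s τ := by
  have hH : ∀ j, HasDerivWithinAt (fun t => H (r t) (unitVec j)) (H r' (unitVec j)) s τ := by
    intro j
    have h1 : HasDerivWithinAt (fun t => H (r t)) (H r') s τ :=
      H.hasFDerivAt.comp_hasDerivWithinAt τ hr
    simpa using h1.clm_apply (hasDerivWithinAt_const τ s (unitVec j))
  have hS := fun j => (P.hasDerivAt_sinSin i j τ).hasDerivWithinAt (s := s)
  unfold intLin
  simp only [Fin.sum_univ_two]
  refine ((((hS 0).const_mul (a 0)).mul (hH 0)).add
    (((hS 1).const_mul (a 1)).mul (hH 1))).congr_deriv ?_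
  rw [P.apply_perturbation]
  fin_cases i <;> simp [Fin.sum_univ_two] <;> ring

section General

variable {z : ℝ → State} {z' : State} {s : Set ℝ}

theorem hasDerivWithinAt_shift (hv : ∀ r, HasFDerivAt v (Dv r) r) (hz : HasDerivWithinAt z z' s τ) :
    HasDerivWithinAt (fun t => P.shift v H a δ t (z t))
      (z'.1,
       WithLp.toLp 2 fun i => z'.2.1 i - δ * P.lowPass i * P.cubicRate H a i τ,
       WithLp.toLp 2 fun i => z'.2.2.1 i - Dv (z τ).1 z'.1 - δ * P.highPass i *
         (1 / 2 * H (P.perturbation a τ) (P.perturbation a τ) - meanQuad H a),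
       z'.2.2.2) s τ := by
  have h1 : HasDerivWithinAt (fun t => (z t).1) z'.1 s τ := hz.fst
  have h2 : HasDerivWithinAt (fun t => (z t).2.1) z'.2.1 s τ := hz.snd.fst
  have h3 : HasDerivWithinAt (fun t => (z t).2.2.1) z'.2.2.1 s τ := hz.snd.snd.fst
  have h4 : HasDerivWithinAt (fun t => (z t).2.2.2) z'.2.2.2 s τ := hz.snd.snd.snd
  refine h1.prodMk (HasDerivWithinAt.prodMk ?_ (HasDerivWithinAt.prodMk ?_ h4))
  · rw [hasDerivWithinAt_plane] at h2 ⊢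
    intro i
    exact (h2 i).sub (((P.hasDerivAt_intCubic H a i τ).hasDerivWithinAt).const_mul _)
  · rw [hasDerivWithinAt_plane] at h3 ⊢
    intro i
    have hvr : HasDerivWithinAt (fun t => v (z t).1) (Dv (z τ).1 z'.1) s τ :=
      (hv _).comp_hasDerivWithinAt τ h1
    exact (((h3 i).sub hvr).sub_const _).sub
      (((P.hasDerivAt_intQuad H a τ).hasDerivWithinAt).const_mul _)

theorem hasDerivWithinAt_fast {u : ℝ → State} {u' : State} (hu : HasDerivWithinAt u u' s τ) :
    HasDerivWithinAt (fun t => P.fast H a δ t (u t))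
      (WithLp.toLp 2 fun i => u'.2.1 i - δ * P.lowPass i *
        (sin (P.freq i * τ) * H (u τ).1 (P.perturbation a τ) - a i / 2 * H (u τ).1 (unitVec i)
          + P.intLin H a i τ u'.1 - sin (P.freq i * τ) * (u τ).2.2.1 i
          + cos (P.freq i * τ) / P.freq i * u'.2.2.1 i)) s τ := by
  have h1 : HasDerivWithinAt (fun t => (u t).1) u'.1 s τ := hu.fst
  have h2 : HasDerivWithinAt (fun t => (u t).2.1) u'.2.1 s τ := hu.snd.fst
  have h3 : HasDerivWithinAt (fun t => (u t).2.2.1) u'.2.2.1 s τ := hu.snd.snd.fst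
  rw [hasDerivWithinAt_plane] at h2 h3 ⊢
  intro i
  refine ((h2 i).sub (((hasDerivWithinAt_intLin h1 i).add
    ((((P.hasDerivAt_cos_freq i τ).hasDerivWithinAt).div_const (P.freq i)).mul (h3 i))).const_mul
      (δ * P.lowPass i))).congr_deriv ?_
  have := (P.freq_pos i).ne'
  simp only
  field_simp
  ring

theorem hasDerivWithinAt_slow {u : ℝ → State} {u' f' : _} (hu : HasDerivWithinAt u u' s τ)
    (hf : HasDerivWithinAt (fun t => P.fast H a δ t (u t)) f' s τ) :
    HasDerivWithinAt (fun t => P.slow H a δ t (u t))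
      (WithLp.toLp 2 fun i => u'.1 i - P.slope i * f' i) s τ := by
  have h1 : HasDerivWithinAt (fun t => (u t).1) u'.1 s τ := hu.fst
  rw [hasDerivWithinAt_plane] at h1 hf ⊢
  intro i
  exact (h1 i).sub ((hf i).const_mul _)

end General

section Solution

variable {z : ℝ → State} {s : Set ℝ}

/-- The derivatives of `intCubic` and `intQuad` cancel the state-independent oscillating forcing of
order ‖a‖². What is left of the perturbed cost is `costDiff`, which is cubic in the amplitude at r =
0. Moving the frame with v(r) costs the term Dv(rate). -/
theorem hasDerivWithinAt_shift_solution (hv : ∀ r, HasFDerivAt v (Dv r) r)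
    (hz : HasDerivWithinAt z (P.costField v a δ τ (z τ)) s τ) {u : State}
    (hu : P.shift v H a δ τ (z τ) = u) :
    HasDerivWithinAt (fun t => P.shift v H a δ t (z t))
      (δ • (P.rate H a δ τ u,
        WithLp.toLp 2 fun i => P.lowPass i * sin (P.freq i * τ) * (P.costDiff v H a τ u.1
          - u.2.2.1 i - δ * P.highPass i * P.intQuad H a τ)
          - P.lowPass i * P.estimate H a δ τ i u,
        WithLp.toLp 2 fun i => -P.highPass i * u.2.2.1 i + P.remEta v Dv H a δ τ i u,
        WithLp.toLp 2 fun i => -P.moment i * u.2.2.2 i + P.remMoment H a δ τ i u)) s τ := by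
  have hsh := hasDerivWithinAt_shift (H := H) (P := P) (a := a) (δ := δ) hv hz
  subst hu
  have hrate : P.rate H a δ τ (P.shift v H a δ τ (z τ))
      = WithLp.toLp 2 fun i => -(P.gain i * (z τ).2.1 i) / √((z τ).2.2.2 i + P.eps) := by
    ext j
    simp [rate, estimate, shift]
  refine hsh.congr_deriv ?_
  refine Prod.ext ?_ (Prod.ext ?_ (Prod.ext ?_ ?_))
  · simp [costField, hrate]
  · ext i
    simp [costField, costDiff, shift, estimate, cubicRate]
    ring
  · ext i
    simp only [costField, remEta, hrate, costDiff]
    simp [shift]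
    ring
  · ext i
    simp only [costField, remMoment, estimate, shift, Prod.smul_snd, PiLp.smul_apply, smul_eq_mul]
    ring

theorem hasDerivWithinAt_zeta_solution (hv : ∀ r, HasFDerivAt v (Dv r) r)
    (hz : HasDerivWithinAt z (P.costField v a δ τ (z τ)) s τ) {u : State}
    (hu : P.shift v H a δ τ (z τ) = u) :
    HasDerivWithinAt (fun t => (P.shift v H a δ t (z t)).2.2.1)
      (δ • WithLp.toLp 2 fun i => -P.highPass i * u.2.2.1 i + P.remEta v Dv H a δ τ i u) s τ :=
  (hasDerivWithinAt_shift_solution hv hz hu).snd.snd.fst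

theorem hasDerivWithinAt_moment_solution (hv : ∀ r, HasFDerivAt v (Dv r) r)
    (hz : HasDerivWithinAt z (P.costField v a δ τ (z τ)) s τ) {u : State}
    (hu : P.shift v H a δ τ (z τ) = u) :
    HasDerivWithinAt (fun t => (P.shift v H a δ t (z t)).2.2.2)
      (δ • WithLp.toLp 2 fun i => -P.moment i * u.2.2.2 i + P.remMoment H a δ τ i u) s τ :=
  (hasDerivWithinAt_shift_solution hv hz hu).snd.snd.snd

theorem intLin_smul (i : Fin 2) (c : ℝ) (r : Plane) :
    P.intLin H a i τ (c • r) = c * P.intLin H a i τ r := by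
  simp [intLin, Fin.sum_univ_two]
  ring

/-- The derivatives of the two corrections in `fast` cancel the forcing sin(ω_i τ)·H(r,p) and
-sin(ω_i τ)·ζ_i, up to the averaged gradient. All other terms either come from the Taylor remainder
of the cost or carry a second factor δ. -/
theorem hasDerivWithinAt_fast_solution (hv : ∀ r, HasFDerivAt v (Dv r) r)
    (hz : HasDerivWithinAt z (P.costField v a δ τ (z τ)) s τ) {u : State}
    (hu : P.shift v H a δ τ (z τ) = u) :
    HasDerivWithinAt (fun t => P.fast H a δ t (P.shift v H a δ t (z t)))
      (δ • WithLp.toLp 2 fun i => -P.lowPass i * P.fast H a δ τ u i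
        + (P.lowPass i * (a i / 2) * H u.1 (unitVec i) + P.remFast v Dv H a δ τ i u)) s τ := by
  refine (hasDerivWithinAt_fast (hasDerivWithinAt_shift_solution hv hz hu)).congr_deriv ?_
  rw [hu]
  ext i
  simp only [Prod.smul_fst, Prod.smul_snd, PiLp.smul_apply, smul_eq_mul, intLin_smul, fast, remFast,
    estimate]
  ring

/-- Because slope times low-pass cutoff equals gain over √ε, the damping of x cancels the drift -k
q/√ε of r up to the O(δ) difference between q and x. Freezing the step size at √ε leaves the factor
1/√ε - 1/√(m+ε) in `remSlow`. -/
theorem hasDerivWithinAt_slow_solution (hv : ∀ r, HasFDerivAt v (Dv r) r)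
    (hz : HasDerivWithinAt z (P.costField v a δ τ (z τ)) s τ) {u : State}
    (hu : P.shift v H a δ τ (z τ) = u) :
    HasDerivWithinAt (fun t => P.slow H a δ t (P.shift v H a δ t (z t)))
      (δ • WithLp.toLp 2 fun i => -(P.gain i / √P.eps * (a i / 2)) * H u.1 (unitVec i)
        + P.remSlow v Dv H a δ τ i u) s τ := by
  refine (hasDerivWithinAt_slow (hasDerivWithinAt_shift_solution hv hz hu)
    (hasDerivWithinAt_fast_solution hv hz hu)).congr_deriv ?_
  ext i
  have h1 := (P.lowPass_pos i).ne'
  have h2 := (Real.sqrt_pos.2 P.eps_pos).ne'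
  simp only [Prod.smul_fst, PiLp.smul_apply, smul_eq_mul, fast, remSlow, estimate, rate, slope]
  rw [div_eq_mul_one_div (-(P.gain i * (u.2.1 i + δ * P.lowPass i * P.intCubic H a i τ)))]
  field_simp
  ring

end Solution

end Params
end ExtremumSeeking
end

/-! ### Lipschitz and boundedness calculus with constants uniform in the parameters. -/

noncomputable section
namespace ExtremumSeeking
open Set Real

/-- Parameters over which the remainder estimates are uniform. -/
structure Regime where
  /-- perturbation amplitudes -/
  amp : Plane
  /-- time scale separation -/
  δ : ℝ
  /-- radius of the region in the `r` and `m` directions -/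
  ρ : ℝ
  /-- time -/
  τ : ℝ

/-- Distance of two states in all but the first block. -/
def fastDist (u w : State) : ℝ := ‖u.2.1 - w.2.1‖ + ‖u.2.2.1 - w.2.2.1‖ + ‖u.2.2.2 - w.2.2.2‖

theorem fastDist_nonneg (u w : State) : 0 ≤ fastDist u w := by unfold fastDist; positivity

/-- The region of the shifted state space in which the averaging estimates hold. -/
def region (c : ℝ) (a : Plane) (ρ : ℝ) : Set State :=
  {u | ‖u.1‖ ≤ ρ ∧ ‖u.2.1‖ ≤ c * ‖a‖ ∧ ‖u.2.2.2‖ ≤ ρ}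

namespace Params

variable (P : Params)

/-- The parameter range considered: small amplitude, small region, small time scale. -/
structure Admissible (θ : Regime) : Prop where
  amp_le : ‖θ.amp‖ ≤ θ.ρ
  rad_le_one : θ.ρ ≤ 1
  rad_le_eps : θ.ρ ≤ P.eps / 2
  scale_nonneg : 0 ≤ θ.δ
  scale_le_one : θ.δ ≤ 1

/-- `f` is Lipschitz on the region, with constants of order `A` in the `r` direction and of order
`B` in the other directions. -/
def IsLip (c : ℝ) (f : Regime → State → ℝ) (A B : Regime → ℝ) : Prop :=
  ∃ C ≥ 0, ∀ θ, P.Admissible θ → 0 ≤ A θ ∧ 0 ≤ B θ ∧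
    ∀ u ∈ region c θ.amp θ.ρ, ∀ w ∈ region c θ.amp θ.ρ,
      |f θ u - f θ w| ≤ C * (A θ * ‖u.1 - w.1‖ + B θ * fastDist u w)

/-- `f` is of order `M` on the region. -/
def IsBdd (c : ℝ) (f : Regime → State → ℝ) (M : Regime → ℝ) : Prop :=
  ∃ C ≥ 0, ∀ θ, P.Admissible θ → 0 ≤ M θ ∧ ∀ u ∈ region c θ.amp θ.ρ, |f θ u| ≤ C * M θ

variable {P} {c : ℝ} {f g : Regime → State → ℝ} {A B A' B' M M' : Regime → ℝ}

theorem Admissible.rad_nonneg {θ : Regime} (h : P.Admissible θ) : 0 ≤ θ.ρ :=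
  (norm_nonneg _).trans h.amp_le

theorem IsLip.mono (hf : P.IsLip c f A B) (k : ℝ) (hk : 0 ≤ k)
    (h : ∀ θ, P.Admissible θ → A θ ≤ k * A' θ ∧ B θ ≤ k * B' θ ∧ 0 ≤ A' θ ∧ 0 ≤ B' θ) :
    P.IsLip c f A' B' := by
  obtain ⟨C, hC, hf⟩ := hf
  refine ⟨C * k, by positivity, fun θ hθ => ⟨(h θ hθ).2.2.1, (h θ hθ).2.2.2, fun u hu w hw => ?_⟩⟩
  refine ((hf θ hθ).2.2 u hu w hw).trans ?_
  obtain ⟨h1, h2, -, -⟩ := h θ hθ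
  have := fastDist_nonneg u w
  calc C * (A θ * ‖u.1 - w.1‖ + B θ * fastDist u w)
      ≤ C * (k * A' θ * ‖u.1 - w.1‖ + k * B' θ * fastDist u w) := by gcongr
    _ = _ := by ring

theorem IsLip.add (hf : P.IsLip c f A B) (hg : P.IsLip c g A B) :
    P.IsLip c (fun θ u => f θ u + g θ u) A B := by
  obtain ⟨C, hC, hf⟩ := hf
  obtain ⟨C', hC', hg⟩ := hg
  refine ⟨C + C', by positivity, fun θ hθ => ⟨(hf θ hθ).1, (hf θ hθ).2.1, fun u hu w hw => ?_⟩⟩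
  have h1 := (hf θ hθ).2.2 u hu w hw
  have h2 := (hg θ hθ).2.2 u hu w hw
  calc |f θ u + g θ u - (f θ w + g θ w)| = |(f θ u - f θ w) + (g θ u - g θ w)| := by congr 1; ring
    _ ≤ _ := (abs_add_le _ _).trans (add_le_add h1 h2)
    _ = _ := by ring

theorem IsLip.const_mul (hf : P.IsLip c f A B) {k : Regime → ℝ} {G : Regime → ℝ} (L : ℝ)
    (hk : ∀ θ, P.Admissible θ → |k θ| ≤ L * G θ ∧ 0 ≤ G θ) (hL : 0 ≤ L) :
    P.IsLip c (fun θ u => k θ * f θ u) (fun θ => G θ * A θ) (fun θ => G θ * B θ) := by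
  obtain ⟨C, hC, hf⟩ := hf
  refine ⟨L * C, by positivity, fun θ hθ => ⟨mul_nonneg (hk θ hθ).2 (hf θ hθ).1,
    mul_nonneg (hk θ hθ).2 (hf θ hθ).2.1, fun u hu w hw => ?_⟩⟩
  have h1 := (hf θ hθ).2.2 u hu w hw
  have h2 := hk θ hθ
  have h3 : 0 ≤ L * G θ := mul_nonneg hL h2.2
  calc |k θ * f θ u - k θ * f θ w| = |k θ| * |f θ u - f θ w| := by rw [← abs_mul]; congr 1; ring
    _ ≤ (L * G θ) * (C * (A θ * ‖u.1 - w.1‖ + B θ * fastDist u w)) :=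
        mul_le_mul h2.1 h1 (abs_nonneg _) h3
    _ = _ := by ring

theorem IsLip.real_mul (hf : P.IsLip c f A B) (k : ℝ) : P.IsLip c (fun θ u => k * f θ u) A B := by
  have := hf.const_mul (k := fun _ => k) (G := fun _ => 1) |k| (fun _ _ => by simp) (abs_nonneg _)
  simpa using this

theorem IsLip.neg (hf : P.IsLip c f A B) : P.IsLip c (fun θ u => -f θ u) A B := by
  simpa using hf.real_mul (-1)

theorem IsLip.sub (hf : P.IsLip c f A B) (hg : P.IsLip c g A B) :
    P.IsLip c (fun θ u => f θ u - g θ u) A B := by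
  simpa [sub_eq_add_neg] using hf.add hg.neg

theorem isLip_const (k : Regime → ℝ) (h : ∀ θ, P.Admissible θ → 0 ≤ A θ ∧ 0 ≤ B θ) :
    P.IsLip c (fun θ _ => k θ) A B := by
  refine ⟨0, le_rfl, fun θ hθ => ⟨(h θ hθ).1, (h θ hθ).2, fun u _ w _ => by simp⟩⟩

theorem IsLip.mul (hf : P.IsLip c f A B) (hfM : P.IsBdd c f M) (hg : P.IsLip c g A' B')
    (hgM : P.IsBdd c g M') :
    P.IsLip c (fun θ u => f θ u * g θ u) (fun θ => A θ * M' θ + M θ * A' θ)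
      (fun θ => B θ * M' θ + M θ * B' θ) := by
  obtain ⟨C, hC, hf⟩ := hf
  obtain ⟨D, hD, hfM⟩ := hfM
  obtain ⟨C', hC', hg⟩ := hg
  obtain ⟨D', hD', hgM⟩ := hgM
  refine ⟨C * D' + D * C', by positivity, fun θ hθ => ?_⟩
  obtain ⟨hA, hB, hf⟩ := hf θ hθ
  obtain ⟨hM, hfM⟩ := hfM θ hθ
  obtain ⟨hA', hB', hg⟩ := hg θ hθ
  obtain ⟨hM', hgM⟩ := hgM θ hθ
  refine ⟨by positivity, by positivity, fun u hu w hw => ?_⟩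
  have hd := fastDist_nonneg u w
  have hn := norm_nonneg (u.1 - w.1)
  calc |f θ u * g θ u - f θ w * g θ w|
      = |(f θ u - f θ w) * g θ u + f θ w * (g θ u - g θ w)| := by congr 1; ring
    _ ≤ |f θ u - f θ w| * |g θ u| + |f θ w| * |g θ u - g θ w| := by
        rw [← abs_mul, ← abs_mul]; exact abs_add_le _ _
    _ ≤ C * (A θ * ‖u.1 - w.1‖ + B θ * fastDist u w) * (D' * M' θ)
        + D * M θ * (C' * (A' θ * ‖u.1 - w.1‖ + B' θ * fastDist u w)) := by
        refine add_le_add (mul_le_mul (hf u hu w hw) (hgM u hu) (abs_nonneg _) (by positivity))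
          (mul_le_mul (hfM w hw) (hg u hu w hw) (abs_nonneg _) (by positivity))
    _ = C * D' * ((A θ * M' θ) * ‖u.1 - w.1‖ + (B θ * M' θ) * fastDist u w)
        + D * C' * ((M θ * A' θ) * ‖u.1 - w.1‖ + (M θ * B' θ) * fastDist u w) := by ring
    _ ≤ C * D' * ((A θ * M' θ + M θ * A' θ) * ‖u.1 - w.1‖
          + (B θ * M' θ + M θ * B' θ) * fastDist u w)
        + D * C' * ((A θ * M' θ + M θ * A' θ) * ‖u.1 - w.1‖
          + (B θ * M' θ + M θ * B' θ) * fastDist u w) := by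
        have e1 : 0 ≤ A θ * M' θ := by positivity
        have e2 : 0 ≤ M θ * A' θ := by positivity
        have e3 : 0 ≤ B θ * M' θ := by positivity
        have e4 : 0 ≤ M θ * B' θ := by positivity
        gcongr <;> linarith
    _ = _ := by ring

theorem IsBdd.mul (hf : P.IsBdd c f M) (hg : P.IsBdd c g M') :
    P.IsBdd c (fun θ u => f θ u * g θ u) (fun θ => M θ * M' θ) := by
  obtain ⟨D, hD, hfM⟩ := hf
  obtain ⟨D', hD', hgM⟩ := hg
  refine ⟨D * D', by positivity, fun θ hθ => ⟨mul_nonneg (hfM θ hθ).1 (hgM θ hθ).1,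
    fun u hu => ?_⟩⟩
  have := (hfM θ hθ).1
  rw [abs_mul]
  calc _ ≤ D * M θ * (D' * M' θ) :=
        mul_le_mul ((hfM θ hθ).2 u hu) ((hgM θ hθ).2 u hu) (abs_nonneg _) (by positivity)
    _ = _ := by ring

theorem IsBdd.real_mul (hf : P.IsBdd c f M) (k : ℝ) : P.IsBdd c (fun θ u => k * f θ u) M := by
  obtain ⟨D, hD, hf⟩ := hf
  refine ⟨|k| * D, by positivity, fun θ hθ => ⟨(hf θ hθ).1, fun u hu => ?_⟩⟩
  rw [abs_mul, mul_assoc]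
  exact mul_le_mul_of_nonneg_left ((hf θ hθ).2 u hu) (abs_nonneg _)

/-! ### The building blocks of the remainders -/

/-- Rationalizing gives (y - x)/(√x √y (√x + √y)), and the denominator is at least e√e. -/
theorem abs_one_div_sqrt_sub_le {e x y : ℝ} (he : 0 < e) (hx : e ≤ x) (hy : e ≤ y) :
    |1 / √x - 1 / √y| ≤ 1 / (e * √e) * |x - y| := by
  have hx0 : 0 < x := he.trans_le hx
  have hy0 : 0 < y := he.trans_le hy
  have sx := Real.sqrt_pos.2 hx0
  have sy := Real.sqrt_pos.2 hy0
  have se := Real.sqrt_pos.2 he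
  have hex : √e ≤ √x := Real.sqrt_le_sqrt hx
  have hey : √e ≤ √y := Real.sqrt_le_sqrt hy
  have h1 : 1 / √x - 1 / √y = (y - x) / (√x * √y * (√x + √y)) := by
    have e1 := Real.mul_self_sqrt hx0.le
    have e2 := Real.mul_self_sqrt hy0.le
    field_simp
    nlinarith
  rw [h1, abs_div, abs_sub_comm, abs_of_pos (by positivity : 0 < √x * √y * (√x + √y)),
    div_eq_inv_mul, ← one_div]
  refine mul_le_mul_of_nonneg_right (one_div_le_one_div_of_le (by positivity) ?_) (abs_nonneg _)
  calc e * √e = √e * √e * √e := by rw [Real.mul_self_sqrt he.le]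
    _ ≤ √x * √y * (√x + √y) := by gcongr; linarith

theorem half_eps_le_moment {θ : Regime} (hθ : P.Admissible θ) {u : State}
    (hu : u ∈ region c θ.amp θ.ρ) (i : Fin 2) : P.eps / 2 ≤ u.2.2.2 i + P.eps := by
  have h1 := abs_coord_le u.2.2.2 i
  have h2 := neg_abs_le (u.2.2.2 i)
  have h3 := hu.2.2
  have h4 := hθ.rad_le_eps
  linarith

theorem isLip_invSqrt (i : Fin 2) :
    P.IsLip c (fun _ u => 1 / √(u.2.2.2 i + P.eps)) (fun _ => 0) (fun _ => 1) := by
  have he : 0 < P.eps / 2 := half_pos P.eps_pos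
  refine ⟨1 / (P.eps / 2 * √(P.eps / 2)), by positivity, fun θ hθ => ⟨le_rfl, zero_le_one,
    fun u hu w hw => ?_⟩⟩
  refine (abs_one_div_sqrt_sub_le he (half_eps_le_moment hθ hu i)
    (half_eps_le_moment hθ hw i)).trans ?_
  gcongr
  have h1 := abs_coord_le (u.2.2.2 - w.2.2.2) i
  simp only [PiLp.sub_apply] at h1
  have := norm_nonneg (u.2.1 - w.2.1)
  have := norm_nonneg (u.2.2.1 - w.2.2.1)
  simp only [add_sub_add_right_eq_sub, zero_mul, one_mul, zero_add, fastDist]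
  linarith

theorem isBdd_invSqrt_sub (i : Fin 2) :
    P.IsBdd c (fun _ u => 1 / √P.eps - 1 / √(u.2.2.2 i + P.eps)) (fun θ => θ.ρ) := by
  have he : 0 < P.eps / 2 := half_pos P.eps_pos
  refine ⟨1 / (P.eps / 2 * √(P.eps / 2)), by positivity, fun θ hθ => ⟨hθ.rad_nonneg,
    fun u hu => ?_⟩⟩
  refine (abs_one_div_sqrt_sub_le he (by linarith) (half_eps_le_moment hθ hu i)).trans ?_
  gcongr
  have h1 := abs_coord_le u.2.2.2 i
  simp only [sub_add_cancel_right, abs_neg]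
  exact h1.trans hu.2.2

theorem isBdd_invSqrt (i : Fin 2) :
    P.IsBdd c (fun _ u => 1 / √(u.2.2.2 i + P.eps)) (fun _ => 1) := by
  have he : 0 < P.eps / 2 := half_pos P.eps_pos
  refine ⟨1 / √(P.eps / 2), by positivity, fun θ hθ => ⟨zero_le_one, fun u hu => ?_⟩⟩
  rw [abs_of_nonneg (by positivity), mul_one]
  exact one_div_le_one_div_of_le (Real.sqrt_pos.2 he)
    (Real.sqrt_le_sqrt (half_eps_le_moment hθ hu i))

end Params
end ExtremumSeeking
end

/-! ### Lipschitz constants of the terms of the transformed field. -/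

noncomputable section
namespace ExtremumSeeking
open Set Real

theorem norm_le_sum_abs (x : Plane) : ‖x‖ ≤ |x 0| + |x 1| := by
  rw [EuclideanSpace.norm_eq, Fin.sum_univ_two]
  simp only [Real.norm_eq_abs, sq_abs]
  rw [Real.sqrt_le_left (by positivity)]
  nlinarith [abs_nonneg (x 0), abs_nonneg (x 1), sq_abs (x 0), sq_abs (x 1),
    mul_nonneg (abs_nonneg (x 0)) (abs_nonneg (x 1))]

theorem plane_eq_sum (x : Plane) : x = ∑ j, x j • unitVec j := by
  ext i
  fin_cases i <;> simp [Fin.sum_univ_two]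

theorem RegularCost.hasFDerivAt_comp_add {v : Plane → ℝ} {Dv : Plane → Plane →L[ℝ] ℝ}
    {H : Plane →L[ℝ] Plane →L[ℝ] ℝ} {K : ℝ} (hv : RegularCost v Dv H K) (x p : Plane) :
    HasFDerivAt (fun r => v (r + p)) (Dv (x + p)) x := by
  have h : HasFDerivAt (fun r : Plane => r + p) (ContinuousLinearMap.id ℝ Plane) x :=
    (hasFDerivAt_id x).add_const p
  exact (hv.hasFDerivAt (x + p)).comp x h

namespace Params

variable {P : Params} {c : ℝ} {v : Plane → ℝ} {Dv : Plane → Plane →L[ℝ] ℝ}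
  {H : Plane →L[ℝ] Plane →L[ℝ] ℝ} {K T : ℝ}

theorem intLin_sub (a : Plane) (i : Fin 2) (τ : ℝ) (r s : Plane) :
    P.intLin H a i τ (r - s) = P.intLin H a i τ r - P.intLin H a i τ s := by
  simp [intLin, Fin.sum_univ_two]
  ring

theorem isLip_estimate (i : Fin 2) :
    P.IsLip c (fun θ u => P.estimate H θ.amp θ.δ θ.τ i u) (fun _ => 0) (fun _ => 1) := by
  refine ⟨1, zero_le_one, fun θ hθ => ⟨le_rfl, zero_le_one, fun u _ w _ => ?_⟩⟩
  have h1 := abs_coord_le (u.2.1 - w.2.1) i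
  simp only [PiLp.sub_apply] at h1
  have := norm_nonneg (u.2.2.1 - w.2.2.1)
  have := norm_nonneg (u.2.2.2 - w.2.2.2)
  simp only [estimate, add_sub_add_right_eq_sub, zero_mul, one_mul, zero_add, fastDist]
  linarith

theorem isBdd_estimate (hc : 0 ≤ c) (hT : 0 < T)
    (hper : ∀ i, Function.Periodic (fun τ : ℝ => sin (P.freq i * τ)) T) (i : Fin 2) :
    P.IsBdd c (fun θ u => P.estimate H θ.amp θ.δ θ.τ i u) (fun θ => ‖θ.amp‖) := by
  have hl := P.lowPass_pos i
  refine ⟨c + P.lowPass i * (2 * ‖H‖ * T), by positivity, fun θ hθ => ⟨norm_nonneg _,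
    fun u hu => ?_⟩⟩
  have h1 := abs_coord_le u.2.1 i
  have h2 := (periodic_intCubic_and_bound H θ.amp hT hper i).2 θ.τ
  have hδ := hθ.scale_nonneg
  have hα : ‖θ.amp‖ ≤ 1 := hθ.amp_le.trans hθ.rad_le_one
  have h3 : |θ.δ * P.lowPass i * P.intCubic H θ.amp i θ.τ|
      ≤ 1 * P.lowPass i * (2 * ‖H‖ * (‖θ.amp‖ * 1) * T) := by
    rw [abs_mul, abs_mul, abs_of_nonneg hδ, abs_of_pos hl]
    have h4 : 2 * ‖H‖ * ‖θ.amp‖ ^ 2 * T ≤ 2 * ‖H‖ * (‖θ.amp‖ * 1) * T := by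
      rw [sq]; gcongr
    have h5 := hθ.scale_le_one
    have h6 := h2.trans h4
    gcongr
  refine (abs_add_le _ _).trans ?_
  have h4 := hu.2.1
  nlinarith

theorem isLip_rate (hc : 0 ≤ c) (hT : 0 < T)
    (hper : ∀ i, Function.Periodic (fun τ : ℝ => sin (P.freq i * τ)) T) (i : Fin 2) :
    P.IsLip c (fun θ u => P.rate H θ.amp θ.δ θ.τ u i) (fun _ => 0) (fun _ => 1) := by
  have h := ((isLip_estimate (H := H) i).mul (isBdd_estimate hc hT hper i) (isLip_invSqrt i)
    (isBdd_invSqrt (c := c) i)).real_mul (-P.gain i)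
  have h2 := h.mono (A' := fun _ => 0) (B' := fun _ => 1) 2 (by norm_num) fun θ hθ => by
    have := hθ.amp_le
    have := hθ.rad_le_one
    exact ⟨by simp, by linarith, le_rfl, zero_le_one⟩
  convert h2 using 3
  simp only [rate]
  ring

theorem isBdd_rate (hc : 0 ≤ c) (hT : 0 < T)
    (hper : ∀ i, Function.Periodic (fun τ : ℝ => sin (P.freq i * τ)) T) (i : Fin 2) :
    P.IsBdd c (fun θ u => P.rate H θ.amp θ.δ θ.τ u i) (fun θ => ‖θ.amp‖) := by
  have h := ((isBdd_estimate (H := H) hc hT hper i).mul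
    (isBdd_invSqrt (c := c) i)).real_mul (-P.gain i)
  simp only [mul_one] at h
  convert h using 3
  simp only [rate]
  ring

theorem isLip_grad (hv : RegularCost v Dv H K) (j : Fin 2) :
    P.IsLip c (fun _ u => Dv u.1 (unitVec j)) (fun _ => 1) (fun _ => 0) := by
  refine ⟨K, zero_le_one.trans hv.one_le, fun θ hθ => ⟨zero_le_one, le_rfl, fun u _ w _ => ?_⟩⟩
  have h1 := (Dv u.1 - Dv w.1).le_opNorm (unitVec j)
  rw [norm_unitVec, mul_one, Real.norm_eq_abs] at h1
  simp only [one_mul, zero_mul, add_zero]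
  exact h1.trans (hv.Dv_lip _ _)

theorem isBdd_grad (hv : RegularCost v Dv H K) (j : Fin 2) :
    P.IsBdd c (fun _ u => Dv u.1 (unitVec j)) (fun θ => θ.ρ) := by
  have hK : 0 ≤ K := zero_le_one.trans hv.one_le
  refine ⟨K, hK, fun θ hθ => ⟨hθ.rad_nonneg, fun u hu => ?_⟩⟩
  have h1 := (Dv u.1).le_opNorm (unitVec j)
  rw [norm_unitVec, mul_one, Real.norm_eq_abs] at h1
  have h2 := hv.Dv_lip u.1 0
  rw [hv.Dv_zero, sub_zero, sub_zero] at h2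
  exact h1.trans (h2.trans (mul_le_mul_of_nonneg_left hu.1 hK))

/-- The variation of Dv in r is multiplied by the rate of r, which is O(‖a‖) on the region. This is
why `region` bounds its second component by a multiple of ‖a‖ and not merely by ρ. -/
theorem isLip_grad_rate (hv : RegularCost v Dv H K) (hc : 0 ≤ c) (hT : 0 < T)
    (hper : ∀ i, Function.Periodic (fun τ : ℝ => sin (P.freq i * τ)) T) :
    P.IsLip c (fun θ u => Dv u.1 (P.rate H θ.amp θ.δ θ.τ u)) (fun θ => ‖θ.amp‖)
      (fun θ => θ.ρ + θ.δ) := by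
  have h := fun j => ((isLip_rate (H := H) hc hT hper j).mul (isBdd_rate hc hT hper j)
    (isLip_grad (c := c) hv j) (isBdd_grad hv j)).mono (A' := fun θ => ‖θ.amp‖)
      (B' := fun θ => θ.ρ + θ.δ) 1 zero_le_one (fun θ hθ => by
        have := hθ.rad_nonneg
        have := hθ.scale_nonneg
        exact ⟨by simp, by linarith, norm_nonneg _, by linarith⟩)
  convert (h 0).add (h 1) using 3 with θ u
  conv_lhs => rw [plane_eq_sum (P.rate H θ.amp θ.δ θ.τ u)]
  simp [Fin.sum_univ_two]

theorem isLip_costDiff (hv : RegularCost v Dv H K) :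
    P.IsLip c (fun θ u => P.costDiff v H θ.amp θ.τ u.1) (fun θ => ‖θ.amp‖) (fun _ => 0) := by
  have hK : 0 ≤ K := zero_le_one.trans hv.one_le
  refine ⟨K, hK, fun θ hθ => ⟨norm_nonneg _, le_rfl, fun u _ w _ => ?_⟩⟩
  have hd : ∀ x ∈ (univ : Set Plane), HasFDerivWithinAt (fun r => P.costDiff v H θ.amp θ.τ r)
      (Dv (x + P.perturbation θ.amp θ.τ) - Dv x) univ x := fun x _ =>
    (((hv.hasFDerivAt_comp_add x _).sub (hv.hasFDerivAt x)).sub_const _).hasFDerivWithinAt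
  have := convex_univ.norm_image_sub_le_of_norm_hasFDerivWithin_le hd (C := K * ‖θ.amp‖)
    (fun x _ => (hv.Dv_lip _ _).trans (by
      rw [add_sub_cancel_left]
      gcongr
      exact P.norm_perturbation_le _ _)) (mem_univ w.1) (mem_univ u.1)
  rw [Real.norm_eq_abs] at this
  refine this.trans (le_of_eq ?_)
  ring

/-- The derivative in r is Dv(r+p) - Dv(r) - H(p), of size (‖r‖ + ‖p‖)‖p‖ by the Taylor estimate.
The gain of a factor ρ over ‖a‖ is what allows a decay rate of order ‖a‖ to absorb this term. -/
theorem isLip_costDiff_sub (hv : RegularCost v Dv H K) :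
    P.IsLip c (fun θ u => P.costDiff v H θ.amp θ.τ u.1 - H u.1 (P.perturbation θ.amp θ.τ))
      (fun θ => (θ.ρ + θ.δ) * ‖θ.amp‖) (fun θ => θ.ρ + θ.δ) := by
  have hK : 0 ≤ K := zero_le_one.trans hv.one_le
  refine ⟨K * 2, by positivity, fun θ hθ => ?_⟩
  have hρ := hθ.rad_nonneg
  have hδ := hθ.scale_nonneg
  refine ⟨by positivity, by positivity, fun u hu w hw => ?_⟩
  set p := P.perturbation θ.amp θ.τ with hp
  have hpn : ‖p‖ ≤ ‖θ.amp‖ := P.norm_perturbation_le _ _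
  have hd : ∀ x ∈ Metric.closedBall (0 : Plane) θ.ρ,
      HasFDerivWithinAt (fun r => P.costDiff v H θ.amp θ.τ r - H r p)
      (Dv (x + p) - Dv x - H p) (Metric.closedBall (0 : Plane) θ.ρ) x := by
    intro x _
    have h1 : HasFDerivAt (fun r => H r p) (H p) x := by
      refine (H.flip p).hasFDerivAt.congr_fderiv ?_
      ext y
      simp [hv.H_symm y p]
    exact ((((hv.hasFDerivAt_comp_add x _).sub (hv.hasFDerivAt x)).sub_const _).sub
      h1).hasFDerivWithinAt
  have hb : ∀ x ∈ Metric.closedBall (0 : Plane) θ.ρ,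
      ‖Dv (x + p) - Dv x - H p‖ ≤ K * ((θ.ρ + θ.ρ) * ‖θ.amp‖) := by
    intro x hx
    have hx' : ‖x‖ ≤ θ.ρ := by simpa using hx
    have := hθ.amp_le
    refine (hv.Dv_taylor x p).trans ?_
    gcongr
    linarith
  have := (convex_closedBall (0 : Plane) θ.ρ).norm_image_sub_le_of_norm_hasFDerivWithin_le hd hb
    (x := w.1) (y := u.1) (by simpa using hw.1) (by simpa using hu.1)
  rw [Real.norm_eq_abs] at this
  refine this.trans ?_
  have h1 := fastDist_nonneg u w
  have h2 : 0 ≤ K * 2 * ((θ.ρ + θ.δ) * fastDist u w) := by positivity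
  have h3 : 0 ≤ K * 2 * (θ.δ * ‖θ.amp‖ * ‖u.1 - w.1‖) := by positivity
  nlinarith

theorem isLip_intLin (i : Fin 2) :
    P.IsLip c (fun θ u => P.intLin H θ.amp i θ.τ u.1) (fun θ => ‖θ.amp‖) (fun _ => 1) := by
  obtain ⟨C, hC⟩ := P.exists_abs_intLin_le
  refine ⟨|C| * ‖H‖, by positivity, fun θ hθ => ⟨norm_nonneg _, zero_le_one, fun u _ w _ => ?_⟩⟩
  rw [← intLin_sub]
  have h1 := fastDist_nonneg u w
  refine (hC H θ.amp i θ.τ (u.1 - w.1)).trans ?_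
  calc C * ‖H‖ * ‖θ.amp‖ * ‖u.1 - w.1‖ ≤ |C| * ‖H‖ * ‖θ.amp‖ * ‖u.1 - w.1‖ := by
        gcongr; exact le_abs_self C
    _ ≤ |C| * ‖H‖ * (‖θ.amp‖ * ‖u.1 - w.1‖ + 1 * fastDist u w) := by
        have : 0 ≤ |C| * ‖H‖ * fastDist u w := by positivity
        linarith

theorem isLip_intLin_rate (hc : 0 ≤ c) (hT : 0 < T)
    (hper : ∀ i, Function.Periodic (fun τ : ℝ => sin (P.freq i * τ)) T) (i : Fin 2) :
    P.IsLip c (fun θ u => P.intLin H θ.amp i θ.τ (P.rate H θ.amp θ.δ θ.τ u))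
      (fun θ => ‖θ.amp‖) (fun _ => 1) := by
  obtain ⟨C, hC⟩ := P.exists_abs_intLin_le
  obtain ⟨D, hD, h0⟩ := isLip_rate (H := H) hc hT hper 0
  obtain ⟨D', hD', h1⟩ := isLip_rate (H := H) hc hT hper 1
  refine ⟨|C| * ‖H‖ * (D + D'), by positivity, fun θ hθ => ⟨norm_nonneg _, zero_le_one,
    fun u hu w hw => ?_⟩⟩
  have h2 := (h0 θ hθ).2.2 u hu w hw
  have h3 := (h1 θ hθ).2.2 u hu w hw
  have hw0 := fastDist_nonneg u w
  have hα : ‖θ.amp‖ ≤ 1 := hθ.amp_le.trans hθ.rad_le_one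
  simp only [zero_mul, zero_add, one_mul] at h2 h3
  rw [← intLin_sub]
  refine (hC H θ.amp i θ.τ _).trans ?_
  have h4 := norm_le_sum_abs (P.rate H θ.amp θ.δ θ.τ u - P.rate H θ.amp θ.δ θ.τ w)
  simp only [PiLp.sub_apply] at h4
  have h5 : ‖P.rate H θ.amp θ.δ θ.τ u - P.rate H θ.amp θ.δ θ.τ w‖ ≤ (D + D') * fastDist u w := by
    linarith
  calc C * ‖H‖ * ‖θ.amp‖ * ‖P.rate H θ.amp θ.δ θ.τ u - P.rate H θ.amp θ.δ θ.τ w‖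
      ≤ |C| * ‖H‖ * 1 * ((D + D') * fastDist u w) := by
        gcongr; exact le_abs_self C
    _ ≤ |C| * ‖H‖ * (D + D') * (‖θ.amp‖ * ‖u.1 - w.1‖ + 1 * fastDist u w) := by
        have : 0 ≤ |C| * ‖H‖ * (D + D') * (‖θ.amp‖ * ‖u.1 - w.1‖) := by positivity
        linarith

theorem isLip_cos_zeta (i : Fin 2) :
    P.IsLip c (fun θ u => cos (P.freq i * θ.τ) / P.freq i * u.2.2.1 i) (fun θ => ‖θ.amp‖)
      (fun _ => 1) := by
  have hf := P.freq_pos i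
  refine ⟨1 / P.freq i, by positivity, fun θ hθ => ⟨norm_nonneg _, zero_le_one, fun u _ w _ => ?_⟩⟩
  have h1 := abs_coord_le (u.2.2.1 - w.2.2.1) i
  simp only [PiLp.sub_apply] at h1
  rw [← mul_sub, abs_mul, abs_div, abs_of_pos hf]
  have := norm_nonneg (u.2.1 - w.2.1)
  have := norm_nonneg (u.2.2.2 - w.2.2.2)
  have : 0 ≤ ‖θ.amp‖ * ‖u.1 - w.1‖ := by positivity
  gcongr
  · exact abs_cos_le_one _
  · simp only [fastDist]
    linarith

theorem isLip_zeta (i : Fin 2) :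
    P.IsLip c (fun _ u => u.2.2.1 i) (fun θ => ‖θ.amp‖) (fun _ => 1) := by
  refine ⟨1, zero_le_one, fun θ hθ => ⟨norm_nonneg _, zero_le_one, fun u _ w _ => ?_⟩⟩
  have h1 := abs_coord_le (u.2.2.1 - w.2.2.1) i
  simp only [PiLp.sub_apply] at h1
  have := norm_nonneg (u.2.1 - w.2.1)
  have := norm_nonneg (u.2.2.2 - w.2.2.2)
  have : 0 ≤ ‖θ.amp‖ * ‖u.1 - w.1‖ := by positivity
  simp only [fastDist]
  linarith

/-! ### Lipschitz bounds for the remainders -/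

theorem isLip_remEta (hv : RegularCost v Dv H K) (hc : 0 ≤ c) (hT : 0 < T)
    (hper : ∀ i, Function.Periodic (fun τ : ℝ => sin (P.freq i * τ)) T) (i : Fin 2) :
    P.IsLip c (fun θ u => P.remEta v Dv H θ.amp θ.δ θ.τ i u) (fun θ => ‖θ.amp‖)
      (fun θ => θ.ρ + θ.δ) := by
  have hn : ∀ θ, P.Admissible θ → 0 ≤ ‖θ.amp‖ ∧ 0 ≤ θ.ρ + θ.δ := fun θ hθ =>
    ⟨norm_nonneg _, add_nonneg hθ.rad_nonneg hθ.scale_nonneg⟩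
  exact ((((isLip_costDiff hv).mono 1 zero_le_one fun θ hθ =>
    ⟨by simp, by simpa using (hn θ hθ).2, hn θ hθ⟩).real_mul (P.highPass i)).sub
    (isLip_const (fun θ => θ.δ * P.highPass i ^ 2 * P.intQuad H θ.amp θ.τ) hn)).sub
    (isLip_grad_rate hv hc hT hper)

theorem isLip_remMoment (hc : 0 ≤ c) (hT : 0 < T)
    (hper : ∀ i, Function.Periodic (fun τ : ℝ => sin (P.freq i * τ)) T) (i : Fin 2) :
    P.IsLip c (fun θ u => P.remMoment H θ.amp θ.δ θ.τ i u) (fun θ => ‖θ.amp‖)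
      (fun θ => θ.ρ + θ.δ) := by
  have h := ((isLip_estimate (H := H) i).mul (isBdd_estimate hc hT hper i)
    (isLip_estimate (H := H) i) (isBdd_estimate hc hT hper i)).real_mul (P.moment i)
  simp only [← sq] at h
  refine h.mono 2 (by norm_num) fun θ hθ => ?_
  have := hθ.rad_nonneg
  have := hθ.scale_nonneg
  have := hθ.amp_le
  have := norm_nonneg θ.amp
  exact ⟨by simp, by linarith, by linarith, by linarith⟩

/-- A term with a factor `δ` in front is small. -/
theorem IsLip.scale_mul {f : Regime → State → ℝ}
    (hf : P.IsLip c f (fun θ => ‖θ.amp‖) (fun _ => 1)) (k : ℝ) :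
    P.IsLip c (fun θ u => θ.δ * k * f θ u) (fun θ => (θ.ρ + θ.δ) * ‖θ.amp‖)
      (fun θ => θ.ρ + θ.δ) := by
  refine (hf.const_mul (k := fun θ => θ.δ * k) (G := fun θ => θ.δ) |k| (fun θ hθ => ?_)
    (abs_nonneg _)).mono 1 zero_le_one fun θ hθ => ?_
  · have := hθ.scale_nonneg
    rw [abs_mul, abs_of_nonneg this, mul_comm]
    exact ⟨le_rfl, this⟩
  · have h1 := hθ.rad_nonneg
    have h2 := hθ.scale_nonneg
    have h3 : 0 ≤ θ.ρ * ‖θ.amp‖ := by positivity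
    have h4 : 0 ≤ θ.δ * ‖θ.amp‖ := by positivity
    refine ⟨?_, ?_, by positivity, by positivity⟩
    · linarith
    · linarith

/-- The constant in r must be (ρ+δ)‖a‖ and not just ‖a‖: through `slope` this remainder also enters
the slow equation, where a term of order ‖a‖ would compete with the decay. -/
theorem isLip_remFast (hv : RegularCost v Dv H K) (hc : 0 ≤ c) (hT : 0 < T)
    (hper : ∀ i, Function.Periodic (fun τ : ℝ => sin (P.freq i * τ)) T) (i : Fin 2) :
    P.IsLip c (fun θ u => P.remFast v Dv H θ.amp θ.δ θ.τ i u) (fun θ => (θ.ρ + θ.δ) * ‖θ.amp‖)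
      (fun θ => θ.ρ + θ.δ) := by
  have hn : ∀ θ, P.Admissible θ → 0 ≤ (θ.ρ + θ.δ) * ‖θ.amp‖ ∧ 0 ≤ θ.ρ + θ.δ := fun θ hθ =>
    ⟨mul_nonneg (add_nonneg hθ.rad_nonneg hθ.scale_nonneg) (norm_nonneg _),
      add_nonneg hθ.rad_nonneg hθ.scale_nonneg⟩
  have hn' : ∀ θ, P.Admissible θ → 0 ≤ ‖θ.amp‖ ∧ (0 : ℝ) ≤ 1 := fun θ _ =>
    ⟨norm_nonneg _, zero_le_one⟩
  have h1 := ((isLip_costDiff_sub (c := c) (P := P) hv).sub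
    (isLip_const (fun θ => θ.δ * P.highPass i * P.intQuad H θ.amp θ.τ) hn)).const_mul
    (k := fun θ => P.lowPass i * sin (P.freq i * θ.τ)) (G := fun _ => 1) |P.lowPass i|
    (fun θ _ => by
      rw [abs_mul, mul_one]
      exact ⟨mul_le_of_le_one_right (abs_nonneg _) (abs_sin_le_one _), zero_le_one⟩)
    (abs_nonneg _)
  simp only [one_mul] at h1
  have h2 := (((isLip_intLin (c := c) (P := P) (H := H) i).add
    (isLip_const (fun θ => P.intCubic H θ.amp i θ.τ) hn')).add (isLip_cos_zeta i)).scale_mul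
    (P.lowPass i ^ 2)
  have h3 : P.IsLip c (fun θ u => -P.highPass i * u.2.2.1 i + P.remEta v Dv H θ.amp θ.δ θ.τ i u)
      (fun θ => ‖θ.amp‖) (fun _ => 1) :=
    ((isLip_zeta i).real_mul (-P.highPass i)).add
      ((isLip_remEta hv hc hT hper i).mono 2 (by norm_num) fun θ hθ => by
        have := norm_nonneg θ.amp
        have := hθ.rad_le_one
        have := hθ.scale_le_one
        exact ⟨by linarith, by linarith, by linarith, zero_le_one⟩)
  have h4 := h3.const_mul (k := fun θ => cos (P.freq i * θ.τ) / P.freq i) (G := fun _ => 1)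
    (1 / P.freq i) (fun θ _ => by
      have hf := P.freq_pos i
      rw [abs_div, abs_of_pos hf, mul_one]
      exact ⟨by gcongr; exact abs_cos_le_one _, zero_le_one⟩) (by have := P.freq_pos i; positivity)
  simp only [one_mul] at h4
  have h5 := ((isLip_intLin_rate (H := H) hc hT hper i).add h4).scale_mul (P.lowPass i)
  exact (h1.sub h2).sub h5

theorem isLip_remSlow (hv : RegularCost v Dv H K) (hc : 0 ≤ c) (hT : 0 < T)
    (hper : ∀ i, Function.Periodic (fun τ : ℝ => sin (P.freq i * τ)) T) (i : Fin 2) :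
    P.IsLip c (fun θ u => P.remSlow v Dv H θ.amp θ.δ θ.τ i u) (fun θ => (θ.ρ + θ.δ) * ‖θ.amp‖)
      (fun θ => θ.ρ + θ.δ) := by
  have hn' : ∀ θ, P.Admissible θ → 0 ≤ ‖θ.amp‖ ∧ (0 : ℝ) ≤ 1 := fun θ _ =>
    ⟨norm_nonneg _, zero_le_one⟩
  have h1 := (((((isLip_intLin (c := c) (P := P) (H := H) i).add
    (isLip_const (fun θ => P.intCubic H θ.amp i θ.τ) hn')).add (isLip_cos_zeta i)).scale_mul
    (P.lowPass i)).real_mul (P.gain i / √P.eps)).neg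
  have hd : P.IsLip c (fun _ u => 1 / √P.eps - 1 / √(u.2.2.2 i + P.eps)) (fun _ => 0)
      (fun _ => 1) :=
    (isLip_const (fun _ => 1 / √P.eps) fun _ _ => ⟨le_rfl, zero_le_one⟩).sub (isLip_invSqrt i)
  -- The step size error is a product of two small factors, q = O(‖a‖) and 1/√ε - 1/√(m+ε) = O(ρ),
  -- and neither depends on r.
  have h2 := ((isLip_estimate (H := H) i).mul (isBdd_estimate hc hT hper i) hd
    (isBdd_invSqrt_sub (c := c) i)).real_mul (P.gain i)
  simp only [← mul_assoc] at h2
  have h3 := h2.mono (A' := fun θ => (θ.ρ + θ.δ) * ‖θ.amp‖) (B' := fun θ => θ.ρ + θ.δ) 2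
    (by norm_num) fun θ hθ => by
      have e1 := hθ.rad_nonneg
      have e2 := hθ.scale_nonneg
      have e3 := hθ.amp_le
      have e4 : 0 ≤ (θ.ρ + θ.δ) * ‖θ.amp‖ := by positivity
      exact ⟨by simp; linarith, by linarith, e4, by linarith⟩
  exact (h1.add h3).sub ((isLip_remFast hv hc hT hper i).real_mul (P.slope i))

end Params
end ExtremumSeeking
end

/-! ### Size of the remainders at the shifted origin. -/

noncomputable section
namespace ExtremumSeeking
open Set Real
namespace Params

variable {P : Params} {c : ℝ} {v : Plane → ℝ} {Dv : Plane → Plane →L[ℝ] ℝ}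
  {H : Plane →L[ℝ] Plane →L[ℝ] ℝ} {K T : ℝ}

/-- `f` is of the order of the residual of the averaged equations at the origin. -/
def IsResidual (P : Params) (f : Regime → ℝ) : Prop :=
  ∃ C ≥ 0, ∀ θ, P.Admissible θ → |f θ| ≤ C * (‖θ.amp‖ ^ 3 + θ.δ * ‖θ.amp‖ ^ 2)

theorem IsResidual.add {f g : Regime → ℝ} (hf : P.IsResidual f) (hg : P.IsResidual g) :
    P.IsResidual fun θ => f θ + g θ := by
  obtain ⟨C, hC, hf⟩ := hf
  obtain ⟨D, hD, hg⟩ := hg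
  refine ⟨C + D, by positivity, fun θ hθ => (abs_add_le _ _).trans ?_⟩
  have := hf θ hθ
  have := hg θ hθ
  linarith

theorem IsResidual.bdd_mul {f g : Regime → ℝ} (hf : P.IsResidual f) (D : ℝ)
    (hg : ∀ θ, P.Admissible θ → |g θ| ≤ D) : P.IsResidual fun θ => g θ * f θ := by
  obtain ⟨C, hC, hf⟩ := hf
  refine ⟨|D| * C, by positivity, fun θ hθ => ?_⟩
  rw [abs_mul, mul_assoc]
  exact mul_le_mul ((hg θ hθ).trans (le_abs_self D)) (hf θ hθ) (abs_nonneg _) (abs_nonneg _)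

theorem IsResidual.real_mul {f : Regime → ℝ} (hf : P.IsResidual f) (k : ℝ) :
    P.IsResidual fun θ => k * f θ := hf.bdd_mul |k| fun _ _ => le_rfl

theorem IsResidual.scale_mul {f : Regime → ℝ} (hf : P.IsResidual f) :
    P.IsResidual fun θ => θ.δ * f θ :=
  hf.bdd_mul 1 fun θ hθ => by rw [abs_of_nonneg hθ.scale_nonneg]; exact hθ.scale_le_one

theorem IsResidual.sub {f g : Regime → ℝ} (hf : P.IsResidual f) (hg : P.IsResidual g) :
    P.IsResidual fun θ => f θ - g θ := by
  simpa [sub_eq_add_neg] using hf.add (hg.real_mul (-1))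

theorem isResidual_intQuad : P.IsResidual fun θ => θ.δ * P.intQuad H θ.amp θ.τ := by
  obtain ⟨C, hC⟩ := P.exists_abs_intQuad_le
  refine ⟨|C| * ‖H‖, by positivity, fun θ hθ => ?_⟩
  have hδ := hθ.scale_nonneg
  rw [abs_mul, abs_of_nonneg hδ]
  calc θ.δ * |P.intQuad H θ.amp θ.τ| ≤ θ.δ * (|C| * ‖H‖ * ‖θ.amp‖ ^ 2) := by
        gcongr
        exact (hC H θ.amp θ.τ).trans (by gcongr; exact le_abs_self C)
    _ ≤ _ := by
        have : 0 ≤ |C| * ‖H‖ * ‖θ.amp‖ ^ 3 := by positivity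
        linarith

theorem isResidual_intCubic (hT : 0 < T)
    (hper : ∀ i, Function.Periodic (fun τ : ℝ => sin (P.freq i * τ)) T) (i : Fin 2) :
    P.IsResidual fun θ => θ.δ * P.intCubic H θ.amp i θ.τ := by
  refine ⟨2 * ‖H‖ * T, by positivity, fun θ hθ => ?_⟩
  have hδ := hθ.scale_nonneg
  rw [abs_mul, abs_of_nonneg hδ]
  calc θ.δ * |P.intCubic H θ.amp i θ.τ| ≤ θ.δ * (2 * ‖H‖ * ‖θ.amp‖ ^ 2 * T) := by
        gcongr
        exact (periodic_intCubic_and_bound H θ.amp hT hper i).2 θ.τ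
    _ ≤ _ := by
        have : 0 ≤ ‖H‖ * T * ‖θ.amp‖ ^ 3 := by positivity
        linarith

/-- At r = 0 this is v(p) - H(p,p)/2, which is cubic in p by Taylor's formula. -/
theorem isResidual_costDiff (hv : RegularCost v Dv H K) :
    P.IsResidual fun θ => P.costDiff v H θ.amp θ.τ 0 := by
  have hK : 0 ≤ K := zero_le_one.trans hv.one_le
  refine ⟨K, hK, fun θ hθ => ?_⟩
  have hδ := hθ.scale_nonneg
  have h1 := hv.v_taylor (P.perturbation θ.amp θ.τ)
  simp only [costDiff, zero_add, hv.v_zero, sub_zero]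
  refine h1.trans ?_
  have h2 : ‖P.perturbation θ.amp θ.τ‖ ^ 3 ≤ ‖θ.amp‖ ^ 3 := by
    gcongr; exact P.norm_perturbation_le _ _
  have : 0 ≤ θ.δ * ‖θ.amp‖ ^ 2 := by positivity
  gcongr
  linarith

theorem isResidual_estimate (hT : 0 < T)
    (hper : ∀ i, Function.Periodic (fun τ : ℝ => sin (P.freq i * τ)) T) (i : Fin 2) :
    P.IsResidual fun θ => P.estimate H θ.amp θ.δ θ.τ i 0 := by
  have := (isResidual_intCubic (H := H) hT hper i).real_mul (P.lowPass i)
  convert this using 2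
  simp [estimate]
  ring

theorem isResidual_rate (hT : 0 < T)
    (hper : ∀ i, Function.Periodic (fun τ : ℝ => sin (P.freq i * τ)) T) (i : Fin 2) :
    P.IsResidual fun θ => P.rate H θ.amp θ.δ θ.τ 0 i := by
  have := (isResidual_estimate (H := H) hT hper i).real_mul (-P.gain i / √P.eps)
  convert this using 2
  simp [rate]
  ring

theorem isResidual_intLin_rate (hT : 0 < T)
    (hper : ∀ i, Function.Periodic (fun τ : ℝ => sin (P.freq i * τ)) T) (i : Fin 2) :
    P.IsResidual fun θ => P.intLin H θ.amp i θ.τ (P.rate H θ.amp θ.δ θ.τ 0) := by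
  obtain ⟨C, hC⟩ := P.exists_abs_intLin_le
  obtain ⟨D, hD, h0⟩ := isResidual_rate (H := H) hT hper 0
  obtain ⟨D', hD', h1⟩ := isResidual_rate (H := H) hT hper 1
  refine ⟨|C| * ‖H‖ * (D + D'), by positivity, fun θ hθ => ?_⟩
  refine (hC H θ.amp i θ.τ _).trans ?_
  have h4 := norm_le_sum_abs (P.rate H θ.amp θ.δ θ.τ 0)
  have h2 := h0 θ hθ
  have h3 := h1 θ hθ
  have hα : ‖θ.amp‖ ≤ 1 := hθ.amp_le.trans hθ.rad_le_one
  have h5 : ‖P.rate H θ.amp θ.δ θ.τ 0‖ ≤ (D + D') * (‖θ.amp‖ ^ 3 + θ.δ * ‖θ.amp‖ ^ 2) := by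
    linarith
  calc C * ‖H‖ * ‖θ.amp‖ * ‖P.rate H θ.amp θ.δ θ.τ 0‖
      ≤ |C| * ‖H‖ * 1 * ((D + D') * (‖θ.amp‖ ^ 3 + θ.δ * ‖θ.amp‖ ^ 2)) := by
        gcongr; exact le_abs_self C
    _ = _ := by ring

theorem isResidual_remEta (hv : RegularCost v Dv H K) (i : Fin 2) :
    P.IsResidual fun θ => P.remEta v Dv H θ.amp θ.δ θ.τ i 0 := by
  have := ((isResidual_costDiff (P := P) hv).real_mul (P.highPass i)).sub
    ((isResidual_intQuad (P := P) (H := H)).real_mul (P.highPass i ^ 2))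
  convert this using 2
  simp [remEta, hv.Dv_zero]
  ring

theorem isResidual_remMoment (hT : 0 < T)
    (hper : ∀ i, Function.Periodic (fun τ : ℝ => sin (P.freq i * τ)) T) (i : Fin 2) :
    P.IsResidual fun θ => P.remMoment H θ.amp θ.δ θ.τ i 0 := by
  -- The value c = 0 suffices, since only the zero state is inserted.
  obtain ⟨C, hC, h⟩ := isBdd_estimate (H := H) (c := 0) le_rfl hT hper i
  have := ((isResidual_estimate (H := H) hT hper i).bdd_mul
    (g := fun θ => P.estimate H θ.amp θ.δ θ.τ i 0) C fun θ hθ => by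
      have hα : ‖θ.amp‖ ≤ 1 := hθ.amp_le.trans hθ.rad_le_one
      refine ((h θ hθ).2 0 ⟨by simpa using hθ.rad_nonneg, by simp,
        by simpa using hθ.rad_nonneg⟩).trans ?_
      exact mul_le_of_le_one_right hC hα).real_mul (P.moment i)
  convert this using 2
  rw [remMoment, sq]

theorem isResidual_remFast (hv : RegularCost v Dv H K) (hT : 0 < T)
    (hper : ∀ i, Function.Periodic (fun τ : ℝ => sin (P.freq i * τ)) T) (i : Fin 2) :
    P.IsResidual fun θ => P.remFast v Dv H θ.amp θ.δ θ.τ i 0 := by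
  have h1 := ((isResidual_costDiff (P := P) hv).sub
    ((isResidual_intQuad (P := P) (H := H)).real_mul (P.highPass i))).bdd_mul
    (g := fun θ => P.lowPass i * sin (P.freq i * θ.τ)) |P.lowPass i| (fun θ _ => by
      rw [abs_mul]
      exact mul_le_of_le_one_right (abs_nonneg _) (abs_sin_le_one _))
  have h2 := (isResidual_intCubic (H := H) hT hper i).real_mul (P.lowPass i ^ 2)
  have h3 := (isResidual_remEta (P := P) hv i).bdd_mul
    (g := fun θ => cos (P.freq i * θ.τ) / P.freq i) (1 / P.freq i) (fun θ _ => by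
      have hf := P.freq_pos i
      rw [abs_div, abs_of_pos hf]
      gcongr; exact abs_cos_le_one _)
  have h4 := (((isResidual_intLin_rate (H := H) hT hper i).add h3).scale_mul).real_mul (P.lowPass i)
  convert (h1.sub h2).sub h4 using 2
  simp [remFast, intLin]
  ring

theorem isResidual_remSlow (hv : RegularCost v Dv H K) (hT : 0 < T)
    (hper : ∀ i, Function.Periodic (fun τ : ℝ => sin (P.freq i * τ)) T) (i : Fin 2) :
    P.IsResidual fun θ => P.remSlow v Dv H θ.amp θ.δ θ.τ i 0 := by
  have h1 := (isResidual_intCubic (H := H) hT hper i).real_mul (-(P.gain i / √P.eps * P.lowPass i))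
  have h2 := (isResidual_remFast (P := P) hv hT hper i).real_mul (P.slope i)
  convert h1.sub h2 using 2
  simp [remSlow, intLin]
  ring

/-- All remainders are small on the region, uniformly in the parameters. -/
theorem exists_remainder_bound (hv : RegularCost v Dv H K) (hc : 0 ≤ c) (hT : 0 < T)
    (hper : ∀ i, Function.Periodic (fun τ : ℝ => sin (P.freq i * τ)) T) :
    ∃ C ≥ 0, ∀ θ, P.Admissible θ →
      (∀ u ∈ region c θ.amp θ.ρ, ∀ w ∈ region c θ.amp θ.ρ, ∀ i,
        |P.remSlow v Dv H θ.amp θ.δ θ.τ i u - P.remSlow v Dv H θ.amp θ.δ θ.τ i w|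
            ≤ C * ((θ.ρ + θ.δ) * (‖θ.amp‖ * ‖u.1 - w.1‖ + fastDist u w)) ∧
        |P.remFast v Dv H θ.amp θ.δ θ.τ i u - P.remFast v Dv H θ.amp θ.δ θ.τ i w|
            ≤ C * (‖θ.amp‖ * ‖u.1 - w.1‖ + (θ.ρ + θ.δ) * fastDist u w) ∧
        |P.remEta v Dv H θ.amp θ.δ θ.τ i u - P.remEta v Dv H θ.amp θ.δ θ.τ i w|
            ≤ C * (‖θ.amp‖ * ‖u.1 - w.1‖ + (θ.ρ + θ.δ) * fastDist u w) ∧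
        |P.remMoment H θ.amp θ.δ θ.τ i u - P.remMoment H θ.amp θ.δ θ.τ i w|
            ≤ C * (‖θ.amp‖ * ‖u.1 - w.1‖ + (θ.ρ + θ.δ) * fastDist u w)) ∧
      ∀ i,
        |P.remSlow v Dv H θ.amp θ.δ θ.τ i 0| ≤ C * (‖θ.amp‖ ^ 3 + θ.δ * ‖θ.amp‖ ^ 2) ∧
        |P.remFast v Dv H θ.amp θ.δ θ.τ i 0| ≤ C * (‖θ.amp‖ ^ 3 + θ.δ * ‖θ.amp‖ ^ 2) ∧
        |P.remEta v Dv H θ.amp θ.δ θ.τ i 0| ≤ C * (‖θ.amp‖ ^ 3 + θ.δ * ‖θ.amp‖ ^ 2) ∧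
        |P.remMoment H θ.amp θ.δ θ.τ i 0| ≤ C * (‖θ.amp‖ ^ 3 + θ.δ * ‖θ.amp‖ ^ 2) := by
  -- In the fast equation a constant ‖a‖ in r is good enough, so the bound is weakened to the common
  -- form of the three filter remainders.
  have hfast := fun i => (isLip_remFast (c := c) hv hc hT hper i).mono
    (A' := fun θ => ‖θ.amp‖) (B' := fun θ => θ.ρ + θ.δ) 2 (by norm_num) fun θ hθ => by
      have e1 := hθ.rad_nonneg
      have e2 := hθ.scale_nonneg
      have e3 := hθ.rad_le_one
      have e4 := hθ.scale_le_one
      have e5 := norm_nonneg θ.amp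
      exact ⟨by gcongr; linarith, by linarith, e5, by linarith⟩
  choose C1 hC1 h1 using fun i => isLip_remSlow (c := c) hv hc hT hper i
  choose C2 hC2 h2 using hfast
  choose C3 hC3 h3 using fun i => isLip_remEta (c := c) hv hc hT hper i
  choose C4 hC4 h4 using fun i => isLip_remMoment (H := H) hc hT hper i
  choose D1 hD1 g1 using fun i => isResidual_remSlow (P := P) hv hT hper i
  choose D2 hD2 g2 using fun i => isResidual_remFast (P := P) hv hT hper i
  choose D3 hD3 g3 using fun i => isResidual_remEta (P := P) hv i
  choose D4 hD4 g4 using fun i => isResidual_remMoment (P := P) (H := H) hT hper i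
  have hle : ∀ i, 0 ≤ C1 i + C2 i + C3 i + C4 i + D1 i + D2 i + D3 i + D4 i := fun i => by
    linarith [hC1 i, hC2 i, hC3 i, hC4 i, hD1 i, hD2 i, hD3 i, hD4 i]
  refine ⟨∑ i, (C1 i + C2 i + C3 i + C4 i + D1 i + D2 i + D3 i + D4 i),
    Finset.sum_nonneg fun i _ => hle i, fun θ hθ => ?_⟩
  set C := ∑ i, (C1 i + C2 i + C3 i + C4 i + D1 i + D2 i + D3 i + D4 i) with hCdef
  have hCi : ∀ i, C1 i + C2 i + C3 i + C4 i + D1 i + D2 i + D3 i + D4 i ≤ C := fun i =>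
    Finset.single_le_sum (f := fun i => C1 i + C2 i + C3 i + C4 i + D1 i + D2 i + D3 i + D4 i)
      (fun i _ => hle i) (Finset.mem_univ i)
  have e1 := hθ.rad_nonneg
  have e2 := hθ.scale_nonneg
  have hall := fun i => (⟨hC1 i, hC2 i, hC3 i, hC4 i, hD1 i, hD2 i, hD3 i, hD4 i⟩ :
    0 ≤ C1 i ∧ 0 ≤ C2 i ∧ 0 ≤ C3 i ∧ 0 ≤ C4 i ∧ 0 ≤ D1 i ∧ 0 ≤ D2 i ∧ 0 ≤ D3 i ∧ 0 ≤ D4 i)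
  refine ⟨fun u hu w hw i => ?_, fun i => ?_⟩
  · have hd := fastDist_nonneg u w
    obtain ⟨a1, a2, a3, a4, a5, a6, a7, a8⟩ := hall i
    have hi := hCi i
    refine ⟨((h1 i θ hθ).2.2 u hu w hw).trans ?_, ((h2 i θ hθ).2.2 u hu w hw).trans ?_,
      ((h3 i θ hθ).2.2 u hu w hw).trans ?_, ((h4 i θ hθ).2.2 u hu w hw).trans ?_⟩
    · rw [mul_add (θ.ρ + θ.δ), ← mul_assoc (θ.ρ + θ.δ)]
      refine mul_le_mul_of_nonneg_right ?_ (by positivity)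
      linarith
    all_goals
      refine mul_le_mul_of_nonneg_right ?_ (by positivity)
      linarith
  · obtain ⟨a1, a2, a3, a4, a5, a6, a7, a8⟩ := hall i
    have hi := hCi i
    refine ⟨(g1 i θ hθ).trans ?_, (g2 i θ hθ).trans ?_, (g3 i θ hθ).trans ?_,
      (g4 i θ hθ).trans ?_⟩
    all_goals
      refine mul_le_mul_of_nonneg_right ?_ (by positivity)
      linarith

end Params
end ExtremumSeeking
end

/-! ### Separate decay of the slow and of the fast variables. -/

noncomputable section
namespace ExtremumSeeking
open Set Real

/-- Smoothing of a one-sided estimate for a square root. -/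
theorem div_sqrt_add_sq_le {Y N c e ν : ℝ} (hY : 0 ≤ Y) (hν : 0 < ν) (hc : 0 ≤ c) (he : 0 ≤ e)
    (h : N ≤ √Y * (-c * √Y + e)) :
    N / √(Y + ν ^ 2) ≤ -c * √(Y + ν ^ 2) + c * ν + e := by
  have ht : 0 < √(Y + ν ^ 2) := Real.sqrt_pos.2 (by positivity)
  rw [div_le_iff₀ ht]
  have h1 : √Y ≤ √(Y + ν ^ 2) := Real.sqrt_le_sqrt (by nlinarith)
  have h2 : ν ≤ √(Y + ν ^ 2) := Real.le_sqrt_of_sq_le (by nlinarith)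
  have h3 := Real.mul_self_sqrt (by positivity : 0 ≤ Y + ν ^ 2)
  have h4 := Real.mul_self_sqrt hY
  have h5 : √Y * e ≤ √(Y + ν ^ 2) * e := by gcongr
  have h6 : c * (ν * ν) ≤ c * (ν * √(Y + ν ^ 2)) := by gcongr
  nlinarith

theorem RegularCost.norm_le_mul_sqrt {v : Plane → ℝ} {Dv : Plane → Plane →L[ℝ] ℝ}
    {H : Plane →L[ℝ] Plane →L[ℝ] ℝ} {K : ℝ} (hv : RegularCost v Dv H K) (y : Plane) :
    ‖y‖ ≤ K * √(H y y) := by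
  have hK := hv.one_le
  have h1 := hv.H_pos y
  have h2 : ‖y‖ ^ 2 ≤ K * H y y := by
    rwa [inv_mul_le_iff₀ (by linarith)] at h1
  have h3 : 0 ≤ H y y := le_trans (by positivity) h1
  refine abs_le_of_sq_le_sq' ?_ (by positivity) |>.2
  rw [mul_pow, Real.sq_sqrt h3]
  nlinarith

theorem RegularCost.nonneg {v : Plane → ℝ} {Dv : Plane → Plane →L[ℝ] ℝ}
    {H : Plane →L[ℝ] Plane →L[ℝ] ℝ} {K : ℝ} (hv : RegularCost v Dv H K) (y : Plane) :
    0 ≤ H y y :=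
  le_trans (mul_nonneg (inv_nonneg.2 (zero_le_one.trans hv.one_le)) (sq_nonneg _)) (hv.H_pos y)

theorem RegularCost.abs_apply_unitVec_le {v : Plane → ℝ} {Dv : Plane → Plane →L[ℝ] ℝ}
    {H : Plane →L[ℝ] Plane →L[ℝ] ℝ} {K : ℝ} (hv : RegularCost v Dv H K) (y : Plane) (i : Fin 2) :
    |H y (unitVec i)| ≤ K * ‖y‖ := by
  have h1 := H.le_opNorm₂ y (unitVec i)
  rw [norm_unitVec, mul_one, Real.norm_eq_abs] at h1
  exact h1.trans (mul_le_mul_of_nonneg_right hv.H_le (norm_nonneg _))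

/-- With p_i = H(y,e_i) one has H(y,y) = Σ y_i p_i. Cauchy-Schwarz and coercivity give H(y,y)² ≤
K·H(y,y)·Σ p_i², and one factor H(y,y) is divided out. -/
theorem RegularCost.le_sum_sq {v : Plane → ℝ} {Dv : Plane → Plane →L[ℝ] ℝ}
    {H : Plane →L[ℝ] Plane →L[ℝ] ℝ} {K : ℝ} (hv : RegularCost v Dv H K) (y : Plane) :
    H y y ≤ K * (H y (unitVec 0) ^ 2 + H y (unitVec 1) ^ 2) := by
  have hK := hv.one_le
  have h1 : H y y = y 0 * H y (unitVec 0) + y 1 * H y (unitVec 1) := by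
    have h := congrArg (H y) (plane_eq_sum y)
    rw [h]
    simp [Fin.sum_univ_two]
  have h2 : ‖y‖ ^ 2 = y 0 ^ 2 + y 1 ^ 2 := by
    rw [EuclideanSpace.norm_sq_eq, Fin.sum_univ_two]; simp
  have h3 := hv.H_pos y
  rw [inv_mul_le_iff₀ (by linarith), h2] at h3
  set p := H y (unitVec 0)
  set q := H y (unitVec 1)
  have h4 : 0 ≤ H y y := hv.nonneg y
  have h5 : H y y ^ 2 ≤ (y 0 ^ 2 + y 1 ^ 2) * (p ^ 2 + q ^ 2) := by
    rw [h1]; nlinarith [sq_nonneg (y 0 * q - y 1 * p)]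
  have h6 : H y y * H y y ≤ (K * (p ^ 2 + q ^ 2)) * H y y := by
    nlinarith [sq_nonneg p, sq_nonneg q]
  rcases h4.eq_or_lt with h0 | h0
  · rw [← h0]; positivity
  · exact le_of_mul_le_mul_right h6 h0

namespace Params

variable {P : Params} {v : Plane → ℝ} {Dv : Plane → Plane →L[ℝ] ℝ}
  {H : Plane →L[ℝ] Plane →L[ℝ] ℝ} {K : ℝ}

theorem apply_toLp (y : Plane) (b : Fin 2 → ℝ) :
    H y (WithLp.toLp 2 b) = b 0 * H y (unitVec 0) + b 1 * H y (unitVec 1) := by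
  have h := congrArg (H y) (plane_eq_sum (WithLp.toLp 2 b))
  rw [h]
  simp [Fin.sum_univ_two]

/-- Decay of the slow variable in the norm defined by the Hessian. -/
theorem exists_slow_decay (P : Params) (hv : RegularCost v Dv H K) {κ : ℝ} (hκ : 0 < κ) :
    ∃ k > 0, ∃ C ≥ 0, ∀ a : Plane, (∀ i, κ * ‖a‖ ≤ a i) → ∀ (y x : Plane) (n : Fin 2 → ℝ),
      H y (WithLp.toLp 2 fun i => -(P.gain i / √P.eps * (a i / 2)) *
          H (y + WithLp.toLp 2 fun i => P.slope i * x i) (unitVec i) + n i)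
        ≤ √(H y y) * (-(k * ‖a‖) * √(H y y) + C * (‖a‖ * ‖x‖ + (|n 0| + |n 1|))) := by
  have hK := hv.one_le
  have he := Real.sqrt_pos.2 P.eps_pos
  have hg : ∀ i, 0 < P.gain i / √P.eps := fun i => div_pos (P.gain_pos i) he
  set g := P.gain 0 / √P.eps + P.gain 1 / √P.eps with hgdef
  set gm := min (P.gain 0 / √P.eps) (P.gain 1 / √P.eps) with hgm
  have hgm0 : 0 < gm := lt_min (hg 0) (hg 1)
  have hgi : ∀ i, gm ≤ P.gain i / √P.eps ∧ P.gain i / √P.eps ≤ g := by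
    have h0 := hg 0
    have h1 := hg 1
    intro i
    fin_cases i
    · exact ⟨min_le_left _ _, by simp only [hgdef, Fin.zero_eta]; linarith⟩
    · exact ⟨min_le_right _ _, by simp only [hgdef, Fin.mk_one]; linarith⟩
  set S := |P.slope 0| + |P.slope 1| with hS
  have hg0 : 0 ≤ g := hgm0.le.trans ((hgi 0).1.trans (hgi 0).2)
  have hS0 : 0 ≤ S := by positivity
  refine ⟨gm * κ / (2 * K), by positivity, 2 * (K * K) * (g * (K * S) + 1), by positivity,
    fun a ha y x n => ?_⟩
  rw [apply_toLp]
  set N := √(H y y) with hN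
  have hNN : N * N = H y y := Real.mul_self_sqrt (hv.nonneg y)
  have hN0 : 0 ≤ N := Real.sqrt_nonneg _
  set b : Plane := WithLp.toLp 2 fun i => P.slope i * x i with hb
  have hbn : ‖b‖ ≤ S * ‖x‖ := by
    refine (norm_le_sum_abs b).trans ?_
    simp only [hb, abs_mul]
    have h0 := abs_coord_le x 0
    have h1 := abs_coord_le x 1
    calc |P.slope 0| * |x 0| + |P.slope 1| * |x 1| ≤ |P.slope 0| * ‖x‖ + |P.slope 1| * ‖x‖ := by
          gcongr
      _ = _ := by ring
  have hyN := hv.norm_le_mul_sqrt y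
  rw [← hN] at hyN
  -- In the inner product given by the Hessian, a diagonal gain applied to the gradient acts as a
  -- sum of negative multiples of H(y,e_i)². The cone condition on `a` bounds each multiple below by
  -- a constant times ‖a‖; the displacement `b` only contributes ‖a‖‖x‖.
  have hterm : ∀ i, (-(P.gain i / √P.eps * (a i / 2)) * H (y + b) (unitVec i) + n i)
        * H y (unitVec i)
      ≤ -(gm * κ * ‖a‖ / 2) * H y (unitVec i) ^ 2
        + N * ((K * K) * (g * (K * S) * (‖a‖ * ‖x‖) + |n i|)) := by
    intro i
    have hai := ha i
    have hai' : a i ≤ ‖a‖ := (le_abs_self _).trans (abs_coord_le a i)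
    have hκa : 0 ≤ κ * ‖a‖ := by positivity
    have hpi : |H y (unitVec i)| ≤ K * K * N := by
      refine (hv.abs_apply_unitVec_le y i).trans ?_
      nlinarith
    have hbi : |H b (unitVec i)| ≤ K * S * ‖x‖ := by
      refine (hv.abs_apply_unitVec_le b i).trans ?_
      nlinarith
    rw [map_add, add_apply]
    set p := H y (unitVec i)
    set w := H b (unitVec i)
    set d := P.gain i / √P.eps * (a i / 2) with hd
    have hd1 : gm * κ * ‖a‖ / 2 ≤ d := by
      have := mul_le_mul (hgi i).1 hai hκa (hg i).le
      rw [hd]; linarith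
    have hd2 : d ≤ g * ‖a‖ := by
      have h1 : a i / 2 ≤ ‖a‖ := by linarith [norm_nonneg a]
      have h2 : 0 ≤ a i / 2 := by linarith
      exact mul_le_mul (hgi i).2 h1 h2 hg0
    have hd0 : 0 ≤ d := le_trans (by positivity) hd1
    have e1 : gm * κ * ‖a‖ / 2 * p ^ 2 ≤ d * p ^ 2 := by gcongr
    have e2 : -(d * w * p) ≤ g * ‖a‖ * (K * S * ‖x‖) * (K * K * N) := by
      refine (neg_le_abs _).trans ?_
      rw [abs_mul, abs_mul, abs_of_nonneg hd0]
      gcongr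
    have e3 : n i * p ≤ |n i| * (K * K * N) := by
      refine (le_abs_self _).trans ?_
      rw [abs_mul]
      gcongr
    have e4 : (-d * (p + w) + n i) * p = -(d * p ^ 2) + -(d * w * p) + n i * p := by ring
    rw [e4]
    calc _ ≤ -(gm * κ * ‖a‖ / 2 * p ^ 2) + g * ‖a‖ * (K * S * ‖x‖) * (K * K * N)
          + |n i| * (K * K * N) := by linarith
      _ = _ := by ring
  have h0 := hterm 0
  have h1 := hterm 1
  have hsum := hv.le_sum_sq y
  have hdec : gm * κ / (2 * K) * ‖a‖ * (H y y)
      ≤ gm * κ * ‖a‖ / 2 * (H y (unitVec 0) ^ 2 + H y (unitVec 1) ^ 2) := by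
    calc gm * κ / (2 * K) * ‖a‖ * (H y y) ≤ gm * κ / (2 * K) * ‖a‖ *
          (K * (H y (unitVec 0) ^ 2 + H y (unitVec 1) ^ 2)) := by gcongr
      _ = _ := by field_simp
  have hx : 0 ≤ N * ((K * K) * (|n 0| + |n 1|)) := by positivity
  have hx2 : 0 ≤ N * ((K * K) * (g * (K * S) * (|n 0| + |n 1|))) := by positivity
  have hx3 : 0 ≤ N * ((K * K) * (‖a‖ * ‖x‖)) := by positivity
  calc _ ≤ -(gm * κ / (2 * K) * ‖a‖) * (N * N)
        + N * ((K * K) * (2 * (g * (K * S)) * (‖a‖ * ‖x‖) + (|n 0| + |n 1|))) := by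
        rw [hNN]; linarith
    _ ≤ _ := by linarith

/-- Size of the fast variables. -/
def fastSq (x ζ m : Plane) : ℝ := ‖x‖ ^ 2 + ‖ζ‖ ^ 2 + ‖m‖ ^ 2

theorem fastSq_nonneg (x ζ m : Plane) : 0 ≤ fastSq x ζ m := by unfold fastSq; positivity

theorem inner_toLp_decay {k : ℝ} (c : Fin 2 → ℝ) (hc : ∀ i, k ≤ c i) (x : Plane) (n : Fin 2 → ℝ) :
    inner ℝ x (WithLp.toLp 2 fun i => -c i * x i + n i)
      ≤ -k * ‖x‖ ^ 2 + ‖x‖ * (|n 0| + |n 1|) := by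
  have h2 : ‖x‖ ^ 2 = x 0 ^ 2 + x 1 ^ 2 := by
    rw [EuclideanSpace.norm_sq_eq, Fin.sum_univ_two]; simp
  have h1 : inner ℝ x (WithLp.toLp 2 fun i => -c i * x i + n i)
      = x 0 * (-c 0 * x 0 + n 0) + x 1 * (-c 1 * x 1 + n 1) := by
    simp [PiLp.inner_apply, Fin.sum_univ_two]
    ring
  have h3 : ∀ i, x i * n i ≤ ‖x‖ * |n i| := fun i => by
    refine (le_abs_self _).trans ?_
    rw [abs_mul]
    exact mul_le_mul_of_nonneg_right (abs_coord_le x i) (abs_nonneg _)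
  have h4 : ∀ i, k * x i ^ 2 ≤ c i * x i ^ 2 := fun i =>
    mul_le_mul_of_nonneg_right (hc i) (sq_nonneg _)
  have := h3 0; have := h3 1; have := h4 0; have := h4 1
  rw [h1, h2]
  linarith

theorem exists_fast_decay (P : Params) : ∃ k > 0, ∀ (x ζ m : Plane) (n₁ n₂ n₃ : Fin 2 → ℝ),
    inner ℝ x (WithLp.toLp 2 fun i => -P.lowPass i * x i + n₁ i)
      + inner ℝ ζ (WithLp.toLp 2 fun i => -P.highPass i * ζ i + n₂ i)
      + inner ℝ m (WithLp.toLp 2 fun i => -P.moment i * m i + n₃ i)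
    ≤ √(fastSq x ζ m) * (-k * √(fastSq x ζ m)
      + ((|n₁ 0| + |n₁ 1|) + (|n₂ 0| + |n₂ 1|) + (|n₃ 0| + |n₃ 1|))) := by
  -- The fast rate is the smallest of the six filter cutoffs, so it does not degrade with the
  -- amplitude.
  obtain ⟨k, hk, h1, h2, h3⟩ : ∃ k > 0, (∀ i, k ≤ P.lowPass i) ∧ (∀ i, k ≤ P.highPass i) ∧
      ∀ i, k ≤ P.moment i := by
    have hpos : ∀ i, 0 < min (P.lowPass i) (min (P.highPass i) (P.moment i)) := fun i =>
      lt_min (P.lowPass_pos i) (lt_min (P.highPass_pos i) (P.moment_pos i))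
    refine ⟨min (min (P.lowPass 0) (min (P.highPass 0) (P.moment 0)))
      (min (P.lowPass 1) (min (P.highPass 1) (P.moment 1))), lt_min (hpos 0) (hpos 1), ?_, ?_, ?_⟩
    all_goals
      intro i
      fin_cases i <;> simp
  refine ⟨k, hk, fun x ζ m n₁ n₂ n₃ => ?_⟩
  have e1 := inner_toLp_decay _ h1 x n₁
  have e2 := inner_toLp_decay _ h2 ζ n₂
  have e3 := inner_toLp_decay _ h3 m n₃
  set N := √(fastSq x ζ m) with hN
  have hNN : N * N = ‖x‖ ^ 2 + ‖ζ‖ ^ 2 + ‖m‖ ^ 2 := Real.mul_self_sqrt (fastSq_nonneg x ζ m)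
  have b1 : ‖x‖ ≤ N := Real.le_sqrt_of_sq_le (by unfold fastSq; nlinarith [sq_nonneg ‖ζ‖, sq_nonneg ‖m‖])
  have b2 : ‖ζ‖ ≤ N := Real.le_sqrt_of_sq_le (by unfold fastSq; nlinarith [sq_nonneg ‖x‖, sq_nonneg ‖m‖])
  have b3 : ‖m‖ ≤ N := Real.le_sqrt_of_sq_le (by unfold fastSq; nlinarith [sq_nonneg ‖x‖, sq_nonneg ‖ζ‖])
  have c1 := mul_le_mul_of_nonneg_right b1 (by positivity : 0 ≤ |n₁ 0| + |n₁ 1|)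
  have c2 := mul_le_mul_of_nonneg_right b2 (by positivity : 0 ≤ |n₂ 0| + |n₂ 1|)
  have c3 := mul_le_mul_of_nonneg_right b3 (by positivity : 0 ≤ |n₃ 0| + |n₃ 1|)
  have : N * (-k * N + ((|n₁ 0| + |n₁ 1|) + (|n₂ 0| + |n₂ 1|) + (|n₃ 0| + |n₃ 1|)))
      = -k * (N * N) + N * (|n₁ 0| + |n₁ 1|) + N * (|n₂ 0| + |n₂ 1|) + N * (|n₃ 0| + |n₃ 1|) := by
    ring
  rw [this, hNN]
  linarith

end Params
end ExtremumSeeking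
end

/-! ### The Lyapunov function and its decay under coupling. -/

noncomputable section
namespace ExtremumSeeking
open Set Real
namespace Params

variable {P : Params} {v : Plane → ℝ} {Dv : Plane → Plane →L[ℝ] ℝ}
  {H : Plane →L[ℝ] Plane →L[ℝ] ℝ} {K : ℝ}

/-- The size of the slow part of a shifted state. -/
def slowNorm (P : Params) (H : Plane →L[ℝ] Plane →L[ℝ] ℝ) (a : Plane) (δ τ : ℝ) (D : State) : ℝ :=
  √(H (P.slow H a δ τ D) (P.slow H a δ τ D))

/-- The size of the fast part of a shifted state. -/
def fastNorm (P : Params) (H : Plane →L[ℝ] Plane →L[ℝ] ℝ) (a : Plane) (δ τ : ℝ) (D : State) : ℝ :=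
  √(fastSq (P.fast H a δ τ D) D.2.2.1 D.2.2.2)

theorem slow_add (a : Plane) (δ τ : ℝ) (D : State) :
    P.slow H a δ τ D + WithLp.toLp 2 (fun i => P.slope i * P.fast H a δ τ D i) = D.1 := by
  ext i
  simp [slow]

theorem norm_le_sqrt_fastSq (x ζ m : Plane) :
    ‖x‖ ≤ √(fastSq x ζ m) ∧ ‖ζ‖ ≤ √(fastSq x ζ m) ∧ ‖m‖ ≤ √(fastSq x ζ m) := by
  refine ⟨Real.le_sqrt_of_sq_le ?_, Real.le_sqrt_of_sq_le ?_, Real.le_sqrt_of_sq_le ?_⟩ <;>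
  · unfold fastSq
    nlinarith [sq_nonneg ‖x‖, sq_nonneg ‖ζ‖, sq_nonneg ‖m‖]

theorem exists_ge_one_and_le (x y : ℝ) : ∃ C ≥ 1, x ≤ C ∧ y ≤ C :=
  ⟨max 1 (max x y), le_max_left _ _, (le_max_left _ _).trans (le_max_right _ _),
    (le_max_right _ _).trans (le_max_right _ _)⟩

theorem fastDist_zero (D : State) : fastDist D 0 = ‖D.2.1‖ + ‖D.2.2.1‖ + ‖D.2.2.2‖ := by
  simp [fastDist]

/-- The size of a shifted state in terms of its slow and fast parts. -/
theorem exists_size_le (P : Params) (hv : RegularCost v Dv H K) :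
    ∃ C ≥ 1, ∀ (a : Plane) (δ τ : ℝ) (D : State), ‖a‖ ≤ 1 → 0 ≤ δ → δ ≤ 1 →
      ‖D.1‖ ≤ C * (P.slowNorm H a δ τ D + P.fastNorm H a δ τ D) ∧
      fastDist D 0 ≤ C * (P.fastNorm H a δ τ D + ‖a‖ * ‖D.1‖) := by
  have hK := hv.one_le
  obtain ⟨C, hC⟩ := P.exists_abs_intLin_le
  obtain ⟨S, hS0, hS⟩ : ∃ S ≥ 0, ∀ i, |P.slope i| ≤ S :=
    ⟨|P.slope 0| + |P.slope 1|, by positivity, fun i => by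
      have := abs_nonneg (P.slope 0)
      have := abs_nonneg (P.slope 1)
      fin_cases i <;> simp only [Fin.zero_eta, Fin.mk_one] <;> linarith⟩
  obtain ⟨L, hL0, hL⟩ : ∃ L ≥ 0, ∀ i, P.lowPass i ≤ L :=
    ⟨P.lowPass 0 + P.lowPass 1, by have := P.lowPass_pos 0; have := P.lowPass_pos 1; positivity,
      fun i => by
      have := P.lowPass_pos 0
      have := P.lowPass_pos 1
      fin_cases i <;> simp only [Fin.zero_eta, Fin.mk_one] <;> linarith⟩
  obtain ⟨F, hF0, hF⟩ : ∃ F ≥ 0, ∀ i, 1 / P.freq i ≤ F := by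
    have h0 := one_div_pos.2 (P.freq_pos 0)
    have h1 := one_div_pos.2 (P.freq_pos 1)
    refine ⟨1 / P.freq 0 + 1 / P.freq 1, by positivity, fun i => ?_⟩
    fin_cases i <;> simp only [Fin.zero_eta, Fin.mk_one] <;> linarith
  refine ⟨K + 2 * S + 4 + 2 * L * (|C| * ‖H‖) + 2 * L * F, ?_, fun a δ τ D ha hδ hδ1 => ?_⟩
  · have : 0 ≤ 2 * L * (|C| * ‖H‖) + 2 * L * F := by positivity
    linarith
  obtain ⟨b1, b2, b3⟩ := norm_le_sqrt_fastSq (P.fast H a δ τ D) D.2.2.1 D.2.2.2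
  have hy := hv.norm_le_mul_sqrt (P.slow H a δ τ D)
  change _ ≤ P.fastNorm H a δ τ D at b1 b2 b3
  change _ ≤ K * P.slowNorm H a δ τ D at hy
  set x := P.fast H a δ τ D with hx
  set Ny := P.slowNorm H a δ τ D
  set Nw := P.fastNorm H a δ τ D
  have hNy : 0 ≤ Ny := Real.sqrt_nonneg _
  have hNw : 0 ≤ Nw := Real.sqrt_nonneg _
  have hp1 : 0 ≤ 2 * L * (|C| * ‖H‖) := by positivity
  have hp2 : 0 ≤ 2 * L * F := by positivity
  constructor
  · rw [← slow_add (P := P) (H := H) a δ τ D]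
    refine (norm_add_le _ _).trans ?_
    have h1 : ‖WithLp.toLp 2 (fun i => P.slope i * P.fast H a δ τ D i)‖ ≤ 2 * S * Nw := by
      refine (norm_le_sum_abs _).trans ?_
      simp only [abs_mul]
      have h0 := (abs_coord_le x 0).trans b1
      have h1 := (abs_coord_le x 1).trans b1
      calc |P.slope 0| * |x 0| + |P.slope 1| * |x 1| ≤ S * Nw + S * Nw := by
            gcongr
            · exact hS 0
            · exact hS 1
        _ = _ := by ring
    have e1 : 0 ≤ (2 * S + 4 + 2 * L * (|C| * ‖H‖) + 2 * L * F) * Ny := by positivity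
    have e2 : 0 ≤ (K + 4 + 2 * L * (|C| * ‖H‖) + 2 * L * F) * Nw := by positivity
    linarith
  · rw [fastDist_zero]
    have hq : ∀ i, |D.2.1 i| ≤ Nw + L * (|C| * ‖H‖ * ‖a‖ * ‖D.1‖ + F * Nw) := by
      intro i
      -- Undoing the correction in `fast`; its `intLin` part is the source of the term ‖a‖‖r‖ in the
      -- bound.
      have e : D.2.1 i = x i + δ * P.lowPass i *
          (P.intLin H a i τ D.1 + cos (P.freq i * τ) / P.freq i * D.2.2.1 i) := by
        simp only [hx, fast]; ring
      have hfi := P.freq_pos i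
      have hli := P.lowPass_pos i
      have e1 : |P.intLin H a i τ D.1| ≤ |C| * ‖H‖ * ‖a‖ * ‖D.1‖ :=
        (hC H a i τ D.1).trans (by gcongr; exact le_abs_self C)
      have e2 : |cos (P.freq i * τ) / P.freq i * D.2.2.1 i| ≤ F * Nw := by
        rw [abs_mul, abs_div, abs_of_pos hfi]
        have h1 := (abs_coord_le D.2.2.1 i).trans b2
        have h2 : |cos (P.freq i * τ)| / P.freq i ≤ F :=
          le_trans (by gcongr; exact abs_cos_le_one _) (hF i)
        gcongr
      rw [e]
      refine (abs_add_le _ _).trans (add_le_add ((abs_coord_le x i).trans b1) ?_)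
      rw [abs_mul, abs_mul, abs_of_nonneg hδ, abs_of_pos hli]
      have e3 := (abs_add_le (P.intLin H a i τ D.1)
        (cos (P.freq i * τ) / P.freq i * D.2.2.1 i)).trans (add_le_add e1 e2)
      have e4 : δ * P.lowPass i ≤ L :=
        (mul_le_of_le_one_left hli.le hδ1).trans (hL i)
      gcongr
    have h4 := norm_le_sum_abs D.2.1
    have h5 := hq 0
    have h6 := hq 1
    have e1 : 0 ≤ (K + 2 * S + 4 + 2 * L * F) * (‖a‖ * ‖D.1‖) := by positivity
    have e2 : 0 ≤ (K + 2 * S + 2 * L * (|C| * ‖H‖)) * Nw := by positivity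
    linarith

/-- Smoothed Lyapunov function of the averaged system. -/
def lyap (P : Params) (H : Plane →L[ℝ] Plane →L[ℝ] ℝ) (a : Plane) (δ ϑ ν τ : ℝ) (D : State) : ℝ :=
  √(H (P.slow H a δ τ D) (P.slow H a δ τ D) + ν ^ 2)
    + ϑ * √(fastSq (P.fast H a δ τ D) D.2.2.1 D.2.2.2 + ν ^ 2)

/-- Combination of the slow and the fast decay with small coupling. -/
theorem lyap_combine {k w C₁ ϑ σ α ty tw A B r ν : ℝ} (hk : 0 < k) (hw : 0 < w) (hC₁ : 1 ≤ C₁)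
    (hϑ : ϑ = k / (4 * C₁)) (hσ : σ ≤ k / (4 * C₁))
    (hσ' : σ * (C₁ + ϑ * C₁ + k / 2 * ϑ) ≤ ϑ * w) (hα : 0 ≤ α) (hασ : α ≤ σ) (hα1 : α ≤ 1)
    (hty : 0 ≤ ty) (htw : 0 ≤ tw) (hν : 0 ≤ ν)
    (hA : A ≤ -(k * α) * ty + k * α * ν + C₁ * (σ * α * ty + σ * tw + r))
    (hB : B ≤ -w * tw + w * ν + C₁ * (α * ty + σ * tw + r)) (hr : 0 ≤ r) :
    A + ϑ * B ≤ -(k / 2 * α) * (ty + ϑ * tw) + (C₁ + ϑ * C₁ + k + ϑ * w) * (r + ν) := by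
  have hϑ0 : 0 < ϑ := by rw [hϑ]; positivity
  -- Each direction of coupling costs at most a quarter of the slow decay, so half of it survives.
  -- The condition on σ lets the fast decay pay for all terms in `tw`, including the part ϑ·tw of
  -- the final decay.
  have e1 : C₁ * σ ≤ k / 4 := by
    calc C₁ * σ ≤ C₁ * (k / (4 * C₁)) := by gcongr
      _ = k / 4 := by field_simp
  have e2 : ϑ * C₁ = k / 4 := by rw [hϑ]; field_simp
  have e3 : C₁ * σ * (α * ty) ≤ k / 4 * (α * ty) := by gcongr
  have e4 : σ * (C₁ + ϑ * C₁ + k / 2 * ϑ) * tw ≤ ϑ * w * tw := by gcongr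
  have e5 : k / 2 * ϑ * α * tw ≤ k / 2 * ϑ * σ * tw := by gcongr
  have e6 : k * α * ν ≤ k * 1 * ν := by gcongr
  have e7 : ϑ * B ≤ ϑ * (-w * tw + w * ν + C₁ * (α * ty + σ * tw + r)) := by gcongr
  have e8 : ϑ * C₁ * (α * ty) = k / 4 * (α * ty) := by rw [e2]
  have p1 : 0 ≤ (k + ϑ * w) * r := by positivity
  have p2 : 0 ≤ (C₁ + ϑ * C₁) * ν := by positivity
  linarith

/-- Bookkeeping of the coupling terms. -/
theorem coupling_le {C₀ Cz α σ R F ty tw : ℝ} (hC₀ : 0 ≤ C₀) (hCz : 0 ≤ Cz) (hα : 0 ≤ α)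
    (hα1 : α ≤ 1) (hασ : α ≤ σ) (hσ : σ ≤ 2) (hty : 0 ≤ ty) (htw : 0 ≤ tw)
    (hR : R ≤ Cz * (ty + tw)) (hF : F ≤ Cz * (tw + α * R)) :
    C₀ * (σ * (α * R + F)) ≤ C₀ * (2 * Cz + 2 * Cz * Cz) * (σ * α * ty + σ * tw) ∧
    C₀ * (α * R + σ * F) ≤ C₀ * (2 * Cz + 2 * Cz * Cz) * (α * ty + σ * tw) ∧
    α * R ≤ Cz * (α * ty + σ * tw) := by
  have hσ0 : 0 ≤ σ := hα.trans hασ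
  have hr2 : α * R ≤ Cz * (α * ty + α * tw) := by
    calc α * R ≤ α * (Cz * (ty + tw)) := by gcongr
      _ = _ := by ring
  have hatw : α * tw ≤ 1 * tw := by gcongr
  have hatws : α * tw ≤ σ * tw := by gcongr
  have hd2 : F ≤ (Cz + Cz * Cz) * tw + Cz * Cz * (α * ty) := by
    calc F ≤ Cz * (tw + Cz * (α * ty + α * tw)) := by
          refine hF.trans ?_
          gcongr
      _ ≤ Cz * (tw + Cz * (α * ty + 1 * tw)) := by gcongr
      _ = _ := by ring
  have p1 : 0 ≤ Cz * Cz * (α * ty) := by positivity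
  have p2 : 0 ≤ Cz * (α * ty) := by positivity
  refine ⟨?_, ?_, ?_⟩
  · have e : σ * (α * R + F) ≤ σ * ((2 * Cz + 2 * Cz * Cz) * (α * ty + tw)) := by
      have p3 : 0 ≤ Cz * Cz * tw := by positivity
      have p4 : Cz * (α * tw) ≤ Cz * (1 * tw) := by gcongr
      gcongr
      linarith
    calc _ ≤ C₀ * (σ * ((2 * Cz + 2 * Cz * Cz) * (α * ty + tw))) := by gcongr
      _ = _ := by ring
  · have hσ1' : σ * (Cz * Cz * (α * ty)) ≤ 2 * (Cz * Cz * (α * ty)) := by gcongr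
    have e : α * R + σ * F ≤ (2 * Cz + 2 * Cz * Cz) * (α * ty + σ * tw) := by
      have p0 : σ * F ≤ σ * ((Cz + Cz * Cz) * tw + Cz * Cz * (α * ty)) := by gcongr
      have p3 : 0 ≤ Cz * Cz * (σ * tw) := by positivity
      have p4 : Cz * (α * tw) ≤ Cz * (σ * tw) := by gcongr
      linarith
    calc _ ≤ C₀ * ((2 * Cz + 2 * Cz * Cz) * (α * ty + σ * tw)) := by gcongr
      _ = _ := by ring
  · refine hr2.trans ?_
    gcongr

-- The slow decay rate is only of order ‖a‖. It tolerates r-dependent errors of size (ρ+δ)‖a‖;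
-- errors of size (ρ+δ) caused by the fast variables are paid for by the fast decay, whose rate has
-- order one. The fast equation receives ‖a‖‖r‖ with a constant that is not small, whence the small
-- weight ϑ. Adding norms instead of squares keeps the final inequality linear in the residual.
set_option maxHeartbeats 400000 in
theorem exists_lyap_decay (P : Params) (hv : RegularCost v Dv H K) {κ C₀ : ℝ} (hκ : 0 < κ)
    (hC₀ : 0 ≤ C₀) :
    ∃ ϑ > 0, ∃ k > 0, ∃ C ≥ 0, ∃ σ₀ > 0, ∀ (a : Plane) (δ ρ τ : ℝ),
      P.Admissible ⟨a, δ, ρ, τ⟩ → ρ + δ ≤ σ₀ → (∀ i, κ * ‖a‖ ≤ a i) →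
      ∀ (D : State) (n₁ n₂ n₃ n₄ : Fin 2 → ℝ) (r ν : ℝ), 0 ≤ r → 0 < ν →
        (∀ i, |n₁ i| ≤ C₀ * ((ρ + δ) * (‖a‖ * ‖D.1‖ + fastDist D 0)) + r) →
        (∀ i, |n₂ i| ≤ C₀ * (‖a‖ * ‖D.1‖ + (ρ + δ) * fastDist D 0) + r) →
        (∀ i, |n₃ i| ≤ C₀ * (‖a‖ * ‖D.1‖ + (ρ + δ) * fastDist D 0) + r) →
        (∀ i, |n₄ i| ≤ C₀ * (‖a‖ * ‖D.1‖ + (ρ + δ) * fastDist D 0) + r) →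
        H (P.slow H a δ τ D) (WithLp.toLp 2 fun i =>
              -(P.gain i / √P.eps * (a i / 2)) * H D.1 (unitVec i) + n₁ i)
            / √(H (P.slow H a δ τ D) (P.slow H a δ τ D) + ν ^ 2)
          + ϑ * ((inner ℝ (P.fast H a δ τ D) (WithLp.toLp 2 fun i =>
                -P.lowPass i * P.fast H a δ τ D i
                  + (P.lowPass i * (a i / 2) * H D.1 (unitVec i) + n₂ i))
              + inner ℝ D.2.2.1 (WithLp.toLp 2 fun i => -P.highPass i * D.2.2.1 i + n₃ i)
              + inner ℝ D.2.2.2 (WithLp.toLp 2 fun i => -P.moment i * D.2.2.2 i + n₄ i))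
            / √(fastSq (P.fast H a δ τ D) D.2.2.1 D.2.2.2 + ν ^ 2))
        ≤ -(k * ‖a‖) * P.lyap H a δ ϑ ν τ D + C * (r + ν) := by
  have hK := hv.one_le
  obtain ⟨k, hk, Cs, hCs, hslow⟩ := exists_slow_decay P hv hκ
  obtain ⟨w, hw, hfast⟩ := exists_fast_decay P
  obtain ⟨Cz, hCz, hsize⟩ := exists_size_le P hv
  obtain ⟨L, hL0, hL⟩ : ∃ L ≥ 0, ∀ i, P.lowPass i ≤ L :=
    ⟨P.lowPass 0 + P.lowPass 1, by have := P.lowPass_pos 0; have := P.lowPass_pos 1; positivity,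
      fun i => by
      have := P.lowPass_pos 0
      have := P.lowPass_pos 1
      fin_cases i <;> simp only [Fin.zero_eta, Fin.mk_one] <;> linarith⟩
  -- the constant in the coupling terms
  obtain ⟨C₁, hC₁, hC₁s, hC₁f⟩ : ∃ C₁ ≥ 1, Cs * (1 + 2 * (C₀ * (2 * Cz + 2 * Cz * Cz)) + 2) ≤ C₁ ∧
      2 * (L * K * (2 * Cz)) + 6 * (C₀ * (2 * Cz + 2 * Cz * Cz)) + 6 ≤ C₁ :=
    exists_ge_one_and_le _ _
  set ϑ := k / (4 * C₁) with hϑ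
  have hϑ0 : 0 < ϑ := by positivity
  set Q := C₁ + ϑ * C₁ + k / 2 * ϑ with hQ
  have hQ0 : 0 < Q := by positivity
  refine ⟨ϑ, hϑ0, k / 2, by positivity, C₁ + ϑ * C₁ + k + ϑ * w, by positivity,
    min (k / (4 * C₁)) (ϑ * w / Q), by positivity, ?_⟩
  intro a δ ρ τ hadm hσ ha D n₁ n₂ n₃ n₄ r ν hr hν h1 h2 h3 h4
  have hσ1 : ρ + δ ≤ k / (4 * C₁) := hσ.trans (min_le_left _ _)
  have hσ2 : (ρ + δ) * Q ≤ ϑ * w := by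
    have := hσ.trans (min_le_right _ _)
    rwa [le_div_iff₀ hQ0] at this
  have hρ : 0 ≤ ρ := hadm.rad_nonneg
  have hδ : 0 ≤ δ := hadm.scale_nonneg
  have hδ1 : δ ≤ 1 := hadm.scale_le_one
  have haρ : ‖a‖ ≤ ρ := hadm.amp_le
  have hα1 : ‖a‖ ≤ 1 := haρ.trans hadm.rad_le_one
  have hα0 : 0 ≤ ‖a‖ := norm_nonneg a
  have hασ : ‖a‖ ≤ ρ + δ := by linarith
  obtain ⟨hr1, hd1⟩ := hsize a δ τ D hα1 hδ hδ1
  have hs := hslow a ha (P.slow H a δ τ D) (P.fast H a δ τ D) n₁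
  rw [slow_add] at hs
  have hf := hfast (P.fast H a δ τ D) D.2.2.1 D.2.2.2
    (fun i => P.lowPass i * (a i / 2) * H D.1 (unitVec i) + n₂ i) n₃ n₄
  have hx := (norm_le_sqrt_fastSq (P.fast H a δ τ D) D.2.2.1 D.2.2.2).1
  have hY0 := hv.nonneg (P.slow H a δ τ D)
  have hW0 := fastSq_nonneg (P.fast H a δ τ D) D.2.2.1 D.2.2.2
  unfold slowNorm fastNorm at hr1
  unfold fastNorm at hd1
  unfold lyap
  set Y := H (P.slow H a δ τ D) (P.slow H a δ τ D) with hYdef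
  set W := fastSq (P.fast H a δ τ D) D.2.2.1 D.2.2.2 with hWdef
  set x := P.fast H a δ τ D with hxdef
  have hNy : 0 ≤ √Y := Real.sqrt_nonneg _
  have hNw : 0 ≤ √W := Real.sqrt_nonneg _
  have hty : √Y ≤ √(Y + ν ^ 2) := Real.sqrt_le_sqrt (by nlinarith)
  have htw : √W ≤ √(W + ν ^ 2) := Real.sqrt_le_sqrt (by nlinarith)
  set ty := √(Y + ν ^ 2) with htydef
  set tw := √(W + ν ^ 2) with htwdef
  have hty0 : 0 ≤ ty := Real.sqrt_nonneg _
  have htw0 : 0 ≤ tw := Real.sqrt_nonneg _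
  set σ := ρ + δ with hσdef
  have hσ0 : 0 ≤ σ := by positivity
  have hσ3 : 0 ≤ Cz := by linarith
  -- bounds in terms of the smoothed norms
  have hσ2' : σ ≤ 2 := by
    have := hadm.rad_le_one
    simp only at this
    linarith
  obtain ⟨hc1, hc2, hr2⟩ := coupling_le hC₀ hσ3 hα0 hα1 hασ hσ2' hty0 htw0
    (hr1.trans (by gcongr)) (hd1.trans (by gcongr))
  set M := C₀ * (2 * Cz + 2 * Cz * Cz) with hM
  have hM0 : 0 ≤ M := by positivity
  have hn1 : ∀ i, |n₁ i| ≤ M * (σ * ‖a‖ * ty + σ * tw) + r := fun i =>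
    (h1 i).trans (by linarith)
  have hnw : C₀ * (‖a‖ * ‖D.1‖ + σ * fastDist D 0) + r ≤ M * (‖a‖ * ty + σ * tw) + r := by
    linarith
  have hn2 : ∀ i, |P.lowPass i * (a i / 2) * H D.1 (unitVec i) + n₂ i|
      ≤ L * K * (2 * Cz) * (‖a‖ * ty + σ * tw) + (M * (‖a‖ * ty + σ * tw) + r) := by
    intro i
    refine (abs_add_le _ _).trans (add_le_add ?_ ((h2 i).trans hnw))
    rw [abs_mul, abs_mul, abs_of_pos (P.lowPass_pos i)]
    have p1 : |a i / 2| ≤ ‖a‖ := by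
      rw [abs_div, abs_two]
      have := abs_coord_le a i
      linarith
    calc P.lowPass i * |a i / 2| * |H D.1 (unitVec i)| ≤ L * ‖a‖ * (K * ‖D.1‖) := by
          gcongr
          · exact hL i
          · exact hv.abs_apply_unitVec_le D.1 i
      _ = L * K * (‖a‖ * ‖D.1‖) := by ring
      _ ≤ L * K * (Cz * (‖a‖ * ty + σ * tw)) := by
          have hK0 : 0 ≤ K := by linarith
          gcongr
      _ ≤ _ := by
          have hK0 : 0 ≤ K := by linarith
          have : 0 ≤ L * K * (Cz * (‖a‖ * ty + σ * tw)) := by positivity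
          linarith
  set ey := Cs * (‖a‖ * ‖x‖ + (|n₁ 0| + |n₁ 1|)) with hey
  have hey0 : 0 ≤ ey := by positivity
  have hA := div_sqrt_add_sq_le hY0 hν (by positivity : 0 ≤ k * ‖a‖) hey0 hs
  set ew := ((|P.lowPass 0 * (a 0 / 2) * H D.1 (unitVec 0) + n₂ 0|
    + |P.lowPass 1 * (a 1 / 2) * H D.1 (unitVec 1) + n₂ 1|)
    + (|n₃ 0| + |n₃ 1|) + (|n₄ 0| + |n₄ 1|)) with hew
  have hew0 : 0 ≤ ew := by positivity
  have hB := div_sqrt_add_sq_le hW0 hν hw.le hew0 hf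
  have hey1 : ey ≤ C₁ * (σ * ‖a‖ * ty + σ * tw + r) := by
    have q1 : ‖a‖ * ‖x‖ ≤ σ * tw :=
      mul_le_mul hασ (hx.trans htw) (norm_nonneg _) hσ0
    have q2 := hn1 0
    have q3 := hn1 1
    have p1 : 0 ≤ σ * ‖a‖ * ty := by positivity
    have p2 : 0 ≤ σ * tw := by positivity
    calc ey ≤ Cs * ((1 + 2 * M + 2) * (σ * ‖a‖ * ty + σ * tw + r)) := by
          rw [hey]
          gcongr
          have p3 : 0 ≤ M * r := by positivity
          linarith
      _ = Cs * (1 + 2 * M + 2) * (σ * ‖a‖ * ty + σ * tw + r) := by ring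
      _ ≤ _ := mul_le_mul_of_nonneg_right hC₁s (by positivity)
  have hew1 : ew ≤ C₁ * (‖a‖ * ty + σ * tw + r) := by
    have q0 := hn2 0
    have q1 := hn2 1
    have q2 := (h3 0).trans hnw
    have q3 := (h3 1).trans hnw
    have q4 := (h4 0).trans hnw
    have q5 := (h4 1).trans hnw
    have p1 : 0 ≤ ‖a‖ * ty := by positivity
    have p2 : 0 ≤ σ * tw := by positivity
    have hK0 : 0 ≤ K := by linarith
    have p3 : 0 ≤ (2 * (L * K * (2 * Cz)) + 6 * M) * r := by positivity
    calc ew ≤ (2 * (L * K * (2 * Cz)) + 6 * M + 6) * (‖a‖ * ty + σ * tw + r) := by linarith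
      _ ≤ _ := mul_le_mul_of_nonneg_right hC₁f (by positivity)
  exact lyap_combine hk hw hC₁ hϑ hσ1 hσ2 hα0 hασ hα1 hty0 htw0 hν.le
    (hA.trans (by linarith)) (hB.trans (by linarith)) hr

end Params
end ExtremumSeeking
end

/-! ### The Lyapunov function along solutions, and its comparison with the norm. -/

noncomputable section
namespace ExtremumSeeking
open Set Real
namespace Params

variable {P : Params} {c : ℝ} {v : Plane → ℝ} {Dv : Plane → Plane →L[ℝ] ℝ}
  {H : Plane →L[ℝ] Plane →L[ℝ] ℝ} {K T : ℝ}

theorem fast_sub (a : Plane) (δ τ : ℝ) (u w : State) :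
    P.fast H a δ τ (u - w) = P.fast H a δ τ u - P.fast H a δ τ w := by
  ext i
  simp only [fast, Prod.fst_sub, Prod.snd_sub, PiLp.sub_apply, intLin_sub]
  ring

theorem slow_sub (a : Plane) (δ τ : ℝ) (u w : State) :
    P.slow H a δ τ (u - w) = P.slow H a δ τ u - P.slow H a δ τ w := by
  ext i
  simp only [slow, fast_sub, Prod.fst_sub, PiLp.sub_apply]
  ring

/-- The positive smoothing parameter is what makes both square roots differentiable even where the
slow or the fast part vanishes. -/
theorem hasDerivWithinAt_lyap (hv : RegularCost v Dv H K) {a : Plane} {δ ϑ ν τ : ℝ} (hν : 0 < ν)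
    {D : ℝ → State} {s : Set ℝ} {y' x' ζ' m' : Plane}
    (hy : HasDerivWithinAt (fun t => P.slow H a δ t (D t)) y' s τ)
    (hx : HasDerivWithinAt (fun t => P.fast H a δ t (D t)) x' s τ)
    (hζ : HasDerivWithinAt (fun t => (D t).2.2.1) ζ' s τ)
    (hm : HasDerivWithinAt (fun t => (D t).2.2.2) m' s τ) :
    HasDerivWithinAt (fun t => P.lyap H a δ ϑ ν t (D t))
      (H (P.slow H a δ τ (D τ)) y'
          / √(H (P.slow H a δ τ (D τ)) (P.slow H a δ τ (D τ)) + ν ^ 2)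
        + ϑ * ((inner ℝ (P.fast H a δ τ (D τ)) x' + inner ℝ (D τ).2.2.1 ζ'
            + inner ℝ (D τ).2.2.2 m')
          / √(fastSq (P.fast H a δ τ (D τ)) (D τ).2.2.1 (D τ).2.2.2 + ν ^ 2))) s τ := by
  have hY0 := hv.nonneg (P.slow H a δ τ (D τ))
  have hW0 := fastSq_nonneg (P.fast H a δ τ (D τ)) (D τ).2.2.1 (D τ).2.2.2
  have h1 : HasDerivWithinAt (fun t => H (P.slow H a δ t (D t)) (P.slow H a δ t (D t)) + ν ^ 2)
      (2 * H (P.slow H a δ τ (D τ)) y') s τ := by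
    have h2 : HasDerivWithinAt (fun t => H (P.slow H a δ t (D t))) (H y') s τ :=
      H.hasFDerivAt.comp_hasDerivWithinAt τ hy
    refine ((h2.clm_apply hy).add_const (ν ^ 2)).congr_deriv ?_
    rw [hv.H_symm y']
    ring
  have h3 : HasDerivWithinAt
      (fun t => fastSq (P.fast H a δ t (D t)) (D t).2.2.1 (D t).2.2.2 + ν ^ 2)
      (2 * (inner ℝ (P.fast H a δ τ (D τ)) x' + inner ℝ (D τ).2.2.1 ζ'
            + inner ℝ (D τ).2.2.2 m')) s τ := by
    refine (((hx.norm_sq.add hζ.norm_sq).add hm.norm_sq).add_const (ν ^ 2)).congr_deriv ?_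
    ring
  refine ((h1.sqrt (by positivity)).add ((h3.sqrt (by positivity)).const_mul ϑ)).congr_deriv ?_
  rw [mul_div_mul_left _ _ two_ne_zero, mul_div_mul_left _ _ two_ne_zero]

theorem lyap_deriv_smul (a : Plane) (δ ϑ τ t1 t2 : ℝ) (D : State) (y' x' ζ' m' : Plane) :
    H (P.slow H a δ τ D) (δ • y') / t1
      + ϑ * ((inner ℝ (P.fast H a δ τ D) (δ • x') + inner ℝ D.2.2.1 (δ • ζ')
          + inner ℝ D.2.2.2 (δ • m')) / t2)
    = δ * (H (P.slow H a δ τ D) y' / t1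
      + ϑ * ((inner ℝ (P.fast H a δ τ D) x' + inner ℝ D.2.2.1 ζ' + inner ℝ D.2.2.2 m') / t2)) := by
  simp only [map_smul, smul_eq_mul, inner_smul_right]
  ring

theorem toLp_sub_affine (δ : ℝ) (b : Fin 2 → ℝ) (x y : Plane) (n n' : Fin 2 → ℝ) :
    δ • WithLp.toLp 2 (fun i => b i * x i + n i) - δ • WithLp.toLp 2 (fun i => b i * y i + n' i)
      = δ • (WithLp.toLp 2 fun i => b i * (x - y) i + (n i - n' i) : Plane) := by
  ext i
  simp only [PiLp.sub_apply, PiLp.smul_apply, smul_eq_mul]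
  ring

/-- Differential inequalities for the Lyapunov function along two solutions and along one. -/
theorem exists_lyap_estimates (hv : RegularCost v Dv H K) (hc : 0 ≤ c) (hT : 0 < T)
    (hper : ∀ i, Function.Periodic (fun τ : ℝ => sin (P.freq i * τ)) T) {κ : ℝ} (hκ : 0 < κ) :
    ∃ ϑ > 0, ∃ k > 0, ∃ C ≥ 0, ∃ σ₀ > 0, ∀ (a : Plane) (δ ρ τ : ℝ),
      P.Admissible ⟨a, δ, ρ, τ⟩ → ρ + δ ≤ σ₀ → (∀ i, κ * ‖a‖ ≤ a i) → ∀ ν > 0, ∀ s : Set ℝ,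
      (∀ z₁ z₂ : ℝ → State, HasDerivWithinAt z₁ (P.costField v a δ τ (z₁ τ)) s τ →
        HasDerivWithinAt z₂ (P.costField v a δ τ (z₂ τ)) s τ →
        P.shift v H a δ τ (z₁ τ) ∈ region c a ρ → P.shift v H a δ τ (z₂ τ) ∈ region c a ρ →
        ∃ f', HasDerivWithinAt (fun t => P.lyap H a δ ϑ ν t
            (P.shift v H a δ t (z₁ t) - P.shift v H a δ t (z₂ t))) f' s τ ∧
          f' ≤ δ * (-(k * ‖a‖) * P.lyap H a δ ϑ ν τ
            (P.shift v H a δ τ (z₁ τ) - P.shift v H a δ τ (z₂ τ)) + C * ν)) ∧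
      (∀ z : ℝ → State, HasDerivWithinAt z (P.costField v a δ τ (z τ)) s τ →
        P.shift v H a δ τ (z τ) ∈ region c a ρ →
        ∃ f', HasDerivWithinAt (fun t => P.lyap H a δ ϑ ν t (P.shift v H a δ t (z t))) f' s τ ∧
          f' ≤ δ * (-(k * ‖a‖) * P.lyap H a δ ϑ ν τ (P.shift v H a δ τ (z τ))
            + C * (‖a‖ ^ 3 + δ * ‖a‖ ^ 2 + ν))) := by
  obtain ⟨C₀, hC₀, hrem⟩ := exists_remainder_bound (P := P) hv hc hT hper
  obtain ⟨ϑ, hϑ, k, hk, C, hC, σ₀, hσ₀, hdec⟩ := exists_lyap_decay P hv hκ hC₀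
  refine ⟨ϑ, hϑ, k, hk, C * (C₀ + 1), by positivity, σ₀, hσ₀, ?_⟩
  intro a δ ρ τ hadm hσ ha ν hν s
  obtain ⟨hlip, hres⟩ := hrem _ hadm
  simp only at hlip hres
  have hδ : 0 ≤ δ := hadm.scale_nonneg
  have hρ : 0 ≤ ρ := hadm.rad_nonneg
  constructor
  · intro z₁ z₂ hz₁ hz₂ hu₁ hu₂
    have hy := (hasDerivWithinAt_slow_solution (H := H) hv.hasFDerivAt hz₁ rfl).sub
      (hasDerivWithinAt_slow_solution (H := H) hv.hasFDerivAt hz₂ rfl)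
    have hx := (hasDerivWithinAt_fast_solution (H := H) hv.hasFDerivAt hz₁ rfl).sub
      (hasDerivWithinAt_fast_solution (H := H) hv.hasFDerivAt hz₂ rfl)
    have hζ := (hasDerivWithinAt_zeta_solution (H := H) hv.hasFDerivAt hz₁ rfl).sub
      (hasDerivWithinAt_zeta_solution (H := H) hv.hasFDerivAt hz₂ rfl)
    have hm := (hasDerivWithinAt_moment_solution (H := H) hv.hasFDerivAt hz₁ rfl).sub
      (hasDerivWithinAt_moment_solution (H := H) hv.hasFDerivAt hz₂ rfl)
    set u₁ := P.shift v H a δ τ (z₁ τ) with hu₁def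
    set u₂ := P.shift v H a δ τ (z₂ τ) with hu₂def
    -- The maps `slow` and `fast` are linear in the shifted state, so the two transformed equations
    -- can simply be subtracted although `shift` itself is nonlinear.
    have ey : ∀ t, P.slow H a δ t (P.shift v H a δ t (z₁ t)) - P.slow H a δ t (P.shift v H a δ t (z₂ t))
        = P.slow H a δ t (P.shift v H a δ t (z₁ t) - P.shift v H a δ t (z₂ t)) := fun t =>
      (slow_sub _ _ _ _ _).symm
    have ex : ∀ t, P.fast H a δ t (P.shift v H a δ t (z₁ t)) - P.fast H a δ t (P.shift v H a δ t (z₂ t))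
        = P.fast H a δ t (P.shift v H a δ t (z₁ t) - P.shift v H a δ t (z₂ t)) := fun t =>
      (fast_sub _ _ _ _ _).symm
    have hy' : HasDerivWithinAt (fun t => P.slow H a δ t
        (P.shift v H a δ t (z₁ t) - P.shift v H a δ t (z₂ t)))
        (δ • WithLp.toLp 2 fun i => -(P.gain i / √P.eps * (a i / 2)) * H (u₁ - u₂).1 (unitVec i)
          + (P.remSlow v Dv H a δ τ i u₁ - P.remSlow v Dv H a δ τ i u₂)) s τ := by
      refine (hy.congr_deriv ?_).congr (fun t _ => (ey t).symm) (ey τ).symm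
      ext i
      simp only [PiLp.sub_apply, PiLp.smul_apply, smul_eq_mul, Prod.fst_sub, map_sub, sub_apply]
      ring
    have hx' : HasDerivWithinAt (fun t => P.fast H a δ t
        (P.shift v H a δ t (z₁ t) - P.shift v H a δ t (z₂ t)))
        (δ • WithLp.toLp 2 fun i => -P.lowPass i * P.fast H a δ τ (u₁ - u₂) i
          + (P.lowPass i * (a i / 2) * H (u₁ - u₂).1 (unitVec i)
          + (P.remFast v Dv H a δ τ i u₁ - P.remFast v Dv H a δ τ i u₂))) s τ := by
      refine (hx.congr_deriv ?_).congr (fun t _ => (ex t).symm) (ex τ).symm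
      ext i
      simp only [PiLp.sub_apply, PiLp.smul_apply, smul_eq_mul, Prod.fst_sub, map_sub, sub_apply,
        fast_sub]
      ring
    rw [toLp_sub_affine] at hζ hm
    have hder := hasDerivWithinAt_lyap (ϑ := ϑ)
      (D := fun t => P.shift v H a δ t (z₁ t) - P.shift v H a δ t (z₂ t)) hv hν hy' hx' hζ hm
    simp only [← hu₁def, ← hu₂def] at hder
    refine ⟨_, hder, ?_⟩
    rw [lyap_deriv_smul]
    have hfd : fastDist u₁ u₂ = fastDist (u₁ - u₂) 0 := by simp [fastDist]
    -- The residual is 0 here: a difference of remainders is controlled by the Lipschitz bounds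
    -- alone.
    refine mul_le_mul_of_nonneg_left ((hdec a δ ρ τ hadm hσ ha (u₁ - u₂) _ _ _ _ 0 ν le_rfl hν
      (fun i => ?_) (fun i => ?_) (fun i => ?_) (fun i => ?_)).trans ?_) hδ
    · rw [add_zero, ← hfd]; exact (hlip u₁ hu₁ u₂ hu₂ i).1
    · rw [add_zero, ← hfd]; exact (hlip u₁ hu₁ u₂ hu₂ i).2.1
    · rw [add_zero, ← hfd]; exact (hlip u₁ hu₁ u₂ hu₂ i).2.2.1
    · rw [add_zero, ← hfd]; exact (hlip u₁ hu₁ u₂ hu₂ i).2.2.2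
    · have : 0 ≤ C * C₀ * ν := by positivity
      linarith
  · intro z hz hu
    have hy := hasDerivWithinAt_slow_solution (H := H) hv.hasFDerivAt hz rfl
    have hx := hasDerivWithinAt_fast_solution (H := H) hv.hasFDerivAt hz rfl
    have hζ := hasDerivWithinAt_zeta_solution (H := H) hv.hasFDerivAt hz rfl
    have hm := hasDerivWithinAt_moment_solution (H := H) hv.hasFDerivAt hz rfl
    have hder := hasDerivWithinAt_lyap (ϑ := ϑ)
      (D := fun t => P.shift v H a δ t (z t)) hv hν hy hx hζ hm
    refine ⟨_, hder, ?_⟩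
    set u := P.shift v H a δ τ (z τ) with hudef
    have h0 : (0 : State) ∈ region c a ρ := ⟨by simpa using hρ, by simp; positivity, by simpa using hρ⟩
    rw [lyap_deriv_smul]
    set r := C₀ * (‖a‖ ^ 3 + δ * ‖a‖ ^ 2) with hr
    have hr0 : 0 ≤ r := by positivity
    -- Each remainder is its increment from the zero state plus its value there, which joins the
    -- Lipschitz bound and the residual bound.
    have habs : ∀ x y B : ℝ, |x - y| ≤ B → |y| ≤ r → |x| ≤ B + r := fun x y B h1 h2 => by
      have := abs_add_le (x - y) y
      rw [sub_add_cancel] at this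
      linarith
    refine mul_le_mul_of_nonneg_left ((hdec a δ ρ τ hadm hσ ha u _ _ _ _ r ν hr0 hν
      (fun i => ?_) (fun i => ?_) (fun i => ?_) (fun i => ?_)).trans ?_) hδ
    · have := (hlip u hu 0 h0 i).1
      simp only [Prod.fst_zero, sub_zero] at this
      exact habs _ _ _ this (hres i).1
    · have := (hlip u hu 0 h0 i).2.1
      simp only [Prod.fst_zero, sub_zero] at this
      exact habs _ _ _ this (hres i).2.1
    · have := (hlip u hu 0 h0 i).2.2.1
      simp only [Prod.fst_zero, sub_zero] at this
      exact habs _ _ _ this (hres i).2.2.1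
    · have := (hlip u hu 0 h0 i).2.2.2
      simp only [Prod.fst_zero, sub_zero] at this
      exact habs _ _ _ this (hres i).2.2.2
    · have h1 : 0 ≤ C * C₀ * ν := by positivity
      have h2 : 0 ≤ C * (‖a‖ ^ 3 + δ * ‖a‖ ^ 2) := by positivity
      rw [hr]
      linarith

/-! ### Comparison of norms -/

theorem slowNorm_le_lyap (a : Plane) {δ ϑ ν τ : ℝ} (hϑ : 0 ≤ ϑ) (D : State) :
    P.slowNorm H a δ τ D ≤ P.lyap H a δ ϑ ν τ D := by
  have h1 : P.slowNorm H a δ τ D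
      ≤ √(H (P.slow H a δ τ D) (P.slow H a δ τ D) + ν ^ 2) :=
    Real.sqrt_le_sqrt (by nlinarith)
  have h2 : 0 ≤ ϑ * √(fastSq (P.fast H a δ τ D) D.2.2.1 D.2.2.2 + ν ^ 2) := by positivity
  unfold lyap
  linarith

theorem fastNorm_le_lyap (a : Plane) {δ ϑ ν τ : ℝ} (hϑ : 0 ≤ ϑ) (D : State) :
    ϑ * P.fastNorm H a δ τ D ≤ P.lyap H a δ ϑ ν τ D := by
  have h1 : P.fastNorm H a δ τ D ≤ √(fastSq (P.fast H a δ τ D) D.2.2.1 D.2.2.2 + ν ^ 2) :=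
    Real.sqrt_le_sqrt (by nlinarith)
  have h2 : 0 ≤ √(H (P.slow H a δ τ D) (P.slow H a δ τ D) + ν ^ 2) := by positivity
  have h3 := mul_le_mul_of_nonneg_left h1 hϑ
  unfold lyap
  linarith

theorem exists_norm_le_lyap (P : Params) (hv : RegularCost v Dv H K) {ϑ : ℝ} (hϑ : 0 < ϑ) :
    ∃ C ≥ 1, ∀ (a : Plane) (δ ν τ : ℝ) (D : State), ‖a‖ ≤ 1 → 0 ≤ δ → δ ≤ 1 →
      ‖D‖ ≤ C * P.lyap H a δ ϑ ν τ D := by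
  obtain ⟨C, hC, h⟩ := exists_size_le P hv
  obtain ⟨M, hM1, hM2, -⟩ := exists_ge_one_and_le (C * (1 + C) * (1 + 1 / ϑ) + C * (1 / ϑ)) 0
  refine ⟨M, hM1, fun a δ ν τ D ha hδ hδ1 => ?_⟩
  obtain ⟨h1, h2⟩ := h a δ τ D ha hδ hδ1
  have e1 := slowNorm_le_lyap (P := P) (H := H) (δ := δ) (ν := ν) (τ := τ) a hϑ.le D
  have e2 := fastNorm_le_lyap (P := P) (H := H) (δ := δ) (ν := ν) (τ := τ) a hϑ.le D
  set L := P.lyap H a δ ϑ ν τ D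
  have e3 : P.fastNorm H a δ τ D ≤ 1 / ϑ * L := by
    rw [one_div, le_inv_mul_iff₀ hϑ]; exact e2
  have hL0 : 0 ≤ L := (Real.sqrt_nonneg _).trans e1
  have hr : ‖D.1‖ ≤ C * ((1 + 1 / ϑ) * L) := by
    refine h1.trans ?_
    gcongr
    linarith
  have hd : fastDist D 0 ≤ C * (1 / ϑ * L + 1 * (C * ((1 + 1 / ϑ) * L))) := by
    refine h2.trans ?_
    gcongr
  rw [fastDist_zero] at hd
  have n1 := norm_nonneg D.2.1
  have n2 := norm_nonneg D.2.2.1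
  have n3 := norm_nonneg D.2.2.2
  have n0 : 0 ≤ C * ((1 + 1 / ϑ) * L) := by positivity
  have n4 : 0 ≤ C * (1 / ϑ * L + 1 * (C * ((1 + 1 / ϑ) * L))) := by positivity
  have hD : ‖D‖ ≤ C * ((1 + 1 / ϑ) * L) + C * (1 / ϑ * L + 1 * (C * ((1 + 1 / ϑ) * L))) := by
    rw [Prod.norm_def, Prod.norm_def, Prod.norm_def]
    refine max_le (by linarith) (max_le (by linarith) (max_le (by linarith) (by linarith)))
  refine hD.trans ?_
  calc _ = (C * (1 + C) * (1 + 1 / ϑ) + C * (1 / ϑ)) * L := by ring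
    _ ≤ M * L := by gcongr

theorem sqrt_add_sq_le {Y ν : ℝ} (hY : 0 ≤ Y) (hν : 0 ≤ ν) : √(Y + ν ^ 2) ≤ √Y + ν := by
  rw [Real.sqrt_le_left (by positivity)]
  nlinarith [Real.sq_sqrt hY, mul_nonneg (Real.sqrt_nonneg Y) hν]

theorem exists_lyap_le_norm (P : Params) (hv : RegularCost v Dv H K) {ϑ : ℝ} (hϑ : 0 < ϑ) :
    ∃ C ≥ 1, ∀ (a : Plane) (δ ν τ : ℝ) (D : State), ‖a‖ ≤ 1 → 0 ≤ δ → δ ≤ 1 → 0 ≤ ν →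
      P.lyap H a δ ϑ ν τ D ≤ C * ‖D‖ + (1 + ϑ) * ν := by
  have hK := hv.one_le
  obtain ⟨C, hC⟩ := P.exists_abs_intLin_le
  have hlF : ∀ i, 0 < P.lowPass i ∧ 0 < P.freq i := fun i => ⟨P.lowPass_pos i, P.freq_pos i⟩
  obtain ⟨F, hF0, hF⟩ : ∃ F ≥ 1, ∀ (a : Plane) (δ τ : ℝ) (D : State), ‖a‖ ≤ 1 → 0 ≤ δ → δ ≤ 1 →
      ∀ i, |P.fast H a δ τ D i| ≤ F * ‖D‖ := by
    obtain ⟨F, hF1, hF2, hF3⟩ := exists_ge_one_and_le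
      (1 + P.lowPass 0 * (|C| * ‖H‖ + 1 / P.freq 0)) (1 + P.lowPass 1 * (|C| * ‖H‖ + 1 / P.freq 1))
    refine ⟨F, hF1, fun a δ τ D ha hδ hδ1 i => ?_⟩
    obtain ⟨hl, hf⟩ := hlF i
    have d1 : ‖D.1‖ ≤ ‖D‖ := norm_fst_le D
    have d2 : ‖D.2.1‖ ≤ ‖D‖ := (norm_fst_le D.2).trans (norm_snd_le D)
    have d3 : ‖D.2.2.1‖ ≤ ‖D‖ := (norm_fst_le D.2.2).trans ((norm_snd_le D.2).trans (norm_snd_le D))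
    have e1 : |P.intLin H a i τ D.1| ≤ |C| * ‖H‖ * ‖D‖ := by
      refine (hC H a i τ D.1).trans ?_
      calc C * ‖H‖ * ‖a‖ * ‖D.1‖ ≤ |C| * ‖H‖ * 1 * ‖D‖ := by gcongr; exact le_abs_self C
        _ = _ := by ring
    have e2 : |cos (P.freq i * τ) / P.freq i * D.2.2.1 i| ≤ 1 / P.freq i * ‖D‖ := by
      rw [abs_mul, abs_div, abs_of_pos hf]
      gcongr
      · exact abs_cos_le_one _
      · exact (abs_coord_le _ i).trans d3
    have e3 : |P.fast H a δ τ D i| ≤ ‖D‖ + 1 * P.lowPass i * (|C| * ‖H‖ * ‖D‖ + 1 / P.freq i * ‖D‖) := by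
      simp only [fast]
      refine (abs_sub _ _).trans (add_le_add ((abs_coord_le _ i).trans d2) ?_)
      rw [abs_mul, abs_mul, abs_of_nonneg hδ, abs_of_pos hl]
      have := (abs_add_le (P.intLin H a i τ D.1)
        (cos (P.freq i * τ) / P.freq i * D.2.2.1 i)).trans (add_le_add e1 e2)
      gcongr
    refine e3.trans ?_
    have hFi : 1 + P.lowPass i * (|C| * ‖H‖ + 1 / P.freq i) ≤ F := by
      fin_cases i
      · exact hF2
      · exact hF3
    calc _ = (1 + P.lowPass i * (|C| * ‖H‖ + 1 / P.freq i)) * ‖D‖ := by ring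
      _ ≤ _ := by gcongr
  obtain ⟨M, hM1, hM2, -⟩ := exists_ge_one_and_le
    (K * (2 + |P.slope 0| * F + |P.slope 1| * F) + ϑ * (2 * F + 2)) 0
  refine ⟨M, hM1, fun a δ ν τ D ha hδ hδ1 hν => ?_⟩
  have d1 : ‖D.1‖ ≤ ‖D‖ := norm_fst_le D
  have d3 : ‖D.2.2.1‖ ≤ ‖D‖ := (norm_fst_le D.2.2).trans ((norm_snd_le D.2).trans (norm_snd_le D))
  have d4 : ‖D.2.2.2‖ ≤ ‖D‖ := (norm_snd_le D.2.2).trans ((norm_snd_le D.2).trans (norm_snd_le D))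
  have f0 := hF a δ τ D ha hδ hδ1 0
  have f1 := hF a δ τ D ha hδ hδ1 1
  have hx : ‖P.fast H a δ τ D‖ ≤ 2 * F * ‖D‖ := by
    have := norm_le_sum_abs (P.fast H a δ τ D)
    linarith
  have hyi : ∀ i, |P.slow H a δ τ D i| ≤ ‖D‖ + |P.slope i| * (F * ‖D‖) := fun i => by
    simp only [slow]
    refine (abs_sub _ _).trans (add_le_add ((abs_coord_le _ i).trans d1) ?_)
    rw [abs_mul]
    have := hF a δ τ D ha hδ hδ1 i
    gcongr
  have hy : ‖P.slow H a δ τ D‖ ≤ (2 + |P.slope 0| * F + |P.slope 1| * F) * ‖D‖ := by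
    have h1 := norm_le_sum_abs (P.slow H a δ τ D)
    have h2 := hyi 0
    have h3 := hyi 1
    linarith
  have hY : √(H (P.slow H a δ τ D) (P.slow H a δ τ D)) ≤ K * ‖P.slow H a δ τ D‖ := by
    rw [Real.sqrt_le_left (by positivity)]
    have h1 := H.le_opNorm₂ (P.slow H a δ τ D) (P.slow H a δ τ D)
    have h2 := (le_abs_self _).trans h1
    have h3 := hv.H_le
    have h4 : ‖H‖ * (‖P.slow H a δ τ D‖ * ‖P.slow H a δ τ D‖)
        ≤ K * K * (‖P.slow H a δ τ D‖ * ‖P.slow H a δ τ D‖) := by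
      gcongr
      nlinarith
    nlinarith
  have hW : √(fastSq (P.fast H a δ τ D) D.2.2.1 D.2.2.2)
      ≤ ‖P.fast H a δ τ D‖ + ‖D.2.2.1‖ + ‖D.2.2.2‖ := by
    rw [Real.sqrt_le_left (by positivity)]
    unfold fastSq
    have p1 := mul_nonneg (norm_nonneg (P.fast H a δ τ D)) (norm_nonneg D.2.2.1)
    have p2 := mul_nonneg (norm_nonneg (P.fast H a δ τ D)) (norm_nonneg D.2.2.2)
    have p3 := mul_nonneg (norm_nonneg D.2.2.1) (norm_nonneg D.2.2.2)
    nlinarith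
  have s1 := sqrt_add_sq_le (hv.nonneg (P.slow H a δ τ D)) hν
  have s2 := sqrt_add_sq_le (fastSq_nonneg (P.fast H a δ τ D) D.2.2.1 D.2.2.2) hν
  have t1 : √(H (P.slow H a δ τ D) (P.slow H a δ τ D) + ν ^ 2)
      ≤ K * ((2 + |P.slope 0| * F + |P.slope 1| * F) * ‖D‖) + ν := by
    refine s1.trans (add_le_add (hY.trans ?_) le_rfl)
    gcongr
  have t2 : √(fastSq (P.fast H a δ τ D) D.2.2.1 D.2.2.2 + ν ^ 2) ≤ (2 * F + 2) * ‖D‖ + ν := by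
    linarith
  have t3 := mul_le_mul_of_nonneg_left t2 hϑ.le
  unfold lyap
  calc _ ≤ (K * (2 + |P.slope 0| * F + |P.slope 1| * F) + ϑ * (2 * F + 2)) * ‖D‖
        + (1 + ϑ) * ν := by linarith
    _ ≤ _ := by gcongr

end Params
end ExtremumSeeking
end

/-! ### Fixed points of the period map, and a globally Lipschitz truncation of the field. -/

noncomputable section
namespace ExtremumSeeking
open Set Real

/-- A periodic, bounded, globally Lipschitz field whose flow preserves a periodic family of closed
sets and contracts exponentially there has a periodic solution in this family. -/
theorem exists_periodic_solution_of_contracting {E : Type*} [NormedAddCommGroup E]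
    [NormedSpace ℝ E] [CompleteSpace E] {F : ℝ → E → E} {K M : NNReal}
    (hlip : ∀ t, LipschitzWith K (F t)) (hcont : ∀ x, Continuous fun t => F t x)
    (hbdd : ∀ t x, ‖F t x‖ ≤ M) {T : ℝ} (hT : 0 < T) (hF : Function.Periodic F T)
    {S : ℝ → Set E} (hS : Function.Periodic S T) (hne : (S 0).Nonempty) (hcl : IsClosed (S 0))
    (hinv : ∀ z : ℝ → E, (∀ t, HasDerivAt z (F t (z t)) t) → z 0 ∈ S 0 → ∀ t ≥ 0, z t ∈ S t)
    {B lam : ℝ} (hlam : 0 < lam)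
    (hcontr : ∀ z w : ℝ → E, (∀ t, HasDerivAt z (F t (z t)) t) → (∀ t, HasDerivAt w (F t (w t)) t) →
      z 0 ∈ S 0 → w 0 ∈ S 0 → ∀ t ≥ 0, ‖z t - w t‖ ≤ B * exp (-lam * t) * ‖z 0 - w 0‖) :
    ∃ z : ℝ → E, (∀ t, HasDerivAt z (F t (z t)) t) ∧ Function.Periodic z T ∧ ∀ t, z t ∈ S t := by
  choose φ hφ0 hφ using exists_solution_of_bounded_lipschitz hlip hcont hbdd 0
  have huniq : ∀ z w : ℝ → E, (∀ t, HasDerivAt z (F t (z t)) t) → (∀ t, HasDerivAt w (F t (w t)) t) →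
      z 0 = w 0 → z = w := fun z w hz hw h0 =>
    ODE_solution_unique_univ (s := fun _ => univ) (t₀ := 0) (fun t => (hlip t).lipschitzOnWith)
      (fun t => ⟨hz t, trivial⟩) (fun t => ⟨hw t, trivial⟩) h0
  have hshift : ∀ x, (fun t => φ x (t + T)) = φ (φ x T) := fun x => by
    refine huniq _ _ (fun t => ?_) (hφ _) (by simp [hφ0])
    have := (hφ x (t + T)).comp_add_const t T
    rwa [hF t] at this
  have hmaps : ∀ x ∈ S 0, φ x T ∈ S 0 := fun x hx => by
    have := hinv (φ x) (hφ x) (by rwa [hφ0]) T hT.le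
    have h0 := hS 0
    rw [zero_add] at h0
    rwa [h0] at this
  let f : S 0 → S 0 := fun x => ⟨φ x T, hmaps x x.2⟩
  have hiter : ∀ (n : ℕ) (x : S 0), ((f^[n] x : S 0) : E) = φ x (n * T) := by
    intro n
    induction n with
    | zero => intro x; simp [hφ0]
    | succ n ih =>
      intro x
      rw [Function.iterate_succ_apply, ih]
      have := congrFun (hshift x) (n * T)
      simp only [f]
      rw [← this]
      congr 1
      push_cast
      ring
  -- As `B` may exceed 1, the period map itself need not contract, but a high iterate does. The
  -- fixed point of the iterate is unique, hence fixed by the period map as well.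
  obtain ⟨n, hn⟩ : ∃ n : ℕ, |B| * exp (-lam * (n * T)) < 1 / 2 := by
    have h1 : Filter.Tendsto (fun n : ℕ => |B| * exp (-lam * (n * T))) Filter.atTop
        (nhds (|B| * 0)) := by
      refine Filter.Tendsto.const_mul _ (Real.tendsto_exp_atBot.comp ?_)
      have h2 : Filter.Tendsto (fun n : ℕ => (n : ℝ) * T) Filter.atTop Filter.atTop :=
        tendsto_natCast_atTop_atTop.atTop_mul_const hT
      exact h2.const_mul_atTop_of_neg (by linarith)
    rw [mul_zero] at h1
    exact (h1.eventually (gt_mem_nhds (by norm_num : (0 : ℝ) < 1 / 2))).exists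
  have hcw : ContractingWith (1 / 2) f^[n] := by
    refine ⟨by norm_num, LipschitzWith.of_dist_le_mul fun x y => ?_⟩
    rw [Subtype.dist_eq, Subtype.dist_eq, hiter, hiter, dist_eq_norm, dist_eq_norm]
    have h1 := hcontr _ _ (hφ x) (hφ y) (by rw [hφ0]; exact x.2) (by rw [hφ0]; exact y.2) (n * T)
      (by positivity)
    rw [hφ0, hφ0] at h1
    refine h1.trans (mul_le_mul_of_nonneg_right ?_ (norm_nonneg _))
    have h2 := mul_le_mul_of_nonneg_right (le_abs_self B) (exp_pos (-lam * (n * T))).le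
    have h3 : ((1 / 2 : NNReal) : ℝ) = 1 / 2 := by norm_num
    rw [h3]
    linarith
  have : Nonempty (S 0) := hne.to_subtype
  have : CompleteSpace (S 0) := hcl.completeSpace_coe
  have hfix : f (hcw.fixedPoint f^[n]) = hcw.fixedPoint f^[n] :=
    hcw.isFixedPt_fixedPoint_iterate
  generalize hcw.fixedPoint f^[n] = x at hfix
  have hx : φ x T = x := congrArg Subtype.val hfix
  have hper : Function.Periodic (φ x) T := fun t => by
    have := congrFun (hshift x) t
    rwa [hx] at this
  refine ⟨φ x, hφ x, hper, fun t => ?_⟩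
  -- Invariance is known only for nonnegative times; negative times are reached by adding periods.
  obtain ⟨n, hn⟩ := exists_nat_ge (-t / T)
  have hn' : 0 ≤ t + n * T := by
    rw [div_le_iff₀ hT] at hn
    linarith
  have h1 := hinv (φ x) (hφ x) (by rw [hφ0]; exact x.2) _ hn'
  rwa [hper.nat_mul n t, hS.nat_mul n t] at h1

/-! ### Bounded Lipschitz functions -/

/-- `f t x` is bounded and Lipschitz in `x`, uniformly in `t`, and continuous in `t`. -/
def BddLip (f : ℝ → State → ℝ) : Prop :=
  (∃ C, (∀ t x, |f t x| ≤ C) ∧ ∀ t x y, |f t x - f t y| ≤ C * ‖x - y‖) ∧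
    ∀ x, Continuous fun t => f t x

theorem BddLip.add {f g : ℝ → State → ℝ} (hf : BddLip f) (hg : BddLip g) :
    BddLip fun t x => f t x + g t x := by
  obtain ⟨⟨C, hC, hC'⟩, hfc⟩ := hf
  obtain ⟨⟨D, hD, hD'⟩, hgc⟩ := hg
  refine ⟨⟨C + D, fun t x => ?_, fun t x y => ?_⟩, fun x => (hfc x).add (hgc x)⟩
  · exact (abs_add_le _ _).trans (add_le_add (hC t x) (hD t x))
  · rw [add_sub_add_comm, add_mul]
    exact (abs_add_le _ _).trans (add_le_add (hC' t x y) (hD' t x y))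

theorem BddLip.mul {f g : ℝ → State → ℝ} (hf : BddLip f) (hg : BddLip g) :
    BddLip fun t x => f t x * g t x := by
  obtain ⟨⟨C, hC, hC'⟩, hfc⟩ := hf
  obtain ⟨⟨D, hD, hD'⟩, hgc⟩ := hg
  have hC0 : 0 ≤ C := (abs_nonneg _).trans (hC 0 0)
  have hD0 : 0 ≤ D := (abs_nonneg _).trans (hD 0 0)
  refine ⟨⟨2 * (C * D), fun t x => ?_, fun t x y => ?_⟩, fun x => (hfc x).mul (hgc x)⟩
  · rw [abs_mul]
    have := mul_le_mul (hC t x) (hD t x) (abs_nonneg _) hC0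
    nlinarith
  · have h1 : f t x * g t x - f t y * g t y = f t x * (g t x - g t y) + (f t x - f t y) * g t y := by
      ring
    rw [h1]
    refine (abs_add_le _ _).trans ?_
    rw [abs_mul, abs_mul]
    have h2 := mul_le_mul (hC t x) (hD' t x y) (abs_nonneg _) hC0
    have h3 := mul_le_mul (hC' t x y) (hD t y) (abs_nonneg _) (by positivity)
    linarith

theorem bddLip_of_bounded {f : ℝ → ℝ} {C : ℝ} (h : ∀ t, |f t| ≤ C) (hf : Continuous f) :
    BddLip fun t _ => f t := by
  have hC : 0 ≤ C := (abs_nonneg _).trans (h 0)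
  exact ⟨⟨C, fun t _ => h t, fun t x y => by rw [sub_self, abs_zero]; positivity⟩, fun _ => hf⟩

theorem bddLip_const (c : ℝ) : BddLip fun _ _ => c :=
  bddLip_of_bounded (fun _ => le_rfl) continuous_const

theorem BddLip.neg {f : ℝ → State → ℝ} (hf : BddLip f) : BddLip fun t x => -f t x := by
  simpa using (bddLip_const (-1)).mul hf

/-- Truncation of a real number to `[-c, c]`. -/
def clip (c x : ℝ) : ℝ := max (-c) (min x c)

theorem abs_clip_le {c : ℝ} (hc : 0 ≤ c) (x : ℝ) : |clip c x| ≤ c := by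
  rw [abs_le]
  exact ⟨le_max_left _ _, max_le (by linarith) (min_le_right _ _)⟩

theorem clip_eq {c x : ℝ} (h : |x| ≤ c) : clip c x = x := by
  rw [abs_le] at h
  rw [clip, min_eq_left h.2, max_eq_right h.1]

theorem abs_clip_sub_le (c x y : ℝ) : |clip c x - clip c y| ≤ |x - y| := by
  have h1 := abs_max_sub_max_le_max (-c) (min x c) (-c) (min y c)
  have h2 := abs_min_sub_min_le_max x c y c
  simp only [sub_self, abs_zero] at h1 h2
  rw [max_eq_right (abs_nonneg (min x c - min y c))] at h1
  rw [max_eq_left (abs_nonneg (x - y))] at h2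
  exact h1.trans h2

theorem bddLip_clip {c : ℝ} (hc : 0 ≤ c) {f : State → ℝ} (hf : ∀ x y, |f x - f y| ≤ ‖x - y‖) :
    BddLip fun _ x => clip c (f x) := by
  refine ⟨⟨max c 1, fun _ x => (abs_clip_le hc _).trans (le_max_left _ _), fun _ x y => ?_⟩,
    fun _ => continuous_const⟩
  refine (abs_clip_sub_le c _ _).trans ((hf x y).trans ?_)
  exact le_mul_of_one_le_left (norm_nonneg _) (le_max_right _ _)

theorem RegularCost.abs_sub_le {v : Plane → ℝ} {Dv : Plane → Plane →L[ℝ] ℝ}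
    {H : Plane →L[ℝ] Plane →L[ℝ] ℝ} {K : ℝ} (hv : RegularCost v Dv H K) (r s : Plane) :
    |v r - v s| ≤ K * ‖r - s‖ := by
  have := Convex.norm_image_sub_le_of_norm_hasFDerivWithin_le (s := univ)
    (fun x _ => (hv.hasFDerivAt x).hasFDerivWithinAt) (fun x _ => hv.Dv_le x) convex_univ
    (mem_univ s) (mem_univ r)
  simpa using this

namespace Params

variable {P : Params} {v : Plane → ℝ} {Dv : Plane → Plane →L[ℝ] ℝ}
  {H : Plane →L[ℝ] Plane →L[ℝ] ℝ} {K T : ℝ}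

theorem abs_coords_le (x : State) (i : Fin 2) :
    |x.1 i| ≤ ‖x‖ ∧ |x.2.1 i| ≤ ‖x‖ ∧ |x.2.2.1 i| ≤ ‖x‖ ∧ |x.2.2.2 i| ≤ ‖x‖ :=
  ⟨(abs_coord_le _ i).trans (norm_fst_le x),
    (abs_coord_le _ i).trans ((norm_fst_le x.2).trans (norm_snd_le x)),
    (abs_coord_le _ i).trans ((norm_fst_le x.2.2).trans ((norm_snd_le x.2).trans (norm_snd_le x))),
    (abs_coord_le _ i).trans ((norm_snd_le x.2.2).trans ((norm_snd_le x.2).trans (norm_snd_le x)))⟩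

theorem norm_state_le (x : State) {B : ℝ}
    (h : ∀ i, |x.1 i| ≤ B ∧ |x.2.1 i| ≤ B ∧ |x.2.2.1 i| ≤ B ∧ |x.2.2.2 i| ≤ B) : ‖x‖ ≤ 2 * B := by
  have h0 := h 0
  have h1 := h 1
  rw [Prod.norm_def, Prod.norm_def, Prod.norm_def]
  refine max_le ?_ (max_le ?_ (max_le ?_ ?_)) <;>
  · refine (norm_le_sum_abs _).trans ?_
    linarith [h0.1, h0.2.1, h0.2.2.1, h0.2.2.2, h1.1, h1.2.1, h1.2.2.1, h1.2.2.2]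

/-- A bounded, globally Lipschitz field that agrees with the reduced field near the origin. -/
theorem exists_truncated_field (P : Params) (hv : RegularCost v Dv H K)
    (hper : ∀ i, Function.Periodic (fun τ : ℝ => sin (P.freq i * τ)) T) (a : Plane) (δ : ℝ) :
    ∃ (F : ℝ → State → State) (L M : NNReal), (∀ t, LipschitzWith L (F t)) ∧
      (∀ x, Continuous fun t => F t x) ∧ (∀ t x, ‖F t x‖ ≤ M) ∧ Function.Periodic F T ∧
      ∀ t x, ‖x‖ ≤ P.eps / 2 → F t x = P.costField v a δ t x := by
  have hε := P.eps_pos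
  set c := P.eps / 2 with hc
  have hc0 : 0 ≤ c := by positivity
  -- The block r needs no truncation because `v` is globally bounded and Lipschitz. Clipping m at
  -- ε/2 keeps m + ε ≥ ε/2, away from the singularity of the step size.
  let G : State → State := fun x => (x.1, WithLp.toLp 2 fun i => clip c (x.2.1 i),
    WithLp.toLp 2 fun i => clip c (x.2.2.1 i), WithLp.toLp 2 fun i => clip c (x.2.2.2 i))
  have hq : ∀ i, BddLip fun _ x => clip c (x.2.1 i) := fun i =>
    bddLip_clip hc0 fun x y => (abs_coords_le (x - y) i).2.1
  have hη : ∀ i, BddLip fun _ x => clip c (x.2.2.1 i) := fun i =>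
    bddLip_clip hc0 fun x y => (abs_coords_le (x - y) i).2.2.1
  have hm : ∀ i, BddLip fun _ x => clip c (x.2.2.2 i) := fun i =>
    bddLip_clip hc0 fun x y => (abs_coords_le (x - y) i).2.2.2
  have hcost : BddLip fun t x => v (x.1 + P.perturbation a t) := by
    refine ⟨⟨K, fun t x => hv.abs_le _, fun t x y => ?_⟩, fun x => ?_⟩
    · refine (hv.abs_sub_le _ _).trans ?_
      rw [add_sub_add_right_eq_sub]
      have := hv.one_le
      have h1 : ‖x.1 - y.1‖ ≤ ‖x - y‖ := norm_fst_le (x - y)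
      gcongr
    · have hvc : Continuous v := continuous_iff_continuousAt.2 fun r => (hv.hasFDerivAt r).continuousAt
      exact hvc.comp (continuous_const.add (P.continuous_perturbation a))
  have hsin : ∀ i, BddLip fun t _ => sin (P.freq i * t) := fun i =>
    bddLip_of_bounded (fun t => abs_sin_le_one _) (by fun_prop)
  have hinv : ∀ i, BddLip fun _ x => 1 / √(clip c (x.2.2.2 i) + P.eps) := by
    intro i
    have hlow : ∀ x, c ≤ clip c x + P.eps := fun x => by
      have : -c ≤ clip c x := le_max_left _ _
      linarith
    have hcp : 0 < c := by positivity
    refine ⟨⟨max (1 / √c) (1 / (c * √c)), fun t x => ?_, fun t x y => ?_⟩, fun _ => continuous_const⟩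
    · refine le_trans ?_ (le_max_left _ _)
      rw [abs_of_nonneg (by positivity)]
      exact one_div_le_one_div_of_le (Real.sqrt_pos.2 hcp) (Real.sqrt_le_sqrt (hlow _))
    · have h1 := abs_one_div_sqrt_sub_le hcp (hlow (x.2.2.2 i)) (hlow (y.2.2.2 i))
      rw [add_sub_add_right_eq_sub] at h1
      have h2 := (abs_clip_sub_le c (x.2.2.2 i) (y.2.2.2 i)).trans (abs_coords_le (x - y) i).2.2.2
      refine h1.trans ?_
      have h3 : 1 / (c * √c) ≤ max (1 / √c) (1 / (c * √c)) := le_max_right _ _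
      exact mul_le_mul h3 h2 (abs_nonneg _) (by positivity)
  have hr' : ∀ i, BddLip fun t x => (P.costField v a δ t (G x)).1 i := fun i => by
    have := (bddLip_const (-(δ * P.gain i))).mul ((hq i).mul (hinv i))
    refine (congrArg BddLip ?_).mp this
    funext t x
    simp only [G, costField, Prod.smul_fst, PiLp.smul_apply, smul_eq_mul]
    ring
  have hq' : ∀ i, BddLip fun t x => (P.costField v a δ t (G x)).2.1 i := fun i => by
    have := (bddLip_const (δ * P.lowPass i)).mul (((hcost.add (hη i).neg).mul (hsin i)).add (hq i).neg)
    refine (congrArg BddLip ?_).mp this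
    funext t x
    simp only [G, costField, Prod.smul_fst, Prod.smul_snd, PiLp.smul_apply, smul_eq_mul]
    ring
  have hη' : ∀ i, BddLip fun t x => (P.costField v a δ t (G x)).2.2.1 i := fun i => by
    have := (bddLip_const (δ * P.highPass i)).mul (hcost.add (hη i).neg)
    refine (congrArg BddLip ?_).mp this
    funext t x
    simp only [G, costField, Prod.smul_fst, Prod.smul_snd, PiLp.smul_apply, smul_eq_mul]
    ring
  have hm' : ∀ i, BddLip fun t x => (P.costField v a δ t (G x)).2.2.2 i := fun i => by
    have := (bddLip_const (δ * P.moment i)).mul ((hm i).neg.add ((hq i).mul (hq i)))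
    refine (congrArg BddLip ?_).mp this
    funext t x
    simp only [G, costField, Prod.smul_snd, PiLp.smul_apply, smul_eq_mul]
    ring
  choose B hB using fun i => (hr' i).1
  choose Bq hBq using fun i => (hq' i).1
  choose Be hBe using fun i => (hη' i).1
  choose Bm hBm using fun i => (hm' i).1
  obtain ⟨M, hM0, hM⟩ : ∃ M ≥ 0, ∀ i, B i ≤ M ∧ Bq i ≤ M ∧ Be i ≤ M ∧ Bm i ≤ M := by
    refine ⟨∑ i, (|B i| + |Bq i| + |Be i| + |Bm i|), by positivity, fun i => ?_⟩
    have := Finset.single_le_sum (f := fun i => |B i| + |Bq i| + |Be i| + |Bm i|)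
      (fun i _ => by positivity) (Finset.mem_univ i)
    have := le_abs_self (B i)
    have := le_abs_self (Bq i)
    have := le_abs_self (Be i)
    have := le_abs_self (Bm i)
    have := abs_nonneg (B i)
    have := abs_nonneg (Bq i)
    have := abs_nonneg (Be i)
    have := abs_nonneg (Bm i)
    refine ⟨?_, ?_, ?_, ?_⟩ <;> linarith
  refine ⟨fun t x => P.costField v a δ t (G x), ⟨2 * M, by positivity⟩, ⟨2 * M, by positivity⟩,
    fun t => ?_, fun x => ?_, fun t x => ?_, fun t => ?_, fun t x hx => ?_⟩
  · refine LipschitzWith.of_dist_le_mul fun x y => ?_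
    rw [dist_eq_norm, dist_eq_norm]
    have := norm_state_le (P.costField v a δ t (G x) - P.costField v a δ t (G y))
      (B := M * ‖x - y‖) fun i => ⟨?_, ?_, ?_, ?_⟩
    · exact this.trans_eq (by rw [← mul_assoc]; rfl)
    · exact ((hB i).2 t x y).trans (mul_le_mul_of_nonneg_right (hM i).1 (norm_nonneg _))
    · exact ((hBq i).2 t x y).trans (mul_le_mul_of_nonneg_right (hM i).2.1 (norm_nonneg _))
    · exact ((hBe i).2 t x y).trans (mul_le_mul_of_nonneg_right (hM i).2.2.1 (norm_nonneg _))
    · exact ((hBm i).2 t x y).trans (mul_le_mul_of_nonneg_right (hM i).2.2.2 (norm_nonneg _))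
  · have hpl : ∀ f : ℝ → Plane, (∀ i, Continuous fun t => f t i) → Continuous f := fun f hf =>
      (PiLp.continuous_toLp 2 (fun _ : Fin 2 => ℝ)).comp (continuous_pi hf)
    exact (hpl _ fun i => (hr' i).2 x).prodMk ((hpl _ fun i => (hq' i).2 x).prodMk
      ((hpl _ fun i => (hη' i).2 x).prodMk (hpl _ fun i => (hm' i).2 x)))
  · exact norm_state_le _ fun i => ⟨((hB i).1 t x).trans (hM i).1, ((hBq i).1 t x).trans (hM i).2.1,
      ((hBe i).1 t x).trans (hM i).2.2.1, ((hBm i).1 t x).trans (hM i).2.2.2⟩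
  · funext x
    have hs : ∀ i, sin (P.freq i * (t + T)) = sin (P.freq i * t) := fun i => hper i t
    simp only [costField, hs, periodic_perturbation a hper t]
  · have hG : G x = x := by
      have hi := fun i => abs_coords_le x i
      refine Prod.ext rfl (Prod.ext ?_ (Prod.ext ?_ ?_))
      · ext i; exact clip_eq ((hi i).2.1.trans hx)
      · ext i; exact clip_eq ((hi i).2.2.1.trans hx)
      · ext i; exact clip_eq ((hi i).2.2.2.trans hx)
    simp only [hG]

end Params
end ExtremumSeeking
end

/-! ### Comparison of original and shifted coordinates; periodicity and continuity. -/

noncomputable section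
namespace ExtremumSeeking
open Set Real
namespace Params

variable {P : Params} {c : ℝ} {v : Plane → ℝ} {Dv : Plane → Plane →L[ℝ] ℝ}
  {H : Plane →L[ℝ] Plane →L[ℝ] ℝ} {K T : ℝ}

/-- All time-dependent corrections cancel in a difference; only the cost difference in the η block
remains. Hence `shift` is bi-Lipschitz with constants independent of amplitude, time scale and time.
-/
theorem shift_sub_shift (a : Plane) (δ τ : ℝ) (z w : State) :
    P.shift v H a δ τ z - P.shift v H a δ τ w = (z.1 - w.1, z.2.1 - w.2.1,
      z.2.2.1 - w.2.2.1 - (v z.1 - v w.1) • (unitVec 0 + unitVec 1), z.2.2.2 - w.2.2.2) := by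
  refine Prod.ext rfl (Prod.ext ?_ (Prod.ext ?_ rfl))
  · ext i
    simp [shift]
  · ext i
    fin_cases i <;> simp [shift] <;> ring

theorem norm_smul_unitVec_add_le (x : ℝ) : ‖x • (unitVec 0 + unitVec 1 : Plane)‖ ≤ 2 * |x| := by
  rw [norm_smul, Real.norm_eq_abs, mul_comm]
  gcongr
  refine (norm_add_le _ _).trans_eq ?_
  rw [norm_unitVec, norm_unitVec]
  norm_num

theorem norm_shift_sub_le (hv : RegularCost v Dv H K) (a : Plane) (δ τ : ℝ) (z w : State) :
    ‖P.shift v H a δ τ z - P.shift v H a δ τ w‖ ≤ (1 + 2 * K) * ‖z - w‖ := by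
  have hK := hv.one_le
  have n1 : ‖z.1 - w.1‖ ≤ ‖z - w‖ := norm_fst_le (z - w)
  have n0 : ‖z.2 - w.2‖ ≤ ‖z - w‖ := norm_snd_le (z - w)
  have n2 : ‖z.2.1 - w.2.1‖ ≤ ‖z - w‖ := (norm_fst_le (z.2 - w.2)).trans n0
  have n3 : ‖z.2.2 - w.2.2‖ ≤ ‖z - w‖ := (norm_snd_le (z.2 - w.2)).trans n0
  have n4 : ‖z.2.2.1 - w.2.2.1‖ ≤ ‖z - w‖ := (norm_fst_le (z.2.2 - w.2.2)).trans n3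
  have n5 : ‖z.2.2.2 - w.2.2.2‖ ≤ ‖z - w‖ := (norm_snd_le (z.2.2 - w.2.2)).trans n3
  have h0 : 0 ≤ 2 * K * ‖z - w‖ := by positivity
  have h1 := hv.abs_sub_le z.1 w.1
  have h2 := norm_smul_unitVec_add_le (v z.1 - v w.1)
  have h3 := norm_sub_le (z.2.2.1 - w.2.2.1) ((v z.1 - v w.1) • (unitVec 0 + unitVec 1))
  have h4 := mul_le_mul_of_nonneg_left n1 (by linarith : 0 ≤ K)
  rw [shift_sub_shift, Prod.norm_def, Prod.norm_def, Prod.norm_def]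
  refine max_le ?_ (max_le ?_ (max_le ?_ ?_)) <;> simp only <;> linarith

theorem norm_sub_le_shift (hv : RegularCost v Dv H K) (a : Plane) (δ τ : ℝ) (z w : State) :
    ‖z - w‖ ≤ (1 + 2 * K) * ‖P.shift v H a δ τ z - P.shift v H a δ τ w‖ := by
  have hK := hv.one_le
  have he := shift_sub_shift (P := P) (v := v) (H := H) a δ τ z w
  set D := P.shift v H a δ τ z - P.shift v H a δ τ w
  have n1 : ‖D.1‖ ≤ ‖D‖ := norm_fst_le D
  have n0 : ‖D.2‖ ≤ ‖D‖ := norm_snd_le D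
  have n2 : ‖D.2.1‖ ≤ ‖D‖ := (norm_fst_le D.2).trans n0
  have n3 : ‖D.2.2‖ ≤ ‖D‖ := (norm_snd_le D.2).trans n0
  have n4 : ‖D.2.2.1‖ ≤ ‖D‖ := (norm_fst_le D.2.2).trans n3
  have n5 : ‖D.2.2.2‖ ≤ ‖D‖ := (norm_snd_le D.2.2).trans n3
  have h0 : 0 ≤ 2 * K * ‖D‖ := by positivity
  have e1 : z.1 - w.1 = D.1 := by rw [he]
  have e2 : z.2.1 - w.2.1 = D.2.1 := by rw [he]
  have e3 : z.2.2.1 - w.2.2.1 = D.2.2.1 + (v z.1 - v w.1) • (unitVec 0 + unitVec 1) := by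
    rw [he]; exact (sub_add_cancel _ _).symm
  have e4 : z.2.2.2 - w.2.2.2 = D.2.2.2 := by rw [he]
  have h1 := hv.abs_sub_le z.1 w.1
  rw [e1] at h1
  have h2 := norm_smul_unitVec_add_le (v z.1 - v w.1)
  have h3 := norm_add_le D.2.2.1 ((v z.1 - v w.1) • (unitVec 0 + unitVec 1))
  have h4 := mul_le_mul_of_nonneg_left n1 (by linarith : 0 ≤ K)
  rw [Prod.norm_def, Prod.norm_def, Prod.norm_def]
  simp only [Prod.fst_sub, Prod.snd_sub, e1, e2, e3, e4]
  refine max_le ?_ (max_le ?_ (max_le ?_ ?_)) <;> linarith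

/-- The subtracted terms `meanQuad`, `intQuad` and `intCubic` are quadratic in `a`, and v(r) is at
most K‖r‖. The second bound serves uniqueness: it transfers a bound on q to the shifted q. -/
theorem exists_norm_le_shift (P : Params) (hv : RegularCost v Dv H K) (hT : 0 < T)
    (hper : ∀ i, Function.Periodic (fun τ : ℝ => sin (P.freq i * τ)) T) :
    ∃ C ≥ 1, ∀ (a : Plane) (δ τ : ℝ) (z : State), 0 ≤ δ → δ ≤ 1 →
      ‖z‖ ≤ C * (‖P.shift v H a δ τ z‖ + ‖a‖ ^ 2) ∧
      ‖(P.shift v H a δ τ z).2.1‖ ≤ ‖z.2.1‖ + C * ‖a‖ ^ 2 := by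
  have hK := hv.one_le
  obtain ⟨C₁, hC₁⟩ := P.exists_abs_intQuad_le
  set Q := |C₁| * K
  have hq : ∀ a τ, |P.intQuad H a τ| ≤ Q * ‖a‖ ^ 2 := fun a τ => by
    refine (hC₁ H a τ).trans ?_
    have h1 := mul_le_mul (le_abs_self C₁) hv.H_le (by positivity) (abs_nonneg _)
    exact mul_le_mul_of_nonneg_right h1 (by positivity)
  have hb : ∀ a, |meanQuad H a| ≤ K * ‖a‖ ^ 2 := fun a => by
    refine (abs_meanQuad_le H a).trans ?_
    have := hv.H_le
    gcongr
  have hcu : ∀ a i τ, |P.intCubic H a i τ| ≤ 2 * K * T * ‖a‖ ^ 2 := fun a i τ => by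
    refine ((periodic_intCubic_and_bound H a hT hper i).2 τ).trans ?_
    have := hv.H_le
    calc 2 * ‖H‖ * ‖a‖ ^ 2 * T ≤ 2 * K * ‖a‖ ^ 2 * T := by gcongr
      _ = _ := by ring
  set l := P.lowPass 0 + P.lowPass 1
  set h := P.highPass 0 + P.highPass 1
  have hl : ∀ i, P.lowPass i ≤ l := fun i => by
    have := P.lowPass_pos 0; have := P.lowPass_pos 1
    fin_cases i <;> simp [l] <;> linarith
  have hh : ∀ i, P.highPass i ≤ h := fun i => by
    have := P.highPass_pos 0; have := P.highPass_pos 1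
    fin_cases i <;> simp [h] <;> linarith
  have hl0 : 0 ≤ l := (P.lowPass_pos 0).le.trans (hl 0)
  have hh0 : 0 ≤ h := (P.highPass_pos 0).le.trans (hh 0)
  have hQ0 : 0 ≤ Q := by positivity
  set C := 2 * (1 + 2 * K + K + l * (2 * K * T) + h * Q)
  have hlt : 0 ≤ l * (2 * K * T) := by positivity
  have hhq : 0 ≤ h * Q := by positivity
  refine ⟨C, by simp only [C]; linarith, fun a δ τ z hδ hδ1 => ?_⟩
  set u := P.shift v H a δ τ z
  have n := fun i => abs_coords_le u i
  have hlc : ∀ i, |δ * P.lowPass i * P.intCubic H a i τ| ≤ l * (2 * K * T) * ‖a‖ ^ 2 := fun i => by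
    rw [abs_mul, abs_mul, abs_of_nonneg hδ, abs_of_pos (P.lowPass_pos i)]
    calc δ * P.lowPass i * |P.intCubic H a i τ| ≤ 1 * l * (2 * K * T * ‖a‖ ^ 2) := by
          have := (P.lowPass_pos i).le
          gcongr
          · exact hl i
          · exact hcu a i τ
      _ = _ := by ring
  have hhc : ∀ i, |δ * P.highPass i * P.intQuad H a τ| ≤ h * Q * ‖a‖ ^ 2 := fun i => by
    rw [abs_mul, abs_mul, abs_of_nonneg hδ, abs_of_pos (P.highPass_pos i)]
    calc δ * P.highPass i * |P.intQuad H a τ| ≤ 1 * h * (Q * ‖a‖ ^ 2) := by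
          have := (P.highPass_pos i).le
          gcongr
          · exact hh i
          · exact hq a τ
      _ = _ := by ring
  have hvz : |v z.1| ≤ K * ‖u‖ := by
    have h1 := hv.abs_sub_le z.1 0
    rw [hv.v_zero, sub_zero, sub_zero] at h1
    exact h1.trans (mul_le_mul_of_nonneg_left (norm_fst_le u) (by linarith))
  constructor
  · have hx : 2 * ((1 + K) * ‖u‖ + (K + l * (2 * K * T) + h * Q) * ‖a‖ ^ 2)
        ≤ C * (‖u‖ + ‖a‖ ^ 2) := by
      simp only [C]
      have := norm_nonneg u
      have : 0 ≤ K * ‖u‖ := by positivity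
      have : 0 ≤ l * (2 * K * T) * ‖u‖ := by positivity
      have : 0 ≤ h * Q * ‖u‖ := by positivity
      have : 0 ≤ K * ‖a‖ ^ 2 := by positivity
      have : 0 ≤ ‖a‖ ^ 2 := by positivity
      linarith
    refine (norm_state_le z fun i => ?_).trans hx
    have hu0 : 0 ≤ K * ‖u‖ := by positivity
    have ha0 : 0 ≤ K * ‖a‖ ^ 2 := by positivity
    have ha1 : 0 ≤ l * (2 * K * T) * ‖a‖ ^ 2 := by positivity
    have ha2 : 0 ≤ h * Q * ‖a‖ ^ 2 := by positivity
    obtain ⟨n1, n2, n3, n4⟩ := n i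
    have e2 : z.2.1 i = u.2.1 i + δ * P.lowPass i * P.intCubic H a i τ := by
      simp [u, shift]
    have e3 : z.2.2.1 i = u.2.2.1 i + v z.1 + meanQuad H a + δ * P.highPass i * P.intQuad H a τ := by
      simp only [u, shift]
      ring
    have hz1 : |z.1 i| ≤ ‖u‖ := n1
    have hz4 : |z.2.2.2 i| ≤ ‖u‖ := n4
    have hz2 : |z.2.1 i| ≤ ‖u‖ + l * (2 * K * T) * ‖a‖ ^ 2 := by
      rw [e2]
      exact (abs_add_le _ _).trans (add_le_add n2 (hlc i))
    have hz3 : |z.2.2.1 i| ≤ ‖u‖ + K * ‖u‖ + K * ‖a‖ ^ 2 + h * Q * ‖a‖ ^ 2 := by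
      rw [e3]
      refine (abs_add_le _ _).trans (add_le_add ((abs_add_le _ _).trans (add_le_add
        ((abs_add_le _ _).trans (add_le_add n3 hvz)) (hb a))) (hhc i))
    refine ⟨?_, ?_, ?_, ?_⟩ <;> linarith
  · have e : u.2.1 = z.2.1 - WithLp.toLp 2 fun i => δ * P.lowPass i * P.intCubic H a i τ := by
      ext i; simp [u, shift]
    rw [e]
    refine (norm_sub_le _ _).trans (add_le_add le_rfl ((norm_le_sum_abs _).trans ?_))
    have h0 := hlc 0
    have h1 := hlc 1
    have : 0 ≤ K * ‖a‖ ^ 2 := by positivity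
    have : 0 ≤ ‖a‖ ^ 2 := by positivity
    have : 0 ≤ h * Q * ‖a‖ ^ 2 := by positivity
    simp only [C]
    linarith

theorem periodic_shift (hT : 0 < T)
    (hper : ∀ i, Function.Periodic (fun τ : ℝ => sin (P.freq i * τ)) T) (a : Plane) (δ : ℝ) :
    Function.Periodic (P.shift v H a δ) T := fun τ => by
  have h1 : ∀ i, P.intCubic H a i (τ + T) = P.intCubic H a i τ := fun i =>
    (periodic_intCubic_and_bound H a hT hper i).1 τ
  funext z
  simp only [shift, h1, periodic_intQuad H a hper τ]

theorem periodic_lyap (hper : ∀ i, Function.Periodic (fun τ : ℝ => sin (P.freq i * τ)) T)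
    (a : Plane) (δ ϑ ν : ℝ) : Function.Periodic (P.lyap H a δ ϑ ν) T := fun τ => by
  have hf : ∀ D, P.fast H a δ (τ + T) D = P.fast H a δ τ D := fun D => by
    have h1 : ∀ i j, P.sinSin i j (τ + T) = P.sinSin i j τ := fun i j => periodic_sinSin hper i j τ
    have h2 : ∀ i, cos (P.freq i * (τ + T)) = cos (P.freq i * τ) := fun i =>
      periodic_cos_of_periodic_sin (P.freq_pos i) (hper i) τ
    simp only [fast, intLin, h1, h2]
  funext D
  simp only [lyap, slow, hf]

theorem continuous_lyap (a : Plane) (δ ϑ ν τ : ℝ) : Continuous (P.lyap H a δ ϑ ν τ) := by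
  have hpl : ∀ f : State → Plane, (∀ i, Continuous fun t => f t i) → Continuous f := fun f hf =>
    (PiLp.continuous_toLp 2 (fun _ : Fin 2 => ℝ)).comp (continuous_pi hf)
  have hf : Continuous (P.fast H a δ τ) := hpl _ fun i => by
    simp only [fast, intLin]
    fun_prop
  have hs : Continuous (P.slow H a δ τ) := hpl _ fun i => by
    have hi : Continuous fun D => P.fast H a δ τ D i :=
      (EuclideanSpace.proj (𝕜 := ℝ) i).continuous.comp hf
    have h1 : Continuous fun D : State => D.1 i :=
      (EuclideanSpace.proj (𝕜 := ℝ) i).continuous.comp continuous_fst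
    exact h1.sub (hi.const_mul _)
  unfold lyap fastSq
  fun_prop

theorem continuous_shift (hv : RegularCost v Dv H K) (a : Plane) (δ τ : ℝ) :
    Continuous (P.shift v H a δ τ) := by
  have hK := hv.one_le
  refine (LipschitzWith.of_dist_le_mul (K := ⟨1 + 2 * K, by linarith⟩) fun z w => ?_).continuous
  rw [dist_eq_norm, dist_eq_norm]
  exact norm_shift_sub_le hv a δ τ z w

theorem exists_hasDerivWithinAt_lyap_shift (hv : RegularCost v Dv H K) (a : Plane)
    {δ ϑ ν τ : ℝ} (hν : 0 < ν) {z : ℝ → State} {z' : State} {s : Set ℝ}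
    (hz : HasDerivWithinAt z z' s τ) :
    ∃ f', HasDerivWithinAt (fun t => P.lyap H a δ ϑ ν t (P.shift v H a δ t (z t))) f' s τ := by
  have h1 := hasDerivWithinAt_shift (P := P) (H := H) (a := a) (δ := δ) hv.hasFDerivAt hz
  have h2 := hasDerivWithinAt_fast (P := P) (H := H) (a := a) (δ := δ) h1
  have h3 := hasDerivWithinAt_slow h1 h2
  exact ⟨_, hasDerivWithinAt_lyap hv hν h3 h2 h1.snd.snd.fst h1.snd.snd.snd⟩

end Params
end ExtremumSeeking
end

/-! ### Contraction and trapping sets. -/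

noncomputable section
namespace ExtremumSeeking
open Set Real
namespace Params

variable {P : Params} {c : ℝ} {v : Plane → ℝ} {Dv : Plane → Plane →L[ℝ] ℝ}
  {H : Plane →L[ℝ] Plane →L[ℝ] ℝ} {K T : ℝ}

/-- Solutions in the region approach each other exponentially with rate `lam`. -/
def Contracts (P : Params) (v : Plane → ℝ) (H : Plane →L[ℝ] Plane →L[ℝ] ℝ) (c : ℝ) (a : Plane)
    (δ ρ B lam : ℝ) : Prop :=
  ∀ (z₁ z₂ : ℝ → State) (s : ℝ),
    (∀ t ∈ Ici s, HasDerivWithinAt z₁ (P.costField v a δ t (z₁ t)) (Ici s) t) →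
    (∀ t ∈ Ici s, HasDerivWithinAt z₂ (P.costField v a δ t (z₂ t)) (Ici s) t) →
    (∀ t ∈ Ici s, P.shift v H a δ t (z₁ t) ∈ region c a ρ) →
    (∀ t ∈ Ici s, P.shift v H a δ t (z₂ t) ∈ region c a ρ) →
    ∀ t ∈ Ici s, ‖z₁ t - z₂ t‖ ≤ B * exp (-lam * (t - s)) * ‖z₁ s - z₂ s‖

/-- The sublevel sets of `W` at levels `R` and `R'` are forward invariant for every field that agrees
with the reduced field near the origin, and lie well inside the region. -/
structure IsTrapping (P : Params) (v : Plane → ℝ) (H : Plane →L[ℝ] Plane →L[ℝ] ℝ) (c T : ℝ)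
    (a : Plane) (δ ρ A : ℝ) (W : ℝ → State → ℝ) (R R' d : ℝ) : Prop where
  dist_pos : 0 < d
  level_le : R ≤ R'
  periodic : Function.Periodic W T
  continuous : ∀ τ, Continuous (W τ)
  nonempty : ∃ z, W 0 z ≤ R
  bound_lt : A * (δ + ‖a‖ ^ 2) < ρ
  norm_le : ∀ τ z, W τ z ≤ R' → ‖z‖ ≤ A * (δ + ‖a‖ ^ 2)
  mem_region : ∀ τ z, W τ z ≤ R' → P.shift v H a δ τ z ∈ region c a ρ
  near : ∀ τ z w, W τ z ≤ R → ‖w - z‖ < d → W τ w ≤ R'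
  invariant : ∀ (F : ℝ → State → State) (z : ℝ → State) (r s t : ℝ),
    (∀ τ x, ‖x‖ < ρ → F τ x = P.costField v a δ τ x) → (∀ τ, HasDerivAt z (F τ (z τ)) τ) →
    R ≤ r → r ≤ R' → s ≤ t → W s (z s) ≤ r → W t (z t) ≤ r

/-- For each ν the comparison lemma gives exponential decay up to an error proportional to ν. Since
the solutions do not depend on ν, the error disappears as ν tends to 0; norm equivalence and the
bi-Lipschitz shift do the rest. -/
theorem contracts_of_lyap_estimate (hv : RegularCost v Dv H K) {a : Plane} {δ ρ ϑ k C C₁ C₂ : ℝ}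
    (hδ : 0 < δ) (ha : 0 < ‖a‖) (hϑ : 0 < ϑ) (hk : 0 < k) (hC : 0 ≤ C) (hC₁ : 1 ≤ C₁) (hC₂ : 1 ≤ C₂)
    (hest : ∀ ν > 0, ∀ (τ : ℝ) (s : Set ℝ) (z₁ z₂ : ℝ → State),
      HasDerivWithinAt z₁ (P.costField v a δ τ (z₁ τ)) s τ →
      HasDerivWithinAt z₂ (P.costField v a δ τ (z₂ τ)) s τ →
      P.shift v H a δ τ (z₁ τ) ∈ region c a ρ → P.shift v H a δ τ (z₂ τ) ∈ region c a ρ →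
      ∃ f', HasDerivWithinAt (fun t => P.lyap H a δ ϑ ν t
          (P.shift v H a δ t (z₁ t) - P.shift v H a δ t (z₂ t))) f' s τ ∧
        f' ≤ δ * (-(k * ‖a‖) * P.lyap H a δ ϑ ν τ
          (P.shift v H a δ τ (z₁ τ) - P.shift v H a δ τ (z₂ τ)) + C * ν))
    (hup : ∀ ν τ D, ‖D‖ ≤ C₁ * P.lyap H a δ ϑ ν τ D)
    (hlow : ∀ ν τ D, 0 ≤ ν → P.lyap H a δ ϑ ν τ D ≤ C₂ * ‖D‖ + (1 + ϑ) * ν) :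
    P.Contracts v H c a δ ρ ((1 + 2 * K) * (C₁ * (C₂ * (1 + 2 * K)))) (δ * (k * ‖a‖)) := by
  have hK := hv.one_le
  intro z₁ z₂ s hz₁ hz₂ hr₁ hr₂ t ht
  set D : ℝ → State := fun x => P.shift v H a δ x (z₁ x) - P.shift v H a δ x (z₂ x) with hD
  set lam := δ * (k * ‖a‖) with hlam
  have hlam0 : 0 < lam := by positivity
  have key : ∀ ν > 0, P.lyap H a δ ϑ ν t (D t)
      ≤ exp (-lam * (t - s)) * (P.lyap H a δ ϑ ν s (D s)) + C * ν / (k * ‖a‖) := by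
    intro ν hν
    have hd := fun x (hx : x ∈ Ici s) => hest ν hν x (Ici s) z₁ z₂
      (hz₁ x hx) (hz₂ x hx) (hr₁ x hx) (hr₂ x hx)
    choose! f' hf' hle using hd
    have := le_of_right_deriv_le_neg_mul_add (f := fun x => P.lyap H a δ ϑ ν x (D x)) (f' := f')
      (lam := lam) (c := C * ν / (k * ‖a‖)) ht
      (fun x hx => ((hf' x hx.1).continuousWithinAt).mono Icc_subset_Ici_self)
      (fun x hx => (hf' x hx.1).mono (Ici_subset_Ici.2 hx.1))
      (fun x hx => (hle x hx.1).trans_eq (by simp only [hlam, hD]; field_simp))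
    refine this.trans ?_
    have h1 : 0 ≤ exp (-lam * (t - s)) * (C * ν / (k * ‖a‖)) := by positivity
    linarith
  have hDt : ‖D t‖ ≤ C₁ * (C₂ * (exp (-lam * (t - s)) * ‖D s‖)) := by
    have hlim : ∀ ν > 0, ‖D t‖ ≤ C₁ * (C₂ * (exp (-lam * (t - s)) * ‖D s‖))
        + C₁ * (exp (-lam * (t - s)) * (1 + ϑ) + C / (k * ‖a‖)) * ν := by
      intro ν hν
      have h1 := hup ν t (D t)
      have h2 := hlow ν s (D s) hν.le
      have h3 := mul_le_mul_of_nonneg_left h2 (exp_pos (-lam * (t - s))).le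
      have h4 := mul_le_mul_of_nonneg_left ((key ν hν).trans (add_le_add h3 le_rfl))
        (by linarith : 0 ≤ C₁)
      refine h1.trans (h4.trans_eq ?_)
      ring
    refine le_of_forall_pos_le_add fun e he => ?_
    set M := C₁ * (exp (-lam * (t - s)) * (1 + ϑ) + C / (k * ‖a‖))
    have hM : 0 < M := by positivity
    have := hlim (e / M) (by positivity)
    rwa [mul_div_cancel₀ _ hM.ne'] at this
  have e1 := norm_sub_le_shift (P := P) hv a δ t (z₁ t) (z₂ t)
  have e2 := norm_shift_sub_le (P := P) hv a δ s (z₁ s) (z₂ s)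
  calc ‖z₁ t - z₂ t‖ ≤ (1 + 2 * K) * ‖D t‖ := e1
    _ ≤ (1 + 2 * K) * (C₁ * (C₂ * (exp (-lam * (t - s)) * ((1 + 2 * K) * ‖z₁ s - z₂ s‖)))) := by
      refine mul_le_mul_of_nonneg_left (hDt.trans ?_) (by linarith)
      gcongr
    _ = _ := by ring

-- With μ = ‖a‖² + δ‖a‖ the residual equals ‖a‖μ, whereas the decay at level r is k‖a‖r. The flow
-- therefore points strictly inward on every level between A₀μ and A₁μ.
set_option maxHeartbeats 400000 in
theorem exists_contracts_and_trapping (hv : RegularCost v Dv H K) (hc : 0 < c) (hT : 0 < T)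
    (hper : ∀ i, Function.Periodic (fun τ : ℝ => sin (P.freq i * τ)) T) {κ : ℝ} (hκ : 0 < κ) :
    ∃ k > 0, ∃ B ≥ 1, ∃ A ≥ 1, ∃ σ > 0, ∀ ρ > 0, ρ ≤ σ → ∃ β > 0, ∀ (a : Plane) (δ : ℝ),
      0 < ‖a‖ → ‖a‖ < β → (∀ i, κ * ‖a‖ ≤ a i) → 0 < δ → δ < β →
        P.Contracts v H c a δ ρ B (δ * (k * ‖a‖)) ∧
        ∃ W R R' d, P.IsTrapping v H c T a δ ρ A W R R' d := by
  obtain ⟨ϑ, hϑ, k, hk, C, hC, σ₀, hσ₀, hest⟩ := exists_lyap_estimates (P := P) hv hc.le hT hper hκ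
  obtain ⟨C₁, hC₁, hup⟩ := exists_norm_le_lyap P hv hϑ
  obtain ⟨C₂, hC₂, hlow⟩ := exists_lyap_le_norm P hv hϑ
  obtain ⟨C₃, hC₃, hsh⟩ := exists_norm_le_shift P hv hT hper
  have hK := hv.one_le
  have hε := P.eps_pos
  have hB1 : 1 ≤ (1 + 2 * K) * (C₁ * (C₂ * (1 + 2 * K))) := by
    have h1 : (1 : ℝ) ≤ 1 + 2 * K := by linarith
    have h2 : 1 ≤ C₂ * (1 + 2 * K) := one_le_mul_of_one_le_of_one_le hC₂ h1
    exact one_le_mul_of_one_le_of_one_le h1 (one_le_mul_of_one_le_of_one_le hC₁ h2)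
  -- The first summand beats residual plus smoothing, the second puts the shifted origin into the
  -- lower sublevel set, the last makes the inequality strict.
  set A₀ := 2 * C / k + (1 + ϑ) + 1 with hA₀
  have hA₀1 : 1 ≤ A₀ := by
    have : 0 ≤ 2 * C / k := by positivity
    linarith
  -- The upper level leaves room for all states within μ/(1+2K) of the lower sublevel set; this
  -- collar becomes the basin in the stability statement.
  set A₁ := C₂ * (C₁ * A₀ + 1) + (1 + ϑ) with hA₁
  have hA₀₁ : A₀ ≤ A₁ := by
    have h1 : A₀ ≤ C₁ * A₀ := le_mul_of_one_le_left (by linarith) hC₁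
    have h2 : C₁ * A₀ + 1 ≤ C₂ * (C₁ * A₀ + 1) := le_mul_of_one_le_left (by linarith) hC₂
    linarith
  set A₂ := C₁ * A₁ with hA₂
  have hA₂1 : 1 ≤ A₂ := one_le_mul_of_one_le_of_one_le hC₁ (by linarith)
  set A₃ := C₃ * (2 * A₂ + 1) with hA₃
  have hA₃1 : 1 ≤ A₃ := one_le_mul_of_one_le_of_one_le hC₃ (by linarith)
  refine ⟨k, hk, _, hB1, A₃, hA₃1, min (σ₀ / 2) (min 1 (P.eps / 2)), by positivity,
    fun ρ hρ hρσ => ?_⟩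
  have hρ1 : ρ ≤ σ₀ / 2 := hρσ.trans (min_le_left _ _)
  have hρ2 : ρ ≤ 1 := hρσ.trans ((min_le_right _ _).trans (min_le_left _ _))
  have hρ3 : ρ ≤ P.eps / 2 := hρσ.trans ((min_le_right _ _).trans (min_le_right _ _))
  -- The last two entries put the upper sublevel set inside the region, through A₂μ ≤ c‖a‖, and
  -- inside the ball, through A₃(δ + ‖a‖²) < ρ.
  refine ⟨min (min ρ (σ₀ / 2)) (min (c / (2 * A₂)) (ρ / (2 * A₃))), by positivity,
    fun a δ ha0 haβ hcone hδ0 hδβ => ?_⟩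
  set β := min (min ρ (σ₀ / 2)) (min (c / (2 * A₂)) (ρ / (2 * A₃)))
  have hβ1 : β ≤ ρ := (min_le_left _ _).trans (min_le_left _ _)
  have hβ2 : β ≤ σ₀ / 2 := (min_le_left _ _).trans (min_le_right _ _)
  have hβ3 : A₂ * (2 * β) ≤ c := by
    have : β ≤ c / (2 * A₂) := (min_le_right _ _).trans (min_le_left _ _)
    rw [le_div_iff₀ (by positivity)] at this
    linarith
  have hβ4 : A₃ * (2 * β) ≤ ρ := by
    have : β ≤ ρ / (2 * A₃) := (min_le_right _ _).trans (min_le_right _ _)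
    rw [le_div_iff₀ (by positivity)] at this
    linarith
  have hadm : ∀ τ, P.Admissible ⟨a, δ, ρ, τ⟩ := fun τ =>
    ⟨by simp only; linarith, hρ2, hρ3, hδ0.le, by simp only; linarith⟩
  have hσ : ρ + δ ≤ σ₀ := by linarith
  have ha1 : ‖a‖ ≤ 1 := by linarith
  have hδ1 : δ ≤ 1 := by linarith
  refine ⟨contracts_of_lyap_estimate hv hδ0 ha0 hϑ hk hC hC₁ hC₂
    (fun ν hν τ s => (hest a δ ρ τ (hadm τ) hσ hcone ν hν s).1)
    (fun ν τ D => hup a δ ν τ D ha1 hδ0.le hδ1)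
    (fun ν τ D hν => hlow a δ ν τ D ha1 hδ0.le hδ1 hν), ?_⟩
  set μ := ‖a‖ ^ 2 + δ * ‖a‖ with hμ
  have hμ0 : 0 < μ := by positivity
  -- The smoothing is taken of the same order as the residual, so it costs only a constant.
  set ν := ‖a‖ * μ with hν
  have hν0 : 0 < ν := by positivity
  have hνμ : ν ≤ μ := mul_le_of_le_one_left hμ0.le ha1
  have hμβ : μ ≤ 2 * β * ‖a‖ := by rw [hμ]; nlinarith
  have hμδ : μ ≤ 2 * (δ + ‖a‖ ^ 2) := by rw [hμ]; nlinarith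
  have hu : ∀ τ z, P.lyap H a δ ϑ ν τ (P.shift v H a δ τ z) ≤ A₁ * μ →
      ‖P.shift v H a δ τ z‖ ≤ A₂ * μ := fun τ z h => by
    have h1 := hup a δ ν τ (P.shift v H a δ τ z) ha1 hδ0.le hδ1
    have h2 := mul_le_mul_of_nonneg_left h (by linarith : 0 ≤ C₁)
    rw [hA₂, mul_assoc]
    exact h1.trans h2
  have hnorm : ∀ τ z, P.lyap H a δ ϑ ν τ (P.shift v H a δ τ z) ≤ A₁ * μ →
      ‖z‖ ≤ A₃ * (δ + ‖a‖ ^ 2) := fun τ z h => by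
    refine ((hsh a δ τ z hδ0.le hδ1).1).trans ?_
    rw [hA₃, mul_assoc]
    refine mul_le_mul_of_nonneg_left ?_ (by linarith)
    have h1 := (hu τ z h).trans (mul_le_mul_of_nonneg_left hμδ (by linarith))
    linarith
  have hbound : A₃ * (δ + ‖a‖ ^ 2) < ρ := by
    refine lt_of_lt_of_le ?_ hβ4
    refine mul_lt_mul_of_pos_left ?_ (by linarith)
    nlinarith
  have hnorm' : ∀ τ z, P.lyap H a δ ϑ ν τ (P.shift v H a δ τ z) ≤ A₁ * μ → ‖z‖ < ρ := fun τ z h =>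
    (hnorm τ z h).trans_lt hbound
  have hreg : ∀ τ z, P.lyap H a δ ϑ ν τ (P.shift v H a δ τ z) ≤ A₁ * μ →
      P.shift v H a δ τ z ∈ region c a ρ := fun τ z h => by
    have h1 := hu τ z h
    set u := P.shift v H a δ τ z
    have h2 : A₂ * μ ≤ c * ‖a‖ := by
      calc A₂ * μ ≤ A₂ * (2 * β * ‖a‖) := by gcongr
        _ = A₂ * (2 * β) * ‖a‖ := by ring
        _ ≤ c * ‖a‖ := by gcongr
    have hz := hnorm' τ z h
    refine ⟨(norm_fst_le z).trans hz.le, ?_, ?_⟩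
    · exact ((norm_fst_le u.2).trans (norm_snd_le u)).trans (h1.trans h2)
    · exact ((norm_snd_le z.2.2).trans ((norm_snd_le z.2).trans (norm_snd_le z))).trans hz.le
  refine ⟨fun τ z => P.lyap H a δ ϑ ν τ (P.shift v H a δ τ z), A₀ * μ, A₁ * μ, μ / (1 + 2 * K),
    ⟨by positivity, by gcongr, fun τ => ?_, fun τ => ?_, ?_, hbound, hnorm, hreg, ?_, ?_⟩⟩
  · funext z
    rw [periodic_shift hT hper, periodic_lyap hper]
  · exact (continuous_lyap a δ ϑ ν τ).comp (continuous_shift hv a δ τ)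
  · refine ⟨(0, WithLp.toLp 2 fun i => δ * P.lowPass i * P.intCubic H a i 0,
      WithLp.toLp 2 fun i => meanQuad H a + δ * P.highPass i * P.intQuad H a 0, 0), ?_⟩
    have h0 : P.shift v H a δ 0 (0, WithLp.toLp 2 fun i => δ * P.lowPass i * P.intCubic H a i 0,
        WithLp.toLp 2 fun i => meanQuad H a + δ * P.highPass i * P.intQuad H a 0, 0) = 0 := by
      refine Prod.ext rfl (Prod.ext ?_ (Prod.ext ?_ rfl))
      · ext i; simp [shift]
      · ext i; simp [shift, hv.v_zero]
    rw [h0]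
    have h1 := hlow a δ ν 0 0 ha1 hδ0.le hδ1 hν0.le
    rw [norm_zero, mul_zero, zero_add] at h1
    refine h1.trans ((mul_le_mul_of_nonneg_left hνμ (by linarith)).trans ?_)
    refine mul_le_mul_of_nonneg_right ?_ hμ0.le
    have : 0 ≤ 2 * C / k := by positivity
    linarith
  · intro τ z w hz hw
    have h1 : ‖P.shift v H a δ τ z‖ ≤ C₁ * (A₀ * μ) :=
      (hup a δ ν τ _ ha1 hδ0.le hδ1).trans (mul_le_mul_of_nonneg_left hz (by linarith))
    have h2 := norm_shift_sub_le (P := P) hv a δ τ w z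
    rw [lt_div_iff₀ (by linarith)] at hw
    have h3 : ‖P.shift v H a δ τ w‖ ≤ C₁ * (A₀ * μ) + μ := by
      have := norm_le_norm_add_norm_sub' (P.shift v H a δ τ w) (P.shift v H a δ τ z)
      linarith
    have h4 := hlow a δ ν τ (P.shift v H a δ τ w) ha1 hδ0.le hδ1 hν0.le
    have h5 := mul_le_mul_of_nonneg_left h3 (by linarith : 0 ≤ C₂)
    have h6 := mul_le_mul_of_nonneg_left hνμ (by linarith : 0 ≤ 1 + ϑ)
    refine h4.trans ((add_le_add h5 h6).trans_eq ?_)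
    rw [hA₁]
    ring
  · intro F z r s t hF hz hr hr' hst hs
    -- The comparison lemma asks for a derivative at all times but for its sign only on the level
    -- itself. There the state lies in the ball where `F` is the reduced field, so the decay
    -- estimate applies.
    have hd := fun x : ℝ => exists_hasDerivWithinAt_lyap_shift (P := P) (δ := δ) (ϑ := ϑ) hv a hν0
      (hz x).hasDerivWithinAt (s := univ)
    choose f' hf' using hd
    refine image_le_of_deriv_right_lt_deriv_boundary (a := s) (b := t) (f' := f') (B := fun _ => r)
      (B' := fun _ => 0) (fun x _ => ((hf' x).continuousWithinAt).mono (subset_univ _))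
      (fun x _ => (hf' x).mono (subset_univ _)) hs (fun x => hasDerivAt_const x r) ?_ ⟨hst, le_rfl⟩
    intro x _ hx
    have hxl : P.lyap H a δ ϑ ν x (P.shift v H a δ x (z x)) ≤ A₁ * μ := hx.le.trans hr'
    have hzx := (hz x).hasDerivWithinAt (s := univ)
    rw [hF x _ (hnorm' x _ hxl)] at hzx
    obtain ⟨g', hg', hle⟩ := (hest a δ ρ x (hadm x) hσ hcone ν hν0 univ).2 z hzx (hreg x _ hxl)
    have heq : f' x = g' := (uniqueDiffWithinAt_univ).eq_deriv _ (hf' x) hg'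
    rw [heq]
    refine hle.trans_lt ?_
    have hx' : P.lyap H a δ ϑ ν x (P.shift v H a δ x (z x)) = r := hx
    rw [hx']
    refine mul_neg_of_pos_of_neg hδ0 ?_
    have e1 : ‖a‖ ^ 3 + δ * ‖a‖ ^ 2 + ν = ‖a‖ * (2 * μ) := by rw [hν, hμ]; ring
    have e2 : k * (A₀ * μ) = 2 * C * μ + (1 + ϑ + 1) * (k * μ) := by
      rw [hA₀]; field_simp; ring
    have e3 : 0 < (1 + ϑ + 1) * (k * μ) := by positivity
    have e4 : k * (A₀ * μ) ≤ k * r := mul_le_mul_of_nonneg_left hr hk.le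
    rw [e1]
    have e5 : -(k * ‖a‖) * r + C * (‖a‖ * (2 * μ)) = ‖a‖ * (2 * C * μ - k * r) := by ring
    rw [e5]
    exact mul_neg_of_pos_of_neg ha0 (by linarith)

end Params
end ExtremumSeeking
end

/-! ### Existence and exponential stability of the periodic solution. -/

noncomputable section
namespace ExtremumSeeking
open Set Real
namespace Params

variable {P : Params} {c : ℝ} {v : Plane → ℝ} {Dv : Plane → Plane →L[ℝ] ℝ}
  {H : Plane →L[ℝ] Plane →L[ℝ] ℝ} {K T : ℝ}

theorem mem_domain_of_norm_lt {ρ : ℝ} (hρ : ρ ≤ P.eps / 2) {z : State} (hz : ‖z‖ < ρ) :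
    z ∈ P.domain := fun i => by
  have h1 := (abs_le.1 (abs_coords_le z i).2.2.2).1
  have := P.eps_pos
  linarith

theorem IsTrapping.norm_lt {a : Plane} {δ ρ A : ℝ} {W : ℝ → State → ℝ} {R R' d : ℝ}
    (h : P.IsTrapping v H c T a δ ρ A W R R' d) {τ : ℝ} {z : State} (hz : W τ z ≤ R') : ‖z‖ < ρ :=
  (h.norm_le τ z hz).trans_lt h.bound_lt

/-- Solutions are built for the truncated field, which has a global flow; the sublevel sets stay
where it agrees with `G`, so these are solutions for `G` too. For stability, an arbitrary solution
for `G` must first be identified with a truncated one before contraction can be applied. -/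
theorem IsTrapping.exists_stable_periodic {a : Plane} {δ ρ A B lam : ℝ} {W : ℝ → State → ℝ}
    {R R' d : ℝ} {G : ℝ → State → State} (h : P.IsTrapping v H c T a δ ρ A W R R' d)
    (hcon : P.Contracts v H c a δ ρ B lam) (hB : 0 < B) (hlam : 0 < lam)
    (hv : RegularCost v Dv H K) (hT : 0 < T)
    (hper : ∀ i, Function.Periodic (fun τ : ℝ => sin (P.freq i * τ)) T)
    (hρ : ρ ≤ P.eps / 2) (hG : ∀ τ x, ‖x‖ < ρ → G τ x = P.costField v a δ τ x) :
    ∃ z, IsPeriodicSolution G P.domain T z ∧ (∀ τ, ‖z τ‖ < ρ) ∧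
      (∀ τ, ‖z τ‖ ≤ A * (δ + ‖a‖ ^ 2)) ∧ (∀ τ, P.shift v H a δ τ (z τ) ∈ region c a ρ) ∧
      IsExponentiallyStable G P.domain z := by
  obtain ⟨F, L, M, hlip, hcont, hbdd, hFper, hF⟩ := exists_truncated_field P hv hper a δ
  have hF' : ∀ τ x, ‖x‖ < ρ → F τ x = P.costField v a δ τ x := fun τ x hx =>
    hF τ x (hx.le.trans hρ)
  have hGF : ∀ τ x, ‖x‖ < ρ → G τ x = F τ x := fun τ x hx => (hG τ x hx).trans (hF' τ x hx).symm
  have hsol : ∀ z : ℝ → State, (∀ t, HasDerivAt z (F t (z t)) t) → ∀ s, W s (z s) ≤ R' →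
      ∀ t ∈ Ici s, W t (z t) ≤ R' ∧ HasDerivWithinAt z (P.costField v a δ t (z t)) (Ici s) t := by
    intro z hz s hs t ht
    have hW := h.invariant F z R' s t hF' hz h.level_le le_rfl ht hs
    refine ⟨hW, ?_⟩
    rw [← hF' t _ (h.norm_lt hW)]
    exact (hz t).hasDerivWithinAt
  obtain ⟨z, hz, hzper, hzS⟩ := exists_periodic_solution_of_contracting hlip hcont hbdd hT hFper
    (S := fun t => {x | W t x ≤ R}) (fun t => by simp only [h.periodic t]) h.nonempty
    (isClosed_le (h.continuous 0) continuous_const)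
    (fun z hz h0 t ht => h.invariant F z R 0 t hF' hz le_rfl h.level_le ht h0) hlam
    (B := B) (fun z w hz hw hz0 hw0 t ht => by
      have hz' := hsol z hz 0 (le_trans hz0 h.level_le)
      have hw' := hsol w hw 0 (le_trans hw0 h.level_le)
      simpa using hcon z w 0 (fun t ht => (hz' t ht).2) (fun t ht => (hw' t ht).2)
        (fun t ht => h.mem_region t _ (hz' t ht).1) (fun t ht => h.mem_region t _ (hw' t ht).1) t ht)
  have hzW : ∀ t, W t (z t) ≤ R' := fun t => (hzS t).trans h.level_le
  have hzn : ∀ t, ‖z t‖ < ρ := fun t => h.norm_lt (hzW t)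
  refine ⟨z, ⟨fun t _ => ⟨mem_domain_of_norm_lt hρ (hzn t), ?_⟩, hzper⟩, hzn,
    fun t => h.norm_le t _ (hzW t), fun t => h.mem_region t _ (hzW t), ?_⟩
  · rw [hGF t _ (hzn t)]
    exact (hz t).hasDerivWithinAt
  -- The two levels are used here: the periodic orbit lies in the lower set, so data within `d` of
  -- it lie in the upper set, which is still invariant.
  refine ⟨d, h.dist_pos, B, hB, lam, hlam, fun τ₀ z₀ hz₀ => ?_⟩
  obtain ⟨w, hw0, hw⟩ := exists_solution_of_bounded_lipschitz hlip hcont hbdd τ₀ z₀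
  have hwW := hsol w hw τ₀ (by rw [hw0]; exact h.near τ₀ _ _ (hzS τ₀) hz₀)
  have hwG : ∀ t ∈ Ici τ₀, HasDerivWithinAt w (G t (w t)) (Ici τ₀) t := fun t ht => by
    rw [hG t _ (h.norm_lt (hwW t ht).1)]
    exact (hwW t ht).2
  refine ⟨⟨w, fun t ht => ⟨mem_domain_of_norm_lt hρ (h.norm_lt (hwW t ht).1), hwG t ht⟩, hw0⟩,
    fun y hy hy0 t ht => ?_⟩
  -- A tube of this radius around `w` stays in the open ball where `G` equals the Lipschitz field.
  have hgap : 0 < (ρ - A * (δ + ‖a‖ ^ 2)) / 2 := by linarith [h.bound_lt]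
  have heq : EqOn y w (Ici τ₀) := by
    refine eqOn_Ici_of_lipschitz_near (F := G) (K := L) hgap (fun t ht => (hy t ht).2) hwG
      (fun t ht x hx => ?_) (hy0.trans hw0.symm)
    have h1 := h.norm_le t _ (hwW t ht).1
    have h2 : ‖x‖ < ρ := by
      have := norm_le_norm_add_norm_sub' x (w t)
      linarith
    rw [hGF t x h2, hGF t _ (h.norm_lt (hwW t ht).1)]
    have := (hlip t).dist_le_mul x (w t)
    rwa [dist_eq_norm, dist_eq_norm] at this
  have hzW' := hsol z hz τ₀ (hzW τ₀)
  have := hcon w z τ₀ (fun t ht => (hwW t ht).2) (fun t ht => (hzW' t ht).2)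
    (fun t ht => h.mem_region t _ (hwW t ht).1) (fun t ht => h.mem_region t _ (hzW' t ht).1) t ht
  rw [heq ht]
  rwa [hw0] at this

end Params
end ExtremumSeeking
end

/-! ### A priori bounds for periodic solutions, and uniqueness. -/

noncomputable section
namespace ExtremumSeeking
open Set Real

theorem exists_isMaxOn_univ_of_periodic {f : ℝ → ℝ} {T : ℝ} (hT : 0 < T) (hf : Continuous f)
    (hper : Function.Periodic f T) : ∃ t, ∀ s, f s ≤ f t := by
  obtain ⟨t, -, ht⟩ := (isCompact_Icc (a := (0 : ℝ)) (b := T)).exists_isMaxOn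
    ⟨0, le_rfl, hT.le⟩ hf.continuousOn
  refine ⟨t, fun s => ?_⟩
  obtain ⟨y, hy, hys⟩ := hper.exists_mem_Ico₀ hT s
  rw [hys]
  exact ht (Ico_subset_Icc_self hy)

/-- At a maximum and at a minimum of the periodic function the derivative vanishes, so b f = g
there. The bound does not involve δ or the period. -/
theorem abs_le_of_periodic_linear_ode {f g : ℝ → ℝ} {T δ b G : ℝ} (hT : 0 < T) (hδ : 0 < δ)
    (hb : 0 < b) (hper : Function.Periodic f T)
    (hf : ∀ t, HasDerivAt f (δ * (-b * f t + g t)) t) (hg : ∀ t, |g t| ≤ b * G) (t : ℝ) :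
    |f t| ≤ G := by
  have hc : Continuous f := continuous_iff_continuousAt.2 fun t => (hf t).continuousAt
  have hzero : ∀ s, δ * (-b * f s + g s) = 0 → |f s| ≤ G := fun s hs => by
    have h1 : b * f s = g s := by
      have := (mul_eq_zero.1 hs).resolve_left hδ.ne'
      linarith
    have h2 := hg s
    rw [← h1, abs_mul, abs_of_pos hb] at h2
    exact le_of_mul_le_mul_left h2 hb
  obtain ⟨s, hs⟩ := exists_isMaxOn_univ_of_periodic hT hc hper
  obtain ⟨s', hs'⟩ := exists_isMaxOn_univ_of_periodic hT hc.neg (fun t => by simp [hper t])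
  have h1 := hzero s (IsLocalMax.hasDerivAt_eq_zero (Filter.Eventually.of_forall hs) (hf s))
  have h2 := hzero s' (IsLocalMin.hasDerivAt_eq_zero
    (Filter.Eventually.of_forall fun x => neg_le_neg_iff.1 (hs' x)) (hf s'))
  rw [abs_le] at h1 h2 ⊢
  exact ⟨h2.1.trans (neg_le_neg_iff.1 (hs' t)), (hs t).trans h1.2⟩

theorem abs_le_of_periodic_of_zero {f f' : ℝ → ℝ} {T D : ℝ} (hT : 0 < T)
    (hper : Function.Periodic f T) (hf : ∀ t, HasDerivAt f (f' t) t) (hD : ∀ t, |f' t| ≤ D)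
    {s : ℝ} (hs : f s = 0) (t : ℝ) : |f t| ≤ D * T := by
  obtain ⟨y, hy, hyt⟩ := hper.exists_mem_Ico hT t s
  rw [hyt]
  have h1 := Convex.norm_image_sub_le_of_norm_hasDerivWithin_le (s := univ)
    (fun x _ => (hf x).hasDerivWithinAt) (fun x _ => hD x) convex_univ (mem_univ s) (mem_univ y)
  rw [hs, sub_zero, Real.norm_eq_abs, Real.norm_eq_abs, abs_of_nonneg (sub_nonneg.2 hy.1)] at h1
  have hD0 : 0 ≤ D := (abs_nonneg _).trans (hD 0)
  exact h1.trans (mul_le_mul_of_nonneg_left (by linarith [hy.2]) hD0)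

/-- Apply the self-improving bound to the supremum; the crude bound `X₀` serves only to make it
finite. -/
theorem le_two_mul_of_forall_le_add_half {ι : Type*} {f : ι → ℝ} {X₀ b : ℝ} (h0 : ∀ i, f i ≤ X₀)
    (h : ∀ X, (∀ i, f i ≤ X) → ∀ i, f i ≤ b + X / 2) (i : ι) : f i ≤ 2 * b := by
  have hbdd : BddAbove (range f) := ⟨X₀, by rintro _ ⟨j, rfl⟩; exact h0 j⟩
  have : Nonempty ι := ⟨i⟩
  have h1 : ⨆ j, f j ≤ b + (⨆ j, f j) / 2 := ciSup_le (h _ fun j => le_ciSup hbdd j)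
  have h2 := le_ciSup hbdd i
  linarith

namespace Params

variable {P : Params} {c : ℝ} {v : Plane → ℝ} {Dv : Plane → Plane →L[ℝ] ℝ}
  {H : Plane →L[ℝ] Plane →L[ℝ] ℝ} {K T : ℝ}

theorem hasDerivAt_plane {f : ℝ → Plane} {f' : Plane} {τ : ℝ} (h : HasDerivAt f f' τ) (i : Fin 2) :
    HasDerivAt (fun t => f t i) (f' i) τ := by
  rw [← hasDerivWithinAt_univ] at h ⊢
  exact hasDerivWithinAt_plane.1 h i

/-- Periodic solutions near the origin have a gradient estimate `q` of the order of the amplitude. -/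
theorem exists_estimate_le_of_periodic (P : Params) (hv : RegularCost v Dv H K) (hT : 0 < T) :
    ∃ b ≥ 0, ∃ σ > 0, ∀ (a : Plane) (δ : ℝ) (z : ℝ → State), 0 < δ →
      (∀ τ, HasDerivAt z (P.costField v a δ τ (z τ)) τ) → Function.Periodic z T →
      (∀ τ, ‖z τ‖ ≤ σ) → ∀ τ, ‖(z τ).2.1‖ ≤ b * ‖a‖ := by
  have hK := hv.one_le
  have hε := P.eps_pos
  set D := (P.gain 0 + P.gain 1) / √(P.eps / 2) with hD
  have hs : 0 < √(P.eps / 2) := Real.sqrt_pos.2 (by positivity)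
  have hg0 := P.gain_pos 0
  have hg1 := P.gain_pos 1
  have hD0 : 0 < D := by positivity
  set N := 1 / P.highPass 0 + 1 / P.highPass 1 with hN
  have hh0 := P.highPass_pos 0
  have hh1 := P.highPass_pos 1
  have hN0 : 0 < N := by positivity
  have hNi : ∀ i, 1 ≤ P.highPass i * N := fun i => by
    have h1 : 1 / P.highPass i ≤ N := by
      have := one_div_pos.2 hh0
      have := one_div_pos.2 hh1
      fin_cases i <;> simp only [hN] <;> simp <;> positivity
    rw [div_le_iff₀ (P.highPass_pos i)] at h1
    linarith
  -- The second entry makes the feedback of q through the motion of r at most one half. The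
  -- bootstrap then gives 4K‖a‖ for each of the two coordinates.
  refine ⟨8 * K, by positivity, min (P.eps / 2) (1 / (2 * (K * D * N))), by positivity, ?_⟩
  intro a δ z hδ hz hper hσ
  set σ := min (P.eps / 2) (1 / (2 * (K * D * N)))
  have hσ1 : σ ≤ P.eps / 2 := min_le_left _ _
  have hσ2 : K * σ * D * N ≤ 1 / 2 := by
    have : σ ≤ 1 / (2 * (K * D * N)) := min_le_right _ _
    rw [le_div_iff₀ (by positivity)] at this
    linarith
  have hσ0 : 0 ≤ σ := (norm_nonneg _).trans (hσ 0)
  have hcost : ∀ τ, |v ((z τ).1 + P.perturbation a τ) - v (z τ).1| ≤ K * ‖a‖ := fun τ => by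
    have h1 := hv.abs_sub_le ((z τ).1 + P.perturbation a τ) (z τ).1
    rw [add_sub_cancel_left] at h1
    exact h1.trans (mul_le_mul_of_nonneg_left (P.norm_perturbation_le a τ) (by linarith))
  have hrate : ∀ X, (∀ x : ℝ × Fin 2, |(z x.1).2.1 x.2| ≤ X) → ∀ τ,
      ‖(WithLp.toLp 2 fun i => -(P.gain i * (z τ).2.1 i) / √((z τ).2.2.2 i + P.eps) : Plane)‖
        ≤ D * X := fun X hX τ => by
    have hX0 : 0 ≤ X := (abs_nonneg _).trans (hX (0, 0))
    have hi : ∀ i, |-(P.gain i * (z τ).2.1 i) / √((z τ).2.2.2 i + P.eps)|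
        ≤ P.gain i / √(P.eps / 2) * X := fun i => by
      have hm := (abs_le.1 ((abs_coords_le (z τ) i).2.2.2.trans (hσ τ))).1
      have hsq : √(P.eps / 2) ≤ √((z τ).2.2.2 i + P.eps) := Real.sqrt_le_sqrt (by linarith)
      rw [abs_div, abs_neg, abs_mul, abs_of_pos (P.gain_pos i), abs_of_nonneg (Real.sqrt_nonneg _),
        div_mul_eq_mul_div]
      have := P.gain_pos i
      have := hX (τ, i)
      gcongr
    refine (norm_le_sum_abs _).trans ((add_le_add (hi 0) (hi 1)).trans_eq ?_)
    rw [hD]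
    ring
  have hgrad : ∀ τ, ‖Dv (z τ).1‖ ≤ K * σ := fun τ => by
    have h1 := hv.Dv_lip (z τ).1 0
    rw [hv.Dv_zero, sub_zero, sub_zero] at h1
    exact h1.trans (mul_le_mul_of_nonneg_left ((norm_fst_le _).trans (hσ τ)) (by linarith))
  have h1 : ∀ τ, HasDerivAt (fun t => (z t).1) (P.costField v a δ τ (z τ)).1 τ := fun τ => (hz τ).fst
  have h2 : ∀ τ, HasDerivAt (fun t => (z t).2.1) (P.costField v a δ τ (z τ)).2.1 τ := fun τ =>
    (hz τ).snd.fst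
  have h3 : ∀ τ, HasDerivAt (fun t => (z t).2.2.1) (P.costField v a δ τ (z τ)).2.2.1 τ := fun τ =>
    (hz τ).snd.snd.fst
  have hstep : ∀ X, (∀ x : ℝ × Fin 2, |(z x.1).2.1 x.2| ≤ X) →
      ∀ x : ℝ × Fin 2, |(z x.1).2.1 x.2| ≤ 2 * K * ‖a‖ + X / 2 := by
    intro X hX
    have hX0 : 0 ≤ X := (abs_nonneg _).trans (hX (0, 0))
    -- Measured against the moving level v(r), the high-pass state is driven by a cost variation
    -- O(‖a‖) and by Dv(r') with a small gradient; neither involves the radius of the ball without a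
    -- factor ‖a‖ or `X`.
    have hzeta : ∀ i τ, |(z τ).2.2.1 i - v (z τ).1| ≤ K * ‖a‖ + X / 2 := by
      intro i
      refine abs_le_of_periodic_linear_ode (f := fun t => (z t).2.2.1 i - v (z t).1) hT hδ
        (P.highPass_pos i) (g := fun τ => P.highPass i *
          (v ((z τ).1 + P.perturbation a τ) - v (z τ).1) - Dv (z τ).1
          (WithLp.toLp 2 fun i => -(P.gain i * (z τ).2.1 i) / √((z τ).2.2.2 i + P.eps)))
        (fun t => by simp only [hper t]) (fun τ => ?_) (fun τ => ?_)
      · have e1 := ((hv.hasFDerivAt (z τ).1).comp_hasDerivAt τ (h1 τ))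
        refine ((hasDerivAt_plane (h3 τ) i).sub e1).congr_deriv ?_
        simp only [costField, Prod.smul_fst, Prod.smul_snd, PiLp.smul_apply, smul_eq_mul, map_smul]
        ring
      · have e1 := (Dv (z τ).1).le_opNorm
          (WithLp.toLp 2 fun i => -(P.gain i * (z τ).2.1 i) / √((z τ).2.2.2 i + P.eps))
        have e2 := mul_le_mul (hgrad τ) (hrate X hX τ) (norm_nonneg _) (by positivity)
        have e3 : K * σ * (D * X) ≤ P.highPass i * (X / 2) := by
          have e4 : K * σ * D * 1 ≤ K * σ * D * (P.highPass i * N) :=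
            mul_le_mul_of_nonneg_left (hNi i) (by positivity)
          have e5 := mul_le_mul_of_nonneg_left hσ2 (P.highPass_pos i).le
          have e6 : K * σ * D ≤ P.highPass i * (1 / 2) := by linarith
          have := mul_le_mul_of_nonneg_right e6 hX0
          linarith
        have e7 := mul_le_mul_of_nonneg_left (hcost τ) (P.highPass_pos i).le
        refine (abs_sub _ _).trans ?_
        rw [abs_mul, abs_of_pos (P.highPass_pos i), mul_add]
        rw [Real.norm_eq_abs] at e1
        exact add_le_add e7 (e1.trans (e2.trans e3))
    rintro ⟨τ, i⟩
    refine abs_le_of_periodic_linear_ode (f := fun t => (z t).2.1 i) hT hδ (P.lowPass_pos i)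
      (g := fun τ => P.lowPass i * (v ((z τ).1 + P.perturbation a τ) - (z τ).2.2.1 i)
        * sin (P.freq i * τ)) (fun t => by simp only [hper t]) (fun τ => ?_) (fun τ => ?_) τ
    · refine (hasDerivAt_plane (h2 τ) i).congr_deriv ?_
      simp only [costField, Prod.smul_fst, Prod.smul_snd, PiLp.smul_apply, smul_eq_mul]
      ring
    · rw [abs_mul, abs_mul, abs_of_pos (P.lowPass_pos i), mul_assoc]
      refine mul_le_mul_of_nonneg_left ?_ (P.lowPass_pos i).le
      have e1 : |v ((z τ).1 + P.perturbation a τ) - (z τ).2.2.1 i|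
          ≤ K * ‖a‖ + (K * ‖a‖ + X / 2) := by
        have e2 : v ((z τ).1 + P.perturbation a τ) - (z τ).2.2.1 i
          = (v ((z τ).1 + P.perturbation a τ) - v (z τ).1) - ((z τ).2.2.1 i - v (z τ).1) := by ring
        rw [e2]
        exact (abs_sub _ _).trans (add_le_add (hcost τ) (hzeta i τ))
      have e3 := mul_le_of_le_one_right (abs_nonneg (v ((z τ).1 + P.perturbation a τ) - (z τ).2.2.1 i))
        (abs_sin_le_one (P.freq i * τ))
      linarith
  intro τ
  have hfin := le_two_mul_of_forall_le_add_half (f := fun x : ℝ × Fin 2 => |(z x.1).2.1 x.2|)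
    (fun x => (abs_coords_le (z x.1) x.2).2.1.trans (hσ x.1)) hstep
  have f0 := hfin (τ, 0)
  have f1 := hfin (τ, 1)
  simp only at f0 f1
  have := norm_le_sum_abs (z τ).2.1
  linarith

/-- Two periodic solutions in the region of contraction coincide. -/
theorem Contracts.eq_of_periodic {a : Plane} {δ ρ B lam : ℝ} (hcon : P.Contracts v H c a δ ρ B lam)
    (hT : 0 < T) (hlam : 0 < lam) {z w : ℝ → State}
    (hz : ∀ τ, HasDerivAt z (P.costField v a δ τ (z τ)) τ)
    (hw : ∀ τ, HasDerivAt w (P.costField v a δ τ (w τ)) τ)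
    (hzp : Function.Periodic z T) (hwp : Function.Periodic w T)
    (hzr : ∀ τ, P.shift v H a δ τ (z τ) ∈ region c a ρ)
    (hwr : ∀ τ, P.shift v H a δ τ (w τ) ∈ region c a ρ) : z = w := by
  funext τ
  -- After n periods both solutions have returned, so their distance is bounded by an arbitrarily
  -- small multiple of itself.
  have h1 : ∀ n : ℕ, ‖z τ - w τ‖ ≤ B * exp (-lam * (n * T)) * ‖z τ - w τ‖ := fun n => by
    have := hcon z w τ (fun t _ => (hz t).hasDerivWithinAt) (fun t _ => (hw t).hasDerivWithinAt)
      (fun t _ => hzr t) (fun t _ => hwr t) (τ + n * T) (by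
        have : 0 ≤ n * T := by positivity
        simp only [mem_Ici]; linarith)
    rwa [hzp.nat_mul n τ, hwp.nat_mul n τ, add_sub_cancel_left] at this
  have h2 : Filter.Tendsto (fun n : ℕ => B * exp (-lam * (n * T)) * ‖z τ - w τ‖) Filter.atTop
      (nhds (B * 0 * ‖z τ - w τ‖)) := by
    refine Filter.Tendsto.mul_const _ (Filter.Tendsto.const_mul _ (Real.tendsto_exp_atBot.comp ?_))
    have h2 : Filter.Tendsto (fun n : ℕ => (n : ℝ) * T) Filter.atTop Filter.atTop :=
      tendsto_natCast_atTop_atTop.atTop_mul_const hT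
    exact h2.const_mul_atTop_of_neg (by linarith)
  rw [mul_zero, zero_mul] at h2
  have h3 : ‖z τ - w τ‖ ≤ 0 := ge_of_tendsto' h2 h1
  exact sub_eq_zero.1 (norm_le_zero_iff.1 h3)

/-- The filters of a periodic solution are of the order of the time scale. -/
theorem exists_filters_le_of_periodic (P : Params) (hv : RegularCost v Dv H K) (hT : 0 < T) :
    ∃ C ≥ 0, ∀ (a : Plane) (δ : ℝ) (z : ℝ → State), 0 < δ →
      (∀ τ, HasDerivAt z (P.costField v a δ τ (z τ)) τ) → Function.Periodic z T →
      (∀ τ, z τ ∈ P.domain) → (∀ τ, ‖z τ‖ ≤ 1) →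
      ∀ τ i, |(z τ).2.1 i| ≤ C * δ ∧ |(z τ).2.2.2 i| ≤ C * δ := by
  have hK := hv.one_le
  have hl0 := P.lowPass_pos 0
  have hl1 := P.lowPass_pos 1
  set l := P.lowPass 0 + P.lowPass 1 with hl
  have hli : ∀ i, P.lowPass i ≤ l := fun i => by
    fin_cases i <;> simp [hl] <;> linarith
  refine ⟨l * (K + 2) * T, by positivity, fun a δ z hδ hz hper hdom hn => ?_⟩
  have hq : ∀ τ i, |(z τ).2.1 i| ≤ l * (K + 2) * T * δ := by
    intro τ i
    have h1 : ∀ τ, HasDerivAt (fun t => (z t).1 i) ((P.costField v a δ τ (z τ)).1 i) τ := fun τ =>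
      hasDerivAt_plane (hz τ).fst i
    have h2 : ∀ τ, HasDerivAt (fun t => (z t).2.1 i) ((P.costField v a δ τ (z τ)).2.1 i) τ := fun τ =>
      hasDerivAt_plane (hz τ).snd.fst i
    obtain ⟨s, hs⟩ := exists_isMaxOn_univ_of_periodic hT
      (continuous_iff_continuousAt.2 fun t => (h1 t).continuousAt) (fun t => by simp only [hper t])
    have hs0 := IsLocalMax.hasDerivAt_eq_zero (Filter.Eventually.of_forall hs) (h1 s)
    -- At a maximum of r_i its rate vanishes, and this rate is a nonzero multiple of q_i on the
    -- domain.
    have hqs : (z s).2.1 i = 0 := by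
      have hpos := Real.sqrt_pos.2 (hdom s i)
      simp only [costField, Prod.smul_fst, PiLp.smul_apply, smul_eq_mul] at hs0
      simpa [hδ.ne', hpos.ne', (P.gain_pos i).ne'] using hs0
    -- The filter moves at speed O(δ), so starting from its zero it reaches only O(δ) within one
    -- period.
    have := abs_le_of_periodic_of_zero (D := δ * (l * (K + 2))) hT (f := fun t => (z t).2.1 i)
      (fun t => by simp only [hper t]) h2 (fun t => ?_) hqs τ
    · linarith
    · have e1 := (abs_coords_le (z t) i).2.1.trans (hn t)
      have e2 := (abs_coords_le (z t) i).2.2.1.trans (hn t)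
      have e3 := hv.abs_le ((z t).1 + P.perturbation a t)
      have e4 := (abs_sub (v ((z t).1 + P.perturbation a t)) ((z t).2.2.1 i)).trans (add_le_add e3 e2)
      have e5 := mul_le_of_le_one_right
        (abs_nonneg (v ((z t).1 + P.perturbation a t) - (z t).2.2.1 i)) (abs_sin_le_one (P.freq i * t))
      have e6 : (P.costField v a δ t (z t)).2.1 i = δ * (P.lowPass i *
          ((v ((z t).1 + P.perturbation a t) - (z t).2.2.1 i) * sin (P.freq i * t)
            - (z t).2.1 i)) := by
        simp only [costField, Prod.smul_fst, Prod.smul_snd, PiLp.smul_apply, smul_eq_mul]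
        ring
      rw [e6, abs_mul, abs_mul, abs_of_pos hδ, abs_of_pos (P.lowPass_pos i)]
      refine mul_le_mul_of_nonneg_left (mul_le_mul (hli i) ?_ (abs_nonneg _) (by positivity)) hδ.le
      refine (abs_sub _ _).trans ?_
      rw [abs_mul]
      linarith
  refine fun τ i => ⟨hq τ i, ?_⟩
  refine abs_le_of_periodic_linear_ode (f := fun t => (z t).2.2.2 i) hT hδ (P.moment_pos i)
    (g := fun t => P.moment i * (z t).2.1 i ^ 2) (fun t => by simp only [hper t]) (fun t => ?_)
    (fun t => ?_) τ
  · refine (hasDerivAt_plane (hz t).snd.snd.snd i).congr_deriv ?_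
    simp only [costField, Prod.smul_snd, PiLp.smul_apply, smul_eq_mul]
    ring
  · rw [abs_mul, abs_of_pos (P.moment_pos i), abs_pow]
    refine mul_le_mul_of_nonneg_left ?_ (P.moment_pos i).le
    have e1 := (abs_coords_le (z t) i).2.1.trans (hn t)
    have e2 := hq t i
    have e3 := mul_le_of_le_one_right (abs_nonneg ((z t).2.1 i)) e1
    rw [sq]
    linarith

end Params
end ExtremumSeeking
end

/-! ### Return to the original cost and choice of the constants. -/

noncomputable section
namespace ExtremumSeeking
open Set Real
namespace Params

theorem reducedField_eq_costField (P : Params) {h : Plane → ℝ} {l : Plane → Plane} {rstar : Plane}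
    {v : Plane → ℝ} {R : ℝ} (hR : ∀ x, ‖x‖ < R → v x = (h ∘ l) (rstar + x) - (h ∘ l) rstar)
    {a : Plane} {δ ρ : ℝ} (hρ : ρ + ‖a‖ ≤ R) (τ : ℝ) {z : State} (hz : ‖z‖ < ρ) :
    P.reducedField h l rstar a δ τ z = P.costField v a δ τ z := by
  have h1 : ‖z.1 + P.perturbation a τ‖ < R := by
    have := norm_add_le z.1 (P.perturbation a τ)
    have := P.norm_perturbation_le a τ
    have := norm_fst_le z
    linarith
  obtain ⟨r, q, η, m⟩ := z
  simp only [reducedField, costField, shiftedCost, hR _ h1]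

end Params
end ExtremumSeeking
end

open ExtremumSeeking in
theorem proposition1 (P : Params) (T : ℝ) (hT : P.IsLeastCommonPeriod T)
    (h : Plane → ℝ) (l : Plane → Plane) (rstar : Plane)
    (hsmooth : ContDiffAt ℝ ∞ (h ∘ l) rstar)
    (hmin : HasNondegenerateLocalMin (h ∘ l) rstar)
    (κ : ℝ) (hκ : 0 < κ) :
    ∃ abar > 0, ∃ δbar > 0, ∃ ρ > 0, ∃ C > 0,
      ∀ a : Plane, 0 < ‖a‖ → ‖a‖ < abar → (∀ i, κ * ‖a‖ ≤ a i) →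
      ∀ δ : ℝ, 0 < δ → δ < δbar →
        ∃ z : ℝ → State,
          IsPeriodicSolution (P.reducedField h l rstar a δ) P.domain T z ∧
          (∀ τ, ‖z τ‖ < ρ) ∧
          (∀ z' : ℝ → State,
            IsPeriodicSolution (P.reducedField h l rstar a δ) P.domain T z' →
            (∀ τ, ‖z' τ‖ < ρ) → z' = z) ∧
          IsExponentiallyStable (P.reducedField h l rstar a δ) P.domain z ∧
          ∀ τ i,
            |(z τ).1 i| ≤ C * (δ + ‖a‖ ^ 2) ∧
            |(z τ).2.1 i| ≤ C * δ ∧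
            |(z τ).2.2.1 i| ≤ C * (δ + ‖a‖ ^ 2) ∧
            |(z τ).2.2.2 i| ≤ C * δ := by
  obtain ⟨hT0, hper⟩ := hT.1
  obtain ⟨v, Dv, H, K, hv, R, hR0, hR⟩ := exists_regularCost hsmooth hmin
  obtain ⟨b, hb, σ₁, hσ₁, hest⟩ := Params.exists_estimate_le_of_periodic P hv hT0
  obtain ⟨C₃, hC₃, hsh⟩ := Params.exists_norm_le_shift P hv hT0 hper
  obtain ⟨C₄, hC₄, hfil⟩ := Params.exists_filters_le_of_periodic P hv hT0
  -- The region constant is dictated by uniqueness: a periodic solution in the ball has ‖q‖ ≤ b‖a‖,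
  -- and shifting adds at most C₃‖a‖² ≤ C₃‖a‖.
  obtain ⟨k, hk, B, hB, A, hA, σ, hσ, htrap⟩ := Params.exists_contracts_and_trapping (P := P)
    (c := b + C₃) hv (by linarith) hT0 hper hκ
  have hε := P.eps_pos
  -- The bound R/2, together with ‖a‖ < ρ, keeps r + p where `v` is the true shifted cost; ε/2 keeps
  -- states in the domain; 1 is required by the filter bounds.
  obtain ⟨ρ, hρ0, hρσ, hρσ₁, hρR, hρ1, hρε⟩ :
      ∃ ρ > 0, ρ ≤ σ ∧ ρ ≤ σ₁ ∧ ρ ≤ R / 2 ∧ ρ ≤ 1 ∧ ρ ≤ P.eps / 2 := by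
    refine ⟨min (min σ σ₁) (min (R / 2) (min 1 (P.eps / 2))), by positivity, ?_⟩
    simp
  obtain ⟨β, hβ, hmain⟩ := htrap ρ hρ0 hρσ
  refine ⟨min β ρ, by positivity, min β 1, by positivity, ρ, hρ0, A + C₄, by linarith, ?_⟩
  intro a ha0 ha hcone δ hδ0 hδ
  have haρ : ‖a‖ < ρ := ha.trans_le (min_le_right _ _)
  have hδ1 : δ ≤ 1 := hδ.le.trans (min_le_right _ _)
  obtain ⟨hcon, W, S, S', d, hW⟩ := hmain a δ ha0 (ha.trans_le (min_le_left _ _)) hcone hδ0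
    (hδ.trans_le (min_le_left _ _))
  have hlam : 0 < δ * (k * ‖a‖) := by positivity
  have hG : ∀ τ x, ‖x‖ < ρ → P.reducedField h l rstar a δ τ x = P.costField v a δ τ x :=
    fun τ x hx => P.reducedField_eq_costField hR (by linarith) τ hx
  have hder : ∀ z : ℝ → State, IsPeriodicSolution (P.reducedField h l rstar a δ) P.domain T z →
      (∀ τ, ‖z τ‖ < ρ) → ∀ τ, HasDerivAt z (P.costField v a δ τ (z τ)) τ := fun z hz hn τ => by
    have := (hz.1 τ (Set.mem_univ τ)).2
    rwa [hasDerivWithinAt_univ, hG τ _ (hn τ)] at this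
  obtain ⟨z, hz, hzn, hzb, hzr, hzs⟩ := hW.exists_stable_periodic hcon (by linarith) hlam hv hT0 hper
    hρε hG
  refine ⟨z, hz, hzn, fun w hw hwn => ?_, hzs, fun τ i => ?_⟩
  · refine hcon.eq_of_periodic hT0 hlam (hder w hw hwn) (hder z hz hzn) hw.2 hz.2 (fun τ => ?_) hzr
    have h1 := hest a δ w hδ0 (hder w hw hwn) hw.2 (fun τ => (hwn τ).le.trans hρσ₁) τ
    have h2 := (hsh a δ τ (w τ) hδ0.le hδ1).2
    refine ⟨(norm_fst_le (w τ)).trans (hwn τ).le, h2.trans ?_,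
      ((norm_snd_le (w τ).2.2).trans ((norm_snd_le (w τ).2).trans (norm_snd_le (w τ)))).trans
        (hwn τ).le⟩
    have h3 : ‖a‖ ^ 2 ≤ ‖a‖ := by nlinarith
    have h4 := mul_le_mul_of_nonneg_left h3 (by linarith : 0 ≤ C₃)
    linarith
  · obtain ⟨h1, -, h3, -⟩ := Params.abs_coords_le (z τ) i
    obtain ⟨h2, h4⟩ := hfil a δ z hδ0 (hder z hz hzn) hz.2 (fun τ => (hz.1 τ (Set.mem_univ τ)).1)
      (fun τ => (hzn τ).le.trans hρ1) τ i
    have e1 : A * (δ + ‖a‖ ^ 2) ≤ (A + C₄) * (δ + ‖a‖ ^ 2) :=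
      mul_le_mul_of_nonneg_right (by linarith) (by positivity)
    have e2 : C₄ * δ ≤ (A + C₄) * δ := mul_le_mul_of_nonneg_right (by linarith) hδ0.le
    exact ⟨h1.trans ((hzb τ).trans e1), h2.trans e2, h3.trans ((hzb τ).trans e1), h4.trans e2⟩
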